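/- Let $k$ be a field of characteristic $0$ and $A=k[[t]]$. For an $A$-algebra $\mathcal A$ write $\mathcal A|_{t^n}=\mathcal A/(t^n)$ and $\underline{\mathcal A}=\mathcal A/(t)$. **Objects.** Let $\mathcal C$ be the category of noetherian flat $A$-algebras $\mathcal A$ that are integral domains and whose closed fibre $\underline{\mathcal A}$ is an integral domain of one of the following kinds: (a) a formally smooth $k$-algebra whose module of Kähler differentials is finitely generated of rank one and whose residue fields at closed points are finite over $k$ (for instance the coordinate ring of a smooth affine curve, or a localisation of it at a closed point); (b) a finitely generated field of transcendence degree $1$ over $k$; (c) isomorphic to $k'[[s]]$, with $k'/k$ finite; (d) isomorphic to $k'((s))$, with $k'/k$ finite. Objects are topological rings: in cases (a), (b) with the $t$-adic topology; in case (c) with the $J$-adic topology, $J\ni t$ the maximal ideal lying over $(s)$; in case (d) with a topology induced from the product topology ($s$-adic in each coefficient) of $k'((s))[[t]]$ through some $A$-algebra homomorphism $\mathcal A\to k'((s))[[t]]$ that identifies $k'((s))[[t]]$ with the $t$-adic completion of $\mathcal A$. Quotients have the quotient topology, morphisms are continuous $A$-algebra homomorphisms, and isomorphisms and splittings are (bi)continuous.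 (Without continuity the statement is false in case (d).) $\Omega^1_{\underline{\mathcal A}/k}$ denotes continuous differentials: the quotient of the Kähler differentials by the elements killed by every continuous $k$-derivation into a Hausdorff topological module. In cases (a), (b) these are the usual Kähler differentials; for $k'[[s]]$ and $k'((s))$ they are free on $ds$. For $\tilde{\mathcal A},\hat{\mathcal A}\in\mathcal C$ and an isomorphism of $A$-algebras $\chi:\tilde{\mathcal A}|_{t^2}\to\hat{\mathcal A}|_{t^2}$ let $\times^3\beta(\tilde{\mathcal A},\hat{\mathcal A},\chi)$ be the set of pairs $(\tilde p,\hat p)$ of triples $\tilde p=(\tilde y_i)\in(\tilde{\mathcal A}^\times)^3$, $\hat p=(\hat y_i)\in(\hat{\mathcal A}^\times)^3$ with $\chi(\tilde y_i|_{t^2})=\hat y_i|_{t^2}$ for $1\le i\le 3$. **Explicit formula.** Let $R$ be a $k$-algebra, and let $\tilde q,\hat q$ be triples of units of $R[[t]]$ congruent modulo $t^2$, written uniquely as $\tilde y_i=\alpha_{0i}e^{\alpha_{1i}t+\tilde\alpha_{2i}t^2+\cdots}$ and $\hat y_i=\alpha_{0i}e^{\alpha_{1i}t+\hat\alpha_{2i}t^2+\cdots}$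 with coefficients in $R$. Put $$\Omega(\tilde q,\hat q)=\sum_{\sigma\in S_3}(-1)^\sigma\alpha_{1\sigma(1)}\,(\tilde\alpha_{2\sigma(3)}-\hat\alpha_{2\sigma(3)})\cdot d\log\alpha_{0\sigma(2)}\in\Omega^1_{R/k}.$$ **Germs.** A germ of $\mathcal A\in\mathcal C$ is a morphism $\iota:\mathcal A\to k'((s))[[t]]$, $k'/k$ finite, such that the induced map $\underline{\mathcal A}\to k'((s))$ is injective and the image of the fraction field of $\underline{\mathcal A}$ is dense; that is, $k'((s))[[t]]$ is the ($t$-completed) localisation at $(t)$ of the completion of $\mathcal A$ at a closed point (a place) of its closed fibre. A morphism $g:\mathcal A_1\to\mathcal A_2$ induces an isomorphism of germs if there is a germ $\iota$ of $\mathcal A_2$ such that $\iota\circ g$ is a germ of $\mathcal A_1$. **Theorem.** There is one and only one family of maps $$\omega(\cdot,\cdot,\chi):\times^3\beta(\tilde{\mathcal A},\hat{\mathcal A},\chi)\to\Omega^1_{\underline{\hat{\mathcal A}}/k},$$ for all $\tilde{\mathcal A},\hat{\mathcal A}\in\mathcal C$ and all isomorphisms $\chi$ as above, with the following three properties. (P1)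 If $\tilde{\mathcal A}=\hat{\mathcal A}=k'((s))[[t]]$ with $k'/k$ finite and $\chi=\mathrm{id}$, then $\omega(\tilde p,\hat p,\mathrm{id})=\Omega(\tilde p,\hat p)$. (P2) If $\tilde{\mathcal A}\to\tilde{\mathcal B}$ and $\hat{\mathcal A}\to\hat{\mathcal B}$ are the completions along the closed fibres, $\psi:\tilde{\mathcal B}|_{t^2}\to\hat{\mathcal B}|_{t^2}$ is the isomorphism induced by $\chi$, and $\tilde q,\hat q$ are the images of $\tilde p,\hat p$, then $\omega(\tilde p,\hat p,\chi)=\omega(\tilde q,\hat q,\psi)$ under $\underline{\hat{\mathcal A}}\cong\underline{\hat{\mathcal B}}$. (P3) Let $\chi_i:\tilde{\mathcal A}_i\to\hat{\mathcal A}_i$ ($i=1,2$) be isomorphisms and $f:\tilde{\mathcal A}_1\to\tilde{\mathcal A}_2$, $g:\hat{\mathcal A}_1\to\hat{\mathcal A}_2$ morphisms with $g\circ\chi_1=\chi_2\circ f$, such that $g$ induces an isomorphism of germs. Then $\underline g_*\,\omega(\tilde p,\hat p,\chi_1|_{t^2})=\omega(f(\tilde p),g(\hat p),\chi_2|_{t^2})$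 for all $(\tilde p,\hat p)\in\times^3\beta(\tilde{\mathcal A}_1,\hat{\mathcal A}_1,\chi_1|_{t^2})$. Moreover, let $\tilde{\mathcal A},\hat{\mathcal A}\in\mathcal C$ be $t$-adically complete and $\chi$ as above. Then $\chi$ lifts to an isomorphism $\tilde{\mathcal A}\to\hat{\mathcal A}$; the projection $\hat{\mathcal A}\to\underline{\hat{\mathcal A}}$ has a splitting; every splitting $\varphi$ extends uniquely to an isomorphism of rings $\overline\varphi:\underline{\hat{\mathcal A}}[[t]]\to\hat{\mathcal A}$ with $t\mapsto t$; and for every lifting $\overline\chi$ of $\chi$, every splitting $\varphi$ and every $(\tilde p,\hat p)\in\times^3\beta(\tilde{\mathcal A},\hat{\mathcal A},\chi)$ $$\omega(\tilde p,\hat p,\chi)=\Omega\big(\overline\varphi^{-1}(\overline\chi(\tilde p)),\,\overline\varphi^{-1}(\hat p)\big).$$ In particular the right-hand side does not depend on $\varphi$ and $\overline\chi$. -/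

import Mathlib

open scoped PowerSeries.WithPiTopology

noncomputable section

namespace CanonicalForm

universe u

/-! ### Continuous differentials -/

section Differentials

variable (k : Type u) [CommRing k]

/-- The Kähler differentials of the topological `k`-algebra `B` that are killed by every continuous
`k`-derivation of `B` into a Hausdorff topological `B`-module. -/
def nullForms (B : Type u) [CommRing B] [Algebra k B] [TopologicalSpace B] :
    Submodule B (KaehlerDifferential k B) where
  carrier := {w | ∀ (M : Type u) [AddCommGroup M] [Module B M] [Module k M] [IsScalarTower k B M]
    [TopologicalSpace M] [T2Space M] [IsTopologicalAddGroup M] [ContinuousSMul B M]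
    (D : Derivation k B M), Continuous D → D.liftKaehlerDifferential w = 0}
  add_mem' := by
    intro a b ha hb M _ _ _ _ _ _ _ _ D hD
    rw [map_add, ha M D hD, hb M D hD, add_zero]
  zero_mem' := by
    intro M _ _ _ _ _ _ _ _ D hD
    exact map_zero _
  smul_mem' := by
    intro c a ha M _ _ _ _ _ _ _ _ D hD
    rw [map_smul, ha M D hD, smul_zero]

/-- The `B`-module `Ω¹_{B/k}` of continuous differentials of the topological `k`-algebra `B`: the
target of the universal continuous `k`-derivation into Hausdorff topological modules. For discrete
`B` it is the usual module of Kähler differentials; for `k'⟦s⟧` and `k'((s))` with the `s`-adic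
topology it is free on `ds`. -/
abbrev Form (B : Type u) [CommRing B] [Algebra k B] [TopologicalSpace B] : Type u :=
  KaehlerDifferential k B ⧸ nullForms k B

/-- The class of `da` in the module of continuous differentials. -/
def Form.d {B : Type u} [CommRing B] [Algebra k B] [TopologicalSpace B] (a : B) : Form k B :=
  (nullForms k B).mkQ (KaehlerDifferential.D k B a)

/-- `d log a = a⁻¹ da` for a unit `a`. -/
def Form.dlog {B : Type u} [CommRing B] [Algebra k B] [TopologicalSpace B] (a : B) : Form k B :=
  Ring.inverse a • Form.d k a

/-- The map `a db ↦ φ(a) dφ(b)` on Kähler differentials. -/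
def kaehlerMap {B C : Type u} [CommRing B] [CommRing C] [Algebra k B] [Algebra k C]
    (φ : B →ₐ[k] C) : KaehlerDifferential k B →+ KaehlerDifferential k C :=
  letI : Algebra B C := φ.toRingHom.toAlgebra
  haveI : IsScalarTower k B C := IsScalarTower.of_algebraMap_eq' φ.comp_algebraMap.symm
  (KaehlerDifferential.map k k B C).toAddMonoidHom

lemma kaehlerMap_smul_D {B C : Type u} [CommRing B] [CommRing C] [Algebra k B] [Algebra k C]
    (φ : B →ₐ[k] C) (a b : B) :
    kaehlerMap k φ (a • KaehlerDifferential.D k B b) =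
      φ a • KaehlerDifferential.D k C (φ b) := by
  let : Algebra B C := φ.toRingHom.toAlgebra
  have : IsScalarTower k B C := IsScalarTower.of_algebraMap_eq' φ.comp_algebraMap.symm
  change KaehlerDifferential.map k k B C (a • KaehlerDifferential.D k B b) = _
  rw [map_smul, KaehlerDifferential.map_D]
  rfl

lemma kaehlerMap_mem_nullForms {B C : Type u} [CommRing B] [CommRing C] [Algebra k B] [Algebra k C]
    [TopologicalSpace B] [TopologicalSpace C] (φ : B →A[k] C) (w : KaehlerDifferential k B)
    (hw : w ∈ nullForms k B) : kaehlerMap k (φ : B →ₐ[k] C) w ∈ nullForms k C := by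
  intro M _ _ _ _ _ _ _ _ D hD
  let : Module B M := Module.compHom M (φ : B →ₐ[k] C).toRingHom
  have hsm : ∀ (b : B) (m : M), b • m = φ b • m := fun _ _ => rfl
  have : IsScalarTower k B M := ⟨fun x y z => by
    rw [hsm, hsm, show φ (x • y) = x • φ y from map_smul (φ : B →ₐ[k] C) x y, smul_assoc]⟩
  have : ContinuousSMul B M := ⟨by
    change Continuous fun p : B × M => φ p.1 • p.2
    exact (φ.continuous.comp continuous_fst).smul continuous_snd⟩
  let D' : Derivation k B M :=
    { toFun := fun b => D (φ b)
      map_add' := fun x y => by rw [map_add, map_add]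
      map_smul' := fun x y => by
        rw [show φ (x • y) = x • φ y from map_smul (φ : B →ₐ[k] C) x y, D.map_smul]; rfl
      map_one_eq_zero' := by simp
      leibniz' := fun x y => by
        change D (φ (x * y)) = _
        rw [map_mul, D.leibniz]; rfl }
  have hD' : Continuous D' := hD.comp φ.continuous
  have key : ∀ v : KaehlerDifferential k B,
      D.liftKaehlerDifferential (kaehlerMap k (φ : B →ₐ[k] C) v) =
        D'.liftKaehlerDifferential v := by
    intro v
    have hv : v ∈ Submodule.span B (Set.range (KaehlerDifferential.D k B)) := by
      rw [KaehlerDifferential.span_range_derivation]; trivial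
    induction hv using Submodule.span_induction with
    | mem x hx =>
      obtain ⟨b, rfl⟩ := hx
      have := kaehlerMap_smul_D k (φ : B →ₐ[k] C) 1 b
      rw [one_smul, map_one, one_smul] at this
      rw [this, Derivation.liftKaehlerDifferential_comp_D,
        Derivation.liftKaehlerDifferential_comp_D]
      rfl
    | zero => simp
    | add x y _ _ hx hy => rw [map_add, map_add, hx, hy, map_add]
    | smul a x _ hx =>
      have hax : kaehlerMap k (φ : B →ₐ[k] C) (a • x) =
          φ a • kaehlerMap k (φ : B →ₐ[k] C) x := by
        let : Algebra B C := (φ : B →ₐ[k] C).toRingHom.toAlgebra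
        have : IsScalarTower k B C :=
          IsScalarTower.of_algebraMap_eq' (φ : B →ₐ[k] C).comp_algebraMap.symm
        change KaehlerDifferential.map k k B C (a • x) = _
        rw [map_smul]
        rfl
      rw [hax, map_smul, map_smul, hx]
      rfl
  rw [key w]
  exact hw M D' hD'

/-- The map `φ_* : Ω¹_{B/k} → Ω¹_{C/k}`, `a db ↦ φ(a) dφ(b)`, induced by a continuous homomorphism
of `k`-algebras. -/
def Form.map {B C : Type u} [CommRing B] [CommRing C] [Algebra k B] [Algebra k C]
    [TopologicalSpace B] [TopologicalSpace C] (φ : B →A[k] C) : Form k B →+ Form k C :=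
  QuotientAddGroup.map (nullForms k B).toAddSubgroup (nullForms k C).toAddSubgroup
    (kaehlerMap k (φ : B →ₐ[k] C)) (fun w hw => kaehlerMap_mem_nullForms k φ w hw)

/-- `∑_{σ ∈ S₃} (-1)^σ α_{1σ(1)} (α̃_{2σ(3)} - α̂_{2σ(3)}) d log α_{0σ(2)}`; here `α i n` is the
coefficient written `α_{n i}` in the formula. -/
def formSum {B : Type u} [CommRing B] [Algebra k B] [TopologicalSpace B]
    (α' α'' : Fin 3 → ℕ → B) : Form k B :=
  ∑ σ : Equiv.Perm (Fin 3), (Equiv.Perm.sign σ : ℤ) •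
    ((α' (σ 0) 1 * (α' (σ 2) 2 - α'' (σ 2) 2)) • Form.dlog k (α' (σ 1) 0))

end Differentials

/-- `y = α₀ exp(α₁ t + α₂ t² + ⋯)` in `R⟦t⟧`. -/
def IsExpExpansion (k : Type u) [Field k] [CharZero k] {R : Type u} [CommRing R] [Algebra k R]
    (y : PowerSeries R) (α : ℕ → R) : Prop :=
  y = PowerSeries.C (α 0) *
    (PowerSeries.exp k).subst (PowerSeries.mk fun n => if n = 0 then 0 else α n)

/-- For triples `y'`, `y''` in `R⟦t⟧` that agree modulo `t²` and a homomorphism `ρ : R → B`, the form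
`w` on `B` is the value of the explicit formula: `y'` and `y''` have exponential expansions with
common coefficients in degrees `0` and `1`, and `w` is `formSum` of the images of the
coefficients. -/
def IsFormulaValue (k : Type u) [Field k] [CharZero k] {R B : Type u} [CommRing R] [Algebra k R]
    [CommRing B] [Algebra k B] [TopologicalSpace B] (ρ : R →+* B)
    (y' y'' : Fin 3 → PowerSeries R) (w : Form k B) : Prop :=
  ∃ α' α'' : Fin 3 → ℕ → R,
    (∀ i, IsExpExpansion k (y' i) (α' i)) ∧ (∀ i, IsExpExpansion k (y'' i) (α'' i)) ∧
    (∀ i, α' i 0 = α'' i 0 ∧ α' i 1 = α'' i 1) ∧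
    w = formSum k (fun i n => ρ (α' i n)) (fun i n => ρ (α'' i n))

/-! ### The category of smooth algebras of relative dimension at most one -/

section Smooth

variable (k : Type u) [Field k]

/-- The parameter `t` of `A = k⟦t⟧`, viewed in an `A`-algebra. -/
abbrev par (R : Type u) [CommRing R] [Algebra (PowerSeries k) R] : R :=
  algebraMap (PowerSeries k) R PowerSeries.X

/-- The truncation `R|_{tⁿ} = R/(tⁿ)`, with the quotient topology. -/
abbrev Trunc (R : Type u) [CommRing R] [Algebra (PowerSeries k) R] (n : ℕ) : Type u :=
  R ⧸ Ideal.span {par k R ^ n}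

/-- The closed fibre `R/(t)`, with the quotient topology. -/
abbrev Fibre (R : Type u) [CommRing R] [Algebra (PowerSeries k) R] : Type u :=
  R ⧸ Ideal.span {par k R}

/-- A ring homomorphism that induces isomorphisms `R/(aⁿ) ≅ S/(f(a)ⁿ)` for all `n`, that is, an
isomorphism on `a`-adic completions. -/
def IsAdicIso {R S : Type u} [CommRing R] [CommRing S] (f : R →+* S) (a : R) : Prop :=
  ∀ n : ℕ, (∀ x, f a ^ n ∣ f x → a ^ n ∣ x) ∧ ∀ y, ∃ x, f a ^ n ∣ y - f x

variable (R : Type u) [CommRing R] [TopologicalSpace R] [Algebra k R] [Algebra (PowerSeries k) R]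

/-- The closed fibre is a smooth curve over `k`: `R` has the `t`-adic topology, and `R/(t)` is
formally smooth over `k` with a finite module of differentials of rank one and with residue fields
at closed points finite over `k`. -/
def IsCurveKind : Prop :=
  IsAdic (Ideal.span {par k R}) ∧
  Algebra.FormallySmooth k (Fibre k R) ∧
  Module.Finite (Fibre k R) (KaehlerDifferential k (Fibre k R)) ∧
  Module.finrank (Fibre k R) (KaehlerDifferential k (Fibre k R)) = 1 ∧
  ∀ m : Ideal (Fibre k R), m.IsMaximal → Module.Finite k (Fibre k R ⧸ m)

/-- The closed fibre is a finitely generated field of transcendence degree one over `k`, and `R` has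
the `t`-adic topology. -/
def IsFunctionFieldKind : Prop :=
  IsAdic (Ideal.span {par k R}) ∧
  IsField (Fibre k R) ∧ Algebra.EssFiniteType k (Fibre k R) ∧ Algebra.trdeg k (Fibre k R) = 1

/-- The closed fibre is `k'⟦s⟧` with `k'/k` finite, and `R` has the `(s,t)`-adic topology. -/
def IsDiscKind : Prop :=
  ∃ (k' : Type u) (_ : Field k') (_ : Algebra k k'), FiniteDimensional k k' ∧
    Nonempty (Fibre k R ≃ₐ[k] PowerSeries k') ∧
    ∃ J : Ideal R, J.IsMaximal ∧ par k R ∈ J ∧ IsAdic J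

/-- The closed fibre is `k'((s))` with `k'/k` finite, and `R` carries the topology coming from the
`s`-adic topology of `k'((s))`: there is an isomorphism of the `t`-adic completion of `R` with
`k'((s))⟦t⟧` over `k⟦t⟧` such that the topology of `R` is the one induced from the product topology
(`s`-adic in each coefficient) of `k'((s))⟦t⟧`. -/
def IsPuncturedDiscKind : Prop :=
  ∃ (k' : Type u) (_ : Field k') (_ : Algebra k k'), FiniteDimensional k k' ∧
    ∃ ι : R →+* PowerSeries (LaurentSeries k'),
      (∀ a : PowerSeries k, ι (algebraMap (PowerSeries k) R a) =
        PowerSeries.map (algebraMap k (LaurentSeries k')) a) ∧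
      Topology.IsInducing ι ∧ IsAdicIso ι (par k R)

end Smooth

/-- The objects of the category: integral domains, smooth of relative dimension zero or one over
`A = k⟦t⟧`, with integral closed fibre of one of the admissible kinds. They are topological
algebras; the topology is `t`-adic except when the closed fibre is `k'⟦s⟧` or `k'((s))`, where the
`s`-adic topology of the fibre is taken into account. -/
structure Obj (k : Type u) [Field k] where
  carrier : Type u
  [commRing : CommRing carrier]
  [topologicalSpace : TopologicalSpace carrier]
  [isTopologicalRing : IsTopologicalRing carrier]
  [algebraBase : Algebra k carrier]
  [algebra : Algebra (PowerSeries k) carrier]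
  [isScalarTower : IsScalarTower k (PowerSeries k) carrier]
  noetherian : IsNoetherianRing carrier
  domain : IsDomain carrier
  flat : Module.Flat (PowerSeries k) carrier
  fibreDomain : IsDomain (Fibre k carrier)
  kind : IsCurveKind k carrier ∨ IsFunctionFieldKind k carrier ∨ IsDiscKind k carrier ∨
    IsPuncturedDiscKind k carrier

instance (k : Type u) [Field k] : CoeSort (Obj k) (Type u) := ⟨Obj.carrier⟩

attribute [instance] Obj.commRing Obj.topologicalSpace Obj.isTopologicalRing Obj.algebraBase
  Obj.algebra Obj.isScalarTower

variable {k : Type u} [Field k]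

/-- Morphisms and isomorphisms are over `A = k⟦t⟧` and (bi)continuous. -/
abbrev Obj.Hom (X Y : Obj k) : Type u := X →A[PowerSeries k] Y

/-- Isomorphisms of objects. -/
abbrev Obj.Iso (X Y : Obj k) : Type u := X ≃A[PowerSeries k] Y

/-- Isomorphisms `X|_{t²} → Y|_{t²}`. -/
abbrev Obj.Iso₂ (X Y : Obj k) : Type u := Trunc k X 2 ≃A[PowerSeries k] Trunc k Y 2

/-- The reduction `X → X|_{t²}`. -/
abbrev Obj.red₂ (X : Obj k) : X →+* Trunc k X 2 := Ideal.Quotient.mk _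

/-- The reduction `X → X/(t)`. -/
abbrev Obj.red (X : Obj k) : X →+* Fibre k X := Ideal.Quotient.mk _

/-- `X` is `t`-adically complete (and separated). -/
def Obj.IsComplete (X : Obj k) : Prop := IsAdicComplete (Ideal.span {par k X}) X

/-- The isomorphism `f` lifts `χ`; equivalently `χ = f|_{t²}`. -/
def Lifts {X Y : Obj k} (f : X.Iso Y) (χ : X.Iso₂ Y) : Prop :=
  ∀ x : X, χ (X.red₂ x) = Y.red₂ (f x)

lemma span_le_comap {X Y : Obj k} (g : X.Hom Y) :
    Ideal.span {par k X} ≤ (Ideal.span {par k Y}).comap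
      (g.restrictScalars k : X →ₐ[k] Y) := by
  rw [Ideal.span_le, Set.singleton_subset_iff]
  change g (par k X) ∈ Ideal.span {par k Y}
  rw [show g (par k X) = par k Y from g.toAlgHom.commutes _]
  exact Ideal.mem_span_singleton_self _

/-- The map `X/(t) → Y/(t)` induced by a morphism. -/
def Obj.Hom.fibre {X Y : Obj k} (g : X.Hom Y) : Fibre k X →A[k] Fibre k Y where
  toAlgHom := Ideal.quotientMapₐ _ (g.restrictScalars k : X →ₐ[k] Y) (span_le_comap g)
  cont := by
    refine Continuous.quotient_lift (f := fun x => Y.red (g x)) ?_ _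
    exact continuous_quot_mk.comp g.continuous

/-- The `Y`-valued `1`-forms: `Ω¹_{Y/(t) / k}`. -/
abbrev Obj.Ω (Y : Obj k) : Type u := Form k (Fibre k Y)

/-- The induced map `g_* : Ω¹_{X/(t)} → Ω¹_{Y/(t)}`. -/
def Obj.Hom.push {X Y : Obj k} (g : X.Hom Y) : X.Ω →+ Y.Ω := Form.map k g.fibre

/-! ### The object `k'((s))⟦t⟧` -/

section Laurent

variable (k) (k' : Type u) [Field k'] [Algebra k k']

/-- The ring `k'((s))⟦t⟧`; the type is kept opaque to instance search, so that its only structure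
of algebra over `k⟦t⟧` is the one given below. -/
def LaurentTube : Type u := PowerSeries (LaurentSeries k')

instance : CommRing (LaurentTube k') := inferInstanceAs (CommRing (PowerSeries (LaurentSeries k')))

instance : IsDomain (LaurentTube k') := inferInstanceAs (IsDomain (PowerSeries (LaurentSeries k')))

instance : IsNoetherianRing (LaurentTube k') :=
  inferInstanceAs (IsNoetherianRing (PowerSeries (LaurentSeries k')))

/-- The product topology of the `s`-adic topologies of the coefficients. -/
instance : TopologicalSpace (LaurentTube k') :=
  inferInstanceAs (TopologicalSpace (PowerSeries (LaurentSeries k')))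

instance : IsTopologicalRing (LaurentTube k') :=
  inferInstanceAs (IsTopologicalRing (PowerSeries (LaurentSeries k')))

/-- `k⟦t⟧` acts through `∑ aₙ tⁿ ↦ ∑ aₙ tⁿ`. -/
instance : Algebra (PowerSeries k) (LaurentTube k') :=
  RingHom.toAlgebra (S := LaurentTube k') (PowerSeries.map (algebraMap k (LaurentSeries k')))

instance : Algebra k (LaurentTube k') :=
  Algebra.compHom (LaurentTube k') (algebraMap k (PowerSeries k))

instance : IsScalarTower k (PowerSeries k) (LaurentTube k') :=
  IsScalarTower.of_algebraMap_eq fun _ => rfl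

lemma flat_of_injective (R : Type u) [CommRing R] [IsDomain R] [Algebra (PowerSeries k) R]
    (h : Function.Injective (algebraMap (PowerSeries k) R)) : Module.Flat (PowerSeries k) R := by
  rw [IsDedekindDomain.flat_iff_torsion_eq_bot, ← Submodule.isTorsionFree_iff_torsion_eq_bot,
    Module.isTorsionFree_iff_smul_eq_zero]
  intro a r
  rw [Algebra.smul_def, mul_eq_zero, map_eq_zero_iff _ h]
  exact id

/-- The object `k'((s))⟦t⟧`. -/
def laurent [FiniteDimensional k k'] : Obj k where
  carrier := LaurentTube k'
  commRing := inferInstance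
  topologicalSpace := inferInstance
  isTopologicalRing := inferInstance
  algebraBase := inferInstance
  algebra := inferInstance
  isScalarTower := inferInstance
  noetherian := inferInstance
  domain := inferInstance
  flat := flat_of_injective k _
    (PowerSeries.map_injective _ (algebraMap k (LaurentSeries k')).injective)
  fibreDomain := by
    rw [Ideal.Quotient.isDomain_iff_prime,
      show par k (LaurentTube k') = (PowerSeries.X : PowerSeries (LaurentSeries k')) from
        PowerSeries.map_X _]
    exact PowerSeries.span_X_isPrime (R := LaurentSeries k')
  kind := Or.inr (Or.inr (Or.inr ⟨k', inferInstance, inferInstance, inferInstance,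
    RingHom.id (LaurentTube k'), fun _ => rfl, Topology.IsInducing.id,
    fun _ => ⟨fun _ hx => hx, fun y => ⟨y, Dvd.intro_left 0 (by rw [zero_mul]; exact (sub_self y).symm)⟩⟩⟩))

/-- The elements of `laurent k k'` are the power series in `t` over `k'((s))`. -/
def laurentSeriesEquiv [FiniteDimensional k k'] :
    laurent k k' ≃+* PowerSeries (LaurentSeries k') :=
  RingEquiv.refl (PowerSeries (LaurentSeries k'))

end Laurent

/-- For `x` in `X`, the constant coefficient in `k'((s))` of the image of `x` in `k'((s))⟦t⟧`. -/
def residueMap {X : Obj k} {k' : Type u} [Field k'] [Algebra k k'] [FiniteDimensional k k']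
    (ι : X.Hom (laurent k k')) : X →+* LaurentSeries k' :=
  (PowerSeries.constantCoeff (R := LaurentSeries k')).comp
    ((laurentSeriesEquiv k k').toRingHom.comp (ι : X →ₐ[PowerSeries k] laurent k k').toRingHom)

/-- The morphism `ι : X → k'((s))⟦t⟧` is a formal germ of `X`: it identifies `k'((s))⟦t⟧` with the
(`t`-adically completed) localisation at `(t)` of the completion of `X` at a point of the closed
fibre. Equivalently, `X/(t) → k'((s))` is injective and identifies `k'((s))` with the completion of
the fraction field of `X/(t)` at a place with residue field `k'`. -/
def IsGerm {X : Obj k} {k' : Type u} [Field k'] [Algebra k k'] [FiniteDimensional k k']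
    (ι : X.Hom (laurent k k')) : Prop :=
  (∀ x : X, residueMap ι x = 0 → par k X ∣ x) ∧
  Dense {z : LaurentSeries k' | ∃ x y : X, z = residueMap ι x / residueMap ι y}

/-- `g` induces an isomorphism from a formal germ of `X` to a formal germ of `Y`. -/
def IsGermIso {X Y : Obj k} (g : X.Hom Y) : Prop :=
  ∃ (k' : Type u) (_ : Field k') (_ : Algebra k k') (_ : FiniteDimensional k k')
    (ι : Y.Hom (laurent k k')), IsGerm ι ∧ IsGerm (ι.comp g)

/-! ### The properties of the assignment `ω` -/

/-- The set `×³ β(X, Y, χ)` of pairs of triples of units that correspond modulo `t²`. -/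
structure Beta3 {X Y : Obj k} (χ : X.Iso₂ Y) where
  fst : Fin 3 → Xˣ
  snd : Fin 3 → Yˣ
  compat : ∀ i, χ (X.red₂ (fst i)) = Y.red₂ (snd i)

/-- `q` is the image of `p` under `f` on the first and `g` on the second triple. -/
def Beta3.IsImage {X Y X' Y' : Obj k} {χ : X.Iso₂ Y} {ψ : X'.Iso₂ Y'} (f : X.Hom X')
    (g : Y.Hom Y') (p : Beta3 χ) (q : Beta3 ψ) : Prop :=
  ∀ i, (q.fst i : X') = f (p.fst i) ∧ (q.snd i : Y') = g (p.snd i)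

variable (k) in
/-- A family of maps `ω(·,·,χ) : ×³ β(X, Y, χ) → Ω¹_{Y/(t) / k}`. -/
abbrev Assignment : Type (u + 1) := ∀ (X Y : Obj k) (χ : X.Iso₂ Y), Beta3 χ → Y.Ω

/-- Normalisation: the explicit formula for `X = Y = k'((s))⟦t⟧` and `χ = id`. -/
def Normalised [CharZero k] (ω : Assignment k) : Prop :=
  ∀ (k' : Type u) [Field k'] [Algebra k k'] [FiniteDimensional k k']
    (p : Beta3 (ContinuousAlgEquiv.refl (PowerSeries k) (Trunc k (laurent k k') 2))),
    IsFormulaValue k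
      ((laurent k k').red.comp
        ((laurentSeriesEquiv k k').symm.toRingHom.comp PowerSeries.C))
      (fun i => laurentSeriesEquiv k k' (p.fst i)) (fun i => laurentSeriesEquiv k k' (p.snd i))
      (ω (laurent k k') (laurent k k') (ContinuousAlgEquiv.refl _ _) p)

/-- `c : X → X'` is the completion of `X` along its closed fibre. -/
def IsCompletion {X X' : Obj k} (c : X.Hom X') : Prop :=
  X'.IsComplete ∧ IsAdicIso (c : X →ₐ[PowerSeries k] X').toRingHom (par k X)

/-- Compatibility with completion along the closed fibre. -/
def CompletionCompatible (ω : Assignment k) : Prop :=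
  ∀ (X Y X' Y' : Obj k) (c : X.Hom X') (d : Y.Hom Y'), IsCompletion c → IsCompletion d →
    ∀ (χ : X.Iso₂ Y) (ψ : X'.Iso₂ Y'),
      (∀ x y, χ (X.red₂ x) = Y.red₂ y → ψ (X'.red₂ (c x)) = Y'.red₂ (d y)) →
    ∀ (p : Beta3 χ) (q : Beta3 ψ), p.IsImage c d q → d.push (ω X Y χ p) = ω X' Y' ψ q

/-- Functoriality for commutative squares
`χ₁ : X₁ ≅ Y₁`, `χ₂ : X₂ ≅ Y₂`, `f : X₁ → X₂`, `g : Y₁ → Y₂`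
in which `g` (hence also `f`) induces an isomorphism of formal germs. -/
def Functorial (ω : Assignment k) : Prop :=
  ∀ (X₁ Y₁ X₂ Y₂ : Obj k) (χ₁ : X₁.Iso Y₁) (χ₂ : X₂.Iso Y₂) (f : X₁.Hom X₂) (g : Y₁.Hom Y₂),
    (∀ x, g (χ₁ x) = χ₂ (f x)) → IsGermIso g →
    ∀ (ψ₁ : X₁.Iso₂ Y₁) (ψ₂ : X₂.Iso₂ Y₂), Lifts χ₁ ψ₁ → Lifts χ₂ ψ₂ →
    ∀ (p : Beta3 ψ₁) (q : Beta3 ψ₂), p.IsImage f g q →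
      g.push (ω X₁ Y₁ ψ₁ p) = ω X₂ Y₂ ψ₂ q

/-- `φ` is a splitting of `Y → Y/(t)`. -/
def IsSplitting {Y : Obj k} (φ : Fibre k Y →A[k] Y) : Prop := ∀ a, Y.red (φ a) = a

/-- `e` is the isomorphism `(Y/(t))⟦t⟧ ≅ Y` that extends the splitting `φ` and sends `t` to `t`. -/
def ExtendsSplitting {Y : Obj k} (φ : Fibre k Y →A[k] Y) (e : PowerSeries (Fibre k Y) ≃+* Y) :
    Prop :=
  (∀ a, e (PowerSeries.C a) = φ a) ∧ e PowerSeries.X = par k Y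

/-- The defining formula, for objects complete along the closed fibre: `χ` has liftings, `Y → Y/(t)`
has splittings, and for every lifting `f` of `χ` and every splitting `φ`, with the extension
`e : (Y/(t))⟦t⟧ ≅ Y` of `φ`, the explicit formula for the triples `e⁻¹(f(p̃))`, `e⁻¹(p̂)` has the
value `ω(p̃, p̂, χ)`. -/
def DefinedByFormula [CharZero k] (ω : Assignment k) : Prop :=
  ∀ (X Y : Obj k), X.IsComplete → Y.IsComplete → ∀ χ : X.Iso₂ Y,
    (∃ f : X.Iso Y, Lifts f χ) ∧ (∃ φ : Fibre k Y →A[k] Y, IsSplitting φ) ∧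
    ∀ f : X.Iso Y, Lifts f χ → ∀ φ : Fibre k Y →A[k] Y, IsSplitting φ →
      (∃! e : PowerSeries (Fibre k Y) ≃+* Y, ExtendsSplitting φ e) ∧
      ∀ e : PowerSeries (Fibre k Y) ≃+* Y, ExtendsSplitting φ e → ∀ p : Beta3 χ,
        IsFormulaValue k (RingHom.id (Fibre k Y)) (fun i => e.symm (f (p.fst i)))
          (fun i => e.symm (p.snd i)) (ω X Y χ p)

end CanonicalForm

/-!
The canonical form is computed in coordinates. A *presentation* of an isomorphism `χ : X|_{t²} ≅ Y|_{t²}`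
consists of homomorphisms `l : X → B⟦t⟧` and `κ : Y → B⟦t⟧` over `k⟦t⟧` that agree modulo `t²` along
`χ`, where `B` contains the closed fibre of `Y` (`IsPresentation`). In a presentation, the explicit
formula assigns a form to `(p̃, p̂)`; only the coefficients of `1`, `t` and `t²` enter (`formValue`).

The central fact is that this form does not depend on the presentation
(`formValue_eq_of_isPresentation`). Passing from one presentation to another changes the coefficients
of `t` by a continuous derivation `E` of the closed fibre, and the differences of the coefficients of
`t²` of `l` and `κ` by a second one, `H`. The continuous differentials of the closed fibre are
torsion-free of rank one (`hasRankOneForms_fibre`), so any two derivations are proportional and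
`E(a) db = E(b) da`, likewise for `H`. Each contribution to the change of the formula is thus symmetric
under a transposition of the three indices and cancels in the alternating sum
(`formValue_eq_of_antisymmetric`).

Presentations exist. Every object has a *chart*, a homomorphism `Y → (Y/(t))⟦t⟧` over `k⟦t⟧` that lifts
the reduction and induces the topology (`exists_isChart`): for curves and function fields from formal
smoothness of the fibre, for discs by lifting the coefficient field `k'`, which is étale over `k`, and
substituting a lift of `s`, and for punctured discs from the definition. In charts, `χ` differs from an
isomorphism of closed fibres by a continuous derivation `δ` in degree one, and `exp(t δ)` lifts it to an
isomorphism of power series rings (`exists_powerSeries_lift`).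

Define `ω` by the formula in a chosen presentation (`canonicalForm`). Presentations can be pulled back
along morphisms and extended along injective homomorphisms of coefficients (`push_canonicalForm`),
which gives both compatibilities; the normalisation and the formula for complete objects hold since
tautological coordinates, or a lifting of `χ` together with a splitting, are presentations as well.

For uniqueness, every closed fibre embeds into some `k'((s))`, `k'/k` finite, with dense field of
quotients (`exists_fibre_germ`): take a closed point of the curve, or of an affine model of the function
field, and expand. The axioms then determine the image of `ω` in the differentials of `k'((s))`, and the
map of differentials is injective (`Form.map_injective_of_dense`).
-/

namespace CanonicalForm

/-! ### Evaluation of power series in adically complete rings -/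

section Evaluation

variable {A C : Type*} [CommRing A] [CommRing C]

lemma mem_span_pow_iff_dvd {S x : C} {n : ℕ} : x ∈ Ideal.span {S} ^ n ↔ S ^ n ∣ x := by
  rw [Ideal.span_singleton_pow, Ideal.mem_span_singleton]

lemma smodEq_span_pow_iff {S x y : C} {n : ℕ} :
    x ≡ y [SMOD (Ideal.span {S} ^ n • ⊤ : Submodule C C)] ↔ S ^ n ∣ x - y := by
  rw [SModEq.sub_mem, smul_eq_mul, Ideal.mul_top, mem_span_pow_iff_dvd]

lemma eq_zero_of_forall_pow_dvd {S : C} [IsHausdorff (Ideal.span {S}) C] {x : C}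
    (h : ∀ n : ℕ, S ^ n ∣ x) : x = 0 :=
  IsHausdorff.haus ‹_› x fun n => by
    rw [smodEq_span_pow_iff, sub_zero]; exact h n

lemma exists_limit_of_pow_dvd {S : C} [IsPrecomplete (Ideal.span {S}) C] (f : ℕ → C)
    (h : ∀ n, S ^ n ∣ f (n + 1) - f n) : ∃ L, ∀ n, S ^ n ∣ L - f n := by
  have h' : ∀ {m n : ℕ}, m ≤ n → S ^ m ∣ f n - f m := by
    intro m n hmn
    induction n, hmn using Nat.le_induction with
    | base => simp
    | succ n hmn ih =>
      have := dvd_add ((pow_dvd_pow S hmn).trans (h n)) ih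
      rwa [sub_add_sub_cancel] at this
  obtain ⟨L, hL⟩ := IsPrecomplete.prec ‹IsPrecomplete (Ideal.span {S}) C› (f := f)
    fun {m n} hmn => by rw [smodEq_span_pow_iff, dvd_sub_comm]; exact h' hmn
  exact ⟨L, fun n => by rw [dvd_sub_comm, ← smodEq_span_pow_iff]; exact hL n⟩

/-- It suffices to test precompleteness on sequences with `Sⁿ ∣ fₙ₊₁ - fₙ`. -/
lemma isPrecomplete_span_singleton {S : C}
    (h : ∀ f : ℕ → C, (∀ n, S ^ n ∣ f (n + 1) - f n) → ∃ L, ∀ n, S ^ n ∣ L - f n) :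
    IsPrecomplete (Ideal.span {S}) C where
  prec' f hf := by
    obtain ⟨L, hL⟩ := h f fun n => by
      rw [dvd_sub_comm, ← smodEq_span_pow_iff]; exact hf n.le_succ
    exact ⟨L, fun n => by rw [smodEq_span_pow_iff, dvd_sub_comm]; exact hL n⟩

lemma isHausdorff_span_singleton {S : C} (h : ∀ x : C, (∀ n : ℕ, S ^ n ∣ x) → x = 0) :
    IsHausdorff (Ideal.span {S}) C where
  haus' x hx := h x fun n => by
    have := hx n; rwa [smodEq_span_pow_iff, sub_zero] at this

open PowerSeries in
/-- Every power series is its truncation plus a multiple of `Xⁿ`. -/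
lemma exists_eq_trunc_add (f : PowerSeries A) (n : ℕ) :
    ∃ g : PowerSeries A, f = (trunc n f : PowerSeries A) + X ^ n * g := by
  have : X ^ n ∣ f - (trunc n f : PowerSeries A) := by
    rw [X_pow_dvd_iff]
    intro m hm
    rw [map_sub, Polynomial.coeff_coe, coeff_trunc, if_pos hm, sub_self]
  obtain ⟨g, hg⟩ := this
  exact ⟨g, by rw [← hg]; ring⟩

/-- Ring homomorphisms on power series agree on polynomials once they agree on constants and on
the variable. -/
lemma map_polynomial_eq (E : PowerSeries A →+* C) (p : Polynomial A) :
    E p = p.eval₂ (E.comp PowerSeries.C) (E PowerSeries.X) := by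
  induction p using Polynomial.induction_on' with
  | add p q hp hq => rw [Polynomial.coe_add, map_add, hp, hq, Polynomial.eval₂_add]
  | monomial n a =>
    rw [Polynomial.eval₂_monomial, Polynomial.coe_monomial, PowerSeries.monomial_eq_C_mul_X_pow,
      map_mul, map_pow]
    rfl

/-- A homomorphism out of `A⟦X⟧` into a ring that is separated for the image of `X` is determined
by its values on constants and on `X`. -/
lemma powerSeries_hom_ext {E E' : PowerSeries A →+* C} (hC : ∀ a, E (PowerSeries.C a) =
    E' (PowerSeries.C a)) (hX : E PowerSeries.X = E' PowerSeries.X)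
    [IsHausdorff (Ideal.span {E PowerSeries.X}) C] : E = E' := by
  ext f
  rw [← sub_eq_zero]
  refine eq_zero_of_forall_pow_dvd (S := E PowerSeries.X) fun n => ?_
  obtain ⟨g, hg⟩ := exists_eq_trunc_add f n
  have : E.comp PowerSeries.C = E'.comp PowerSeries.C := by ext a; exact hC a
  rw [hg, map_add, map_add, map_polynomial_eq, map_polynomial_eq, this, ← hX, map_mul, map_mul,
    map_pow, map_pow, ← hX, add_sub_add_left_eq_sub, ← mul_sub]
  exact Dvd.intro _ rfl

lemma pow_dvd_eval₂ (S : C) (φ : A →+* C) {n : ℕ} {p q : Polynomial A}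
    (h : ∀ m < n, p.coeff m = q.coeff m) : S ^ n ∣ p.eval₂ φ S - q.eval₂ φ S := by
  rw [← Polynomial.eval₂_sub]
  obtain ⟨r, hr⟩ := (Polynomial.X_pow_dvd_iff (f := p - q)).2 fun m hm => by
    rw [Polynomial.coeff_sub, h m hm, sub_self]
  rw [hr, Polynomial.eval₂_mul, Polynomial.eval₂_pow, Polynomial.eval₂_X]
  exact Dvd.intro _ rfl

open PowerSeries in
/-- In an `S`-adically complete ring a power series can be evaluated at `S`. -/
lemma exists_powerSeries_eval (S : C) [IsAdicComplete (Ideal.span {S}) C] (φ : A →+* C) :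
    ∃ E : PowerSeries A →+* C, (∀ a, E (PowerSeries.C a) = φ a) ∧ E PowerSeries.X = S := by
  have key : ∀ f : PowerSeries A, ∃ L : C, ∀ n, S ^ n ∣ L - (trunc n f).eval₂ φ S := fun f =>
    exists_limit_of_pow_dvd (fun n => (trunc n f).eval₂ φ S) fun n =>
      pow_dvd_eval₂ S φ fun m hm => by
        rw [coeff_trunc, coeff_trunc, if_pos hm, if_pos (hm.trans n.lt_succ_self)]
  choose E hE using key
  -- The value of a series is the limit of the values of its truncations, hence compatible with sums
  -- and products.
  have uniq : ∀ f (c : C), (∀ n, S ^ n ∣ c - (trunc n f).eval₂ φ S) → E f = c := by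
    intro f c hc
    rw [← sub_eq_zero]
    refine eq_zero_of_forall_pow_dvd (S := S) fun n => ?_
    have := dvd_sub (hE f n) (hc n)
    rwa [sub_sub_sub_cancel_right] at this
  have poly : ∀ p : Polynomial A, E p = p.eval₂ φ S := fun p => uniq _ _ fun n =>
    pow_dvd_eval₂ S φ fun m hm => by rw [coeff_trunc, if_pos hm, Polynomial.coeff_coe]
  refine ⟨{ toFun := E, map_one' := ?_, map_mul' := ?_, map_zero' := ?_, map_add' := ?_ }, ?_, ?_⟩
  · simpa using poly 1
  · intro f g
    refine uniq _ _ fun n => ?_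
    have h1 : S ^ n ∣ E f * E g - (trunc n f).eval₂ φ S * (trunc n g).eval₂ φ S := by
      have := dvd_add ((hE f n).mul_right (E g)) ((hE g n).mul_left ((trunc n f).eval₂ φ S))
      convert this using 1; ring
    have h2 := pow_dvd_eval₂ S φ (n := n) (p := trunc n f * trunc n g) (q := trunc n (f * g))
      fun m hm => by
        rw [coeff_trunc, if_pos hm, coeff_mul_eq_coeff_trunc_mul_trunc f g hm,
          ← Polynomial.coeff_coe, Polynomial.coe_mul]
    rw [Polynomial.eval₂_mul] at h2
    have := dvd_add h1 h2
    rwa [sub_add_sub_cancel] at this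
  · simpa using poly 0
  · intro f g
    refine uniq _ _ fun n => ?_
    have := dvd_add (hE f n) (hE g n)
    rw [map_add, Polynomial.eval₂_add]
    convert this using 1; ring
  · intro a; simpa using poly (Polynomial.C a)
  · simpa using poly Polynomial.X

/-- If `C` is complete for the nonzerodivisor `S`, a map `φ : A → C` that is bijective modulo `S`
identifies `A⟦X⟧` with `C`. -/
lemma powerSeries_eval_bijective {S : C} [IsAdicComplete (Ideal.span {S}) C]
    (hS : ∀ x, S * x = 0 → x = 0) {φ : A →+* C} (hinj : ∀ a, S ∣ φ a → a = 0)
    (hsurj : ∀ c, ∃ a, S ∣ c - φ a) {E : PowerSeries A →+* C}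
    (hC : ∀ a, E (PowerSeries.C a) = φ a) (hX : E PowerSeries.X = S) :
    Function.Bijective E := by
  have hS' : ∀ (n : ℕ) x, S ^ n * x = 0 → x = 0 := by
    intro n
    induction n with
    | zero => intro x hx; simpa using hx
    | succ n ih => intro x hx; exact hS _ (ih _ (by rw [← mul_assoc, ← pow_succ]; exact hx))
  constructor
  · rw [injective_iff_map_eq_zero]
    intro f hf
    ext n
    rw [map_zero]
    induction n using Nat.strong_induction_on with
    | _ n ih =>
      obtain ⟨g, rfl⟩ := PowerSeries.X_pow_dvd_iff.2 ih
      rw [map_mul, map_pow, hX] at hf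
      have hg := hS' n _ hf
      rw [PowerSeries.coeff_X_pow_mul', if_pos le_rfl, Nat.sub_self]
      obtain ⟨g', hg'⟩ := PowerSeries.X_dvd_iff.2 (show PowerSeries.constantCoeff
        (g - PowerSeries.C (PowerSeries.coeff 0 g)) = 0 by simp)
      rw [sub_eq_iff_eq_add.1 hg', map_add, map_mul, hX, hC] at hg
      exact hinj _ ⟨- E g', by rw [mul_neg]; exact (neg_eq_of_add_eq_zero_right hg).symm⟩
  · intro c
    -- Successive division by `S`: `c = φ(a₀) + S φ(a₁) + ⋯ + Sⁿ rₙ`.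
    choose a ha using hsurj
    choose b hb using ha
    let r : ℕ → C := fun n => (b^[n]) c
    let f : PowerSeries A := PowerSeries.mk fun n => a (r n)
    refine ⟨f, ?_⟩
    have hr : ∀ n, r n = φ (a (r n)) + S * r (n + 1) := fun n => by
      have h1 : r (n + 1) = b (r n) := Function.iterate_succ_apply' b n c
      rw [h1, ← hb (r n)]; ring
    have hc : ∀ n, c = (PowerSeries.trunc n f).eval₂ φ S + S ^ n * r n := by
      intro n
      induction n with
      | zero => simp [r]
      | succ n ih =>
        rw [PowerSeries.trunc_succ, Polynomial.eval₂_add, Polynomial.eval₂_monomial,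
          PowerSeries.coeff_mk]
        rw [hr n] at ih
        refine ih.trans ?_
        ring
    rw [← sub_eq_zero]
    refine eq_zero_of_forall_pow_dvd (S := S) fun n => ?_
    obtain ⟨g, hg⟩ := exists_eq_trunc_add f n
    have hφ : E.comp PowerSeries.C = φ := RingHom.ext hC
    have h1 : E f = (PowerSeries.trunc n f).eval₂ φ S + S ^ n * E g := by
      conv_lhs => rw [hg]
      rw [map_add, map_polynomial_eq, hφ, map_mul, map_pow, hX]
    have h2 : E f - c = S ^ n * (E g - r n) := by
      rw [h1]
      nth_rw 1 [hc n]
      ring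
    rw [h2]
    exact Dvd.intro _ rfl

/-- A ring that is complete for a nonzerodivisor `t` and complete for `S` modulo `t` is complete
for `S`. -/
lemma isAdicComplete_of_quotient {t S : C} [IsAdicComplete (Ideal.span {t}) C]
    (ht : ∀ x, t * x = 0 → x = 0) (hSt : ∀ x, t ∣ S * x → t ∣ x)
    (hsep : ∀ x, (∀ n : ℕ, ∃ y, t ∣ x - S ^ n * y) → t ∣ x)
    (hcomp : ∀ u : ℕ → C, ∃ v : ℕ → C, ∀ n, t ∣ v n - (u n + S * v (n + 1))) :
    IsAdicComplete (Ideal.span {S}) C := by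
  have hSt' : ∀ (n : ℕ) x, t ∣ S ^ n * x → t ∣ x := by
    intro n
    induction n with
    | zero => intro x hx; simpa using hx
    | succ n ih => intro x hx; exact ih _ (hSt _ (by rwa [← mul_assoc, ← pow_succ']))
  -- An element divisible by all powers of `S` is `t` times another such element.
  have step : ∀ x, (∀ n : ℕ, S ^ n ∣ x) → ∃ y, x = t * y ∧ ∀ n : ℕ, S ^ n ∣ y := by
    intro x hx
    obtain ⟨y, rfl⟩ := hsep x fun n => by
      obtain ⟨y, rfl⟩ := hx n
      exact ⟨y, by simp⟩
    refine ⟨y, rfl, fun n => ?_⟩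
    obtain ⟨z, hz⟩ := hx n
    obtain ⟨w, rfl⟩ := hSt' n z ⟨y, hz.symm⟩
    refine ⟨w, sub_eq_zero.1 (ht _ ?_)⟩
    rw [mul_sub, hz]; ring
  have hH : IsHausdorff (Ideal.span {S}) C := isHausdorff_span_singleton fun x hx => by
    refine eq_zero_of_forall_pow_dvd (S := t) fun m => ?_
    suffices ∃ y, x = t ^ m * y ∧ ∀ n : ℕ, S ^ n ∣ y by
      obtain ⟨y, hy, _⟩ := this; exact ⟨y, hy⟩
    induction m with
    | zero => exact ⟨x, by simp, hx⟩
    | succ m ih =>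
      obtain ⟨y, hy, hy'⟩ := ih
      obtain ⟨z, rfl, hz⟩ := step y hy'
      exact ⟨z, by rw [hy, pow_succ, mul_assoc], hz⟩
  -- The operator `v ↦ (vₙ - S vₙ₊₁)` on sequences is onto, since it is so modulo `t`.
  have solve : ∀ u : ℕ → C, ∃ v : ℕ → C, ∀ n, v n = u n + S * v (n + 1) := by
    intro u
    -- Solve modulo `t`, divide the error by `t`, and iterate; the sums `P m` converge `t`-adically.
    choose V hV using hcomp
    choose W hW using hV
    let U : ℕ → ℕ → C := fun m => (fun u n => - W u n)^[m] u
    have hU : ∀ m n, V (U m) n = U m n + S * V (U m) (n + 1) - t * U (m + 1) n := by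
      intro m n
      have h1 : U (m + 1) n = - W (U m) n := by
        change ((fun u n => - W u n)^[m + 1] u) n = _
        rw [Function.iterate_succ_apply']
      rw [h1, ← sub_eq_zero, mul_neg, ← hW (U m) n]; ring
    let P : ℕ → ℕ → C := fun m n => ∑ i ∈ Finset.range m, t ^ i * V (U i) n
    have hP : ∀ m n, P m n = u n + S * P m (n + 1) - t ^ m * U m n := by
      intro m n
      induction m with
      | zero => simp [P, U]
      | succ m ih =>
        change ∑ i ∈ Finset.range (m + 1), _ = u n + S * ∑ i ∈ Finset.range (m + 1), _ - _
        rw [Finset.sum_range_succ, Finset.sum_range_succ]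
        change P m n + _ = u n + S * (P m (n + 1) + _) - _
        rw [ih, hU m n]; ring
    have hlim : ∀ n, ∃ L, ∀ m, t ^ m ∣ L - P m n := fun n =>
      exists_limit_of_pow_dvd (fun m => P m n) fun m => by
        change t ^ m ∣ ∑ i ∈ Finset.range (m + 1), _ - ∑ i ∈ Finset.range m, _
        rw [Finset.sum_range_succ, add_sub_cancel_left]
        exact Dvd.intro _ rfl
    choose v hv using hlim
    refine ⟨v, fun n => ?_⟩
    rw [← sub_eq_zero]
    refine eq_zero_of_forall_pow_dvd (S := t) fun m => ?_
    have h1 := dvd_sub (hv n m) ((hv (n + 1) m).mul_left S)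
    have h2 := dvd_sub h1 (Dvd.intro (U m n) rfl)
    rw [hP m n] at h2
    convert h2 using 1
    ring
  have hPre : IsPrecomplete (Ideal.span {S}) C := isPrecomplete_span_singleton fun f hf => by
    choose u hu using hf
    obtain ⟨v, hv⟩ := solve u
    refine ⟨f 0 + v 0, fun n => ⟨v n, ?_⟩⟩
    induction n with
    | zero => simp
    | succ n ih =>
      have h1 : f (n + 1) = f n + S ^ n * u n := by rw [← hu n]; ring
      rw [h1, ← sub_sub, ih]
      nth_rw 1 [hv n]
      ring
  exact { hH, hPre with }

end Evaluation

/-! ### Exponential expansions -/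

section Exponential

open PowerSeries

lemma natCast_succ_mul_cancel (k : Type u) [Field k] [CharZero k] {R : Type u} [CommRing R]
    [Algebra k R] {n : ℕ} {x y : R} (h : (n + 1 : R) * x = (n + 1) * y) : x = y := by
  have h1 : algebraMap k R ((n + 1 : k)⁻¹) * (n + 1 : R) = 1 := by
    rw [show (n + 1 : R) = algebraMap k R (n + 1) by simp, ← map_mul,
      inv_mul_cancel₀ (by exact_mod_cast n.succ_ne_zero), map_one]
  calc x = algebraMap k R ((n + 1 : k)⁻¹) * ((n + 1 : R) * x) := by rw [← mul_assoc, h1, one_mul]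
    _ = y := by rw [h, ← mul_assoc, h1, one_mul]

/-- A solution of `f' = f h` is determined by its constant term. -/
lemma eq_of_derivative_eq_mul (k : Type u) [Field k] [CharZero k] {R : Type u} [CommRing R]
    [Algebra k R] {f f' h : PowerSeries R} (hf : d⁄dX R f = f * h)
    (hf' : d⁄dX R f' = f' * h) (h0 : coeff 0 f = coeff 0 f') : f = f' := by
  ext n
  induction n using Nat.strong_induction_on with
  | _ n ih =>
    cases n with
    | zero => exact h0
    | succ n =>
      have e1 := congrArg (coeff n) hf
      have e2 := congrArg (coeff n) hf'
      rw [coeff_derivative, coeff_mul, mul_comm] at e1 e2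
      refine natCast_succ_mul_cancel k (n := n) ?_
      rw [e1, e2]
      refine Finset.sum_congr rfl fun p hp => ?_
      rw [ih p.1 (by have := Finset.HasAntidiagonal.mem_antidiagonal.1 hp; omega)]

variable (k : Type u) [Field k] [CharZero k] {R : Type u} [CommRing R] [Algebra k R]

/-- The substitution `exp(g)` solves `f' = f g'`. -/
lemma exp_subst_derivative {g : PowerSeries R} (hg : constantCoeff g = 0) :
    d⁄dX R ((exp k).subst g) = (exp k).subst g * d⁄dX R g := by
  let : Algebra ℚ R := Algebra.compHom R (algebraMap ℚ k)
  have : IsScalarTower ℚ k R := IsScalarTower.of_algebraMap_eq fun _ => rfl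
  have hs : HasSubst g := HasSubst.of_constantCoeff_zero' hg
  have h : (exp k).subst g = (exp R).subst g := by
    ext n
    rw [coeff_subst' hs, coeff_subst' hs]
    refine finsum_congr fun d => ?_
    rw [coeff_exp, coeff_exp, Algebra.smul_def, smul_eq_mul, ← IsScalarTower.algebraMap_apply]
  rw [h, derivative_subst hs, derivative_exp]

lemma exp_subst_constantCoeff {g : PowerSeries R} (hg : constantCoeff g = 0) :
    constantCoeff ((exp k).subst g) = 1 := by
  have hs : HasSubst g := HasSubst.of_constantCoeff_zero' hg
  have h : constantCoeff ((exp k).subst g) = _ := constantCoeff_subst hs (exp k)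
  rw [h, finsum_eq_single _ 0]
  · simp
  · intro n hn
    rw [map_pow, show MvPowerSeries.constantCoeff g = 0 from hg, zero_pow hn, smul_zero]

/-- Units have exponential expansions: the exponent is the integral of the logarithmic derivative
`y'/y`. -/
lemma exists_isExpExpansion {y : PowerSeries R} (hy : IsUnit y) :
    ∃ α : ℕ → R, IsExpExpansion k y α := by
  obtain ⟨v, hv⟩ := hy.exists_right_inv
  set h := d⁄dX R y * v with hh
  let α : ℕ → R := fun n => if n = 0 then coeff 0 y else
    algebraMap k R ((n : k)⁻¹) * coeff (n - 1) h
  refine ⟨α, ?_⟩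
  set g : PowerSeries R := PowerSeries.mk fun n => if n = 0 then 0 else α n with hgdef
  have hg : constantCoeff g = 0 := by
    rw [← coeff_zero_eq_constantCoeff_apply, hgdef, coeff_mk, if_pos rfl]
  have hg' : d⁄dX R g = h := by
    ext n
    rw [coeff_derivative, hgdef, coeff_mk, if_neg n.succ_ne_zero]
    simp only [α, if_neg n.succ_ne_zero, Nat.add_sub_cancel]
    rw [show (n + 1 : R) = algebraMap k R ((n + 1 : ℕ) : k) by simp, mul_right_comm, ← map_mul,
      inv_mul_cancel₀ (by exact_mod_cast n.succ_ne_zero), map_one, one_mul]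
  change y = C (α 0) * (exp k).subst g
  refine eq_of_derivative_eq_mul k (h := h) ?_ ?_ ?_
  · rw [hh, mul_left_comm, hv, mul_one]
  · rw [Derivation.leibniz, exp_subst_derivative k hg, hg', smul_eq_mul, smul_eq_mul,
      derivative_C, mul_zero, add_zero, mul_assoc]
  · rw [coeff_zero_eq_constantCoeff_apply, coeff_zero_eq_constantCoeff_apply, map_mul,
      exp_subst_constantCoeff k hg]
    simp [α]

/-- The first coefficients of `α₀ exp(α₁ t + α₂ t² + ⋯)`, with denominators cleared. -/
lemma IsExpExpansion.coeffs {y : PowerSeries R} {α : ℕ → R} (h : IsExpExpansion k y α) :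
    coeff 0 y = α 0 ∧ coeff 1 y = α 0 * α 1 ∧
      2 * coeff 2 y = α 0 * (2 * α 2 + α 1 ^ 2) := by
  set g : PowerSeries R := PowerSeries.mk fun n => if n = 0 then 0 else α n with hgdef
  have hg : constantCoeff g = 0 := by
    rw [← coeff_zero_eq_constantCoeff_apply, hgdef, coeff_mk, if_pos rfl]
  have hy : y = C (α 0) * (exp k).subst g := h
  set G := (exp k).subst g with hG
  have h0 : coeff 0 G = 1 := by
    rw [coeff_zero_eq_constantCoeff_apply, exp_subst_constantCoeff k hg]
  have hD := exp_subst_derivative k hg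
  rw [← hG] at hD
  have h1 := congrArg (coeff 0) hD
  have h2 := congrArg (coeff 1) hD
  have g1 : coeff 1 g = α 1 := by rw [hgdef, coeff_mk, if_neg one_ne_zero]
  have g2 : coeff 2 g = α 2 := by rw [hgdef, coeff_mk, if_neg two_ne_zero]
  rw [coeff_derivative, coeff_mul] at h1 h2
  simp only [Finset.Nat.antidiagonal_zero, Finset.sum_singleton, coeff_derivative, h0, zero_add, g1,
    Nat.cast_zero, mul_one, one_mul] at h1
  rw [Finset.Nat.sum_antidiagonal_eq_sum_range_succ_mk, Finset.sum_range_succ,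
    Finset.sum_range_one] at h2
  simp only [coeff_derivative, h0, one_mul, h1, zero_add, g1, Nat.cast_zero, Nat.cast_one, mul_one,
    one_add_one_eq_two, g2, Nat.reduceSub] at h2
  refine ⟨?_, ?_, ?_⟩
  · rw [hy, coeff_C_mul, h0, mul_one]
  · rw [hy, coeff_C_mul, h1]
  · rw [hy, coeff_C_mul, mul_left_comm, mul_comm 2, h2]; ring

end Exponential

/-! ### The explicit formula in terms of coefficients -/

section Formula

lemma kaehlerMap_smul (k : Type u) [Field k] {B C : Type u} [CommRing B] [CommRing C]
    [Algebra k B] [Algebra k C] (φ : B →ₐ[k] C) (c : B) 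
    (w : KaehlerDifferential k B) :
    kaehlerMap k φ (c • w) = φ c • kaehlerMap k φ w := by
  let : Algebra B C := φ.toRingHom.toAlgebra
  have : IsScalarTower k B C := IsScalarTower.of_algebraMap_eq' φ.comp_algebraMap.symm
  change KaehlerDifferential.map k k B C (c • w) = _
  rw [map_smul]
  rfl

variable (k : Type u) [Field k] {B C : Type u} [CommRing B] [CommRing C] [Algebra k B]
  [Algebra k C] [TopologicalSpace B] [TopologicalSpace C]

open PowerSeries

/-- The explicit formula `Ω(y', y'')`, written through the coefficients of the power series instead
of those of their exponential expansions: for `y = α₀ exp(α₁ t + α₂ t² + ⋯)` one has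
`α₁ = y₁ / y₀`, and for two series that agree modulo `t²` the difference of the `α₂` is the
difference of the `y₂ / y₀`. -/
def formValue (y' y'' : Fin 3 → PowerSeries B) : Form k B :=
  ∑ σ : Equiv.Perm (Fin 3), (Equiv.Perm.sign σ : ℤ) •
    ((Ring.inverse (coeff 0 (y' (σ 0))) * coeff 1 (y' (σ 0)) *
      (Ring.inverse (coeff 0 (y' (σ 2))) * (coeff 2 (y' (σ 2)) - coeff 2 (y'' (σ 2))))) •
        Form.dlog k (coeff 0 (y' (σ 1))))

lemma map_inverse_of_isUnit {R S : Type*} [CommRing R] [CommRing S] (f : R →+* S) {a : R}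
    (ha : IsUnit a) : f (Ring.inverse a) = Ring.inverse (f a) := by
  obtain ⟨u, rfl⟩ := ha
  rw [Ring.inverse_unit]
  exact (Ring.inverse_unit (Units.map (f : R →* S) u)).symm

lemma coeff_zero_isUnit {R : Type*} [CommRing R] {y : PowerSeries R} (hy : IsUnit y) :
    IsUnit (coeff 0 y) := by
  rw [coeff_zero_eq_constantCoeff_apply]; exact hy.map _

/-- A value of the explicit formula is given by the coefficients of the series. -/
lemma IsFormulaValue.eq_formValue [CharZero k] {R : Type u} [CommRing R] [Algebra k R]
    {ρ : R →+* B} {y' y'' : Fin 3 → PowerSeries R} {w : Form k B} (hy : ∀ i, IsUnit (y' i))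
    (h : IsFormulaValue k ρ y' y'' w) :
    w = formValue k (fun i => map ρ (y' i)) (fun i => map ρ (y'' i)) := by
  obtain ⟨α', α'', h', h'', hα, rfl⟩ := h
  refine Finset.sum_congr rfl fun σ _ => ?_
  have e0 : ∀ i, α' i 0 = coeff 0 (y' i) := fun i => (h' i).coeffs.1.symm
  have e1 : ∀ i, α' i 1 = Ring.inverse (coeff 0 (y' i)) * coeff 1 (y' i) := fun i => by
    rw [(h' i).coeffs.2.1, e0, Ring.inverse_mul_cancel_left _ _ (coeff_zero_isUnit (hy i))]
  have e2 : ∀ i, α' i 2 - α'' i 2 =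
      Ring.inverse (coeff 0 (y' i)) * (coeff 2 (y' i) - coeff 2 (y'' i)) := fun i => by
    have a := (h' i).coeffs.2.2
    have b := (h'' i).coeffs.2.2
    rw [← (hα i).1, ← (hα i).2] at b
    have c : coeff 2 (y' i) - coeff 2 (y'' i) = coeff 0 (y' i) * (α' i 2 - α'' i 2) := by
      refine natCast_succ_mul_cancel k (n := 1) ?_
      rw [Nat.cast_one, one_add_one_eq_two, mul_sub, a, b, ← e0]; ring
    rw [c, Ring.inverse_mul_cancel_left _ _ (coeff_zero_isUnit (hy i))]
  simp only [coeff_map]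
  rw [← map_sub ρ (α' (σ 2) 2), ← map_sub ρ (coeff 2 (y' (σ 2))), e1, e2, e0, map_mul, map_mul, map_inverse_of_isUnit _ (coeff_zero_isUnit (hy _)),
    map_inverse_of_isUnit _ (coeff_zero_isUnit (hy _))]

/-- Series that agree modulo `t²` have exponential expansions with common first coefficients. -/
lemma isFormulaValue_formValue [CharZero k] {R : Type u} [CommRing R] [Algebra k R]
    {ρ : R →+* B} {y' y'' : Fin 3 → PowerSeries R} (hy' : ∀ i, IsUnit (y' i))
    (hy'' : ∀ i, IsUnit (y'' i)) (h0 : ∀ i, coeff 0 (y' i) = coeff 0 (y'' i))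
    (h1 : ∀ i, coeff 1 (y' i) = coeff 1 (y'' i)) :
    IsFormulaValue k ρ y' y''
      (formValue k (fun i => map ρ (y' i)) (fun i => map ρ (y'' i))) := by
  choose α' hα' using fun i => exists_isExpExpansion k (hy' i)
  choose α'' hα'' using fun i => exists_isExpExpansion k (hy'' i)
  have h : IsFormulaValue k ρ y' y''
      (formSum k (fun i n => ρ (α' i n)) (fun i n => ρ (α'' i n))) := by
    refine ⟨α', α'', hα', hα'', fun i => ?_, rfl⟩
    have e : α' i 0 = α'' i 0 := by rw [← (hα' i).coeffs.1, h0, (hα'' i).coeffs.1]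
    refine ⟨e, ?_⟩
    have u := coeff_zero_isUnit (hy' i)
    rw [(hα' i).coeffs.1] at u
    refine u.mul_left_cancel ?_
    rw [← (hα' i).coeffs.2.1, h1, (hα'' i).coeffs.2.1, e]
  rw [← h.eq_formValue k hy']
  exact h

lemma Form.map_mk (φ : B →A[k] C) (w : KaehlerDifferential k B) :
    Form.map k φ ((nullForms k B).mkQ w) = (nullForms k C).mkQ (kaehlerMap k (φ : B →ₐ[k] C) w) :=
  rfl

lemma Form.map_smul (φ : B →A[k] C) (c : B) (w : Form k B) :
    Form.map k φ (c • w) = φ c • Form.map k φ w := by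
  obtain ⟨w, rfl⟩ := (nullForms k B).mkQ_surjective w
  rw [← _root_.map_smul, Form.map_mk, kaehlerMap_smul, _root_.map_smul, ← Form.map_mk]
  rfl

lemma Form.map_d (φ : B →A[k] C) (a : B) : Form.map k φ (Form.d k a) = Form.d k (φ a) := by
  change Form.map k φ ((nullForms k B).mkQ _) = _
  have := kaehlerMap_smul_D k (φ : B →ₐ[k] C) 1 a
  rw [one_smul, map_one, one_smul] at this
  rw [Form.map_mk, this]
  rfl

lemma Form.map_dlog (φ : B →A[k] C) {a : B} (ha : IsUnit a) :
    Form.map k φ (Form.dlog k a) = Form.dlog k (φ a) := by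
  rw [Form.dlog, Form.map_smul, Form.map_d, Form.dlog]
  congr 1
  exact map_inverse_of_isUnit (φ : B →ₐ[k] C).toRingHom ha

lemma Form.induction {P : Form k B → Prop} (d : ∀ a, P (Form.d k a)) (zero : P 0)
    (add : ∀ x y, P x → P y → P (x + y)) (smul : ∀ (c : B) x, P x → P (c • x)) (w : Form k B) :
    P w := by
  obtain ⟨w, rfl⟩ := (nullForms k B).mkQ_surjective w
  have hv : w ∈ Submodule.span B (Set.range (KaehlerDifferential.D k B)) := by
    rw [KaehlerDifferential.span_range_derivation]; trivial
  induction hv using Submodule.span_induction with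
  | mem x hx => obtain ⟨b, rfl⟩ := hx; exact d b
  | zero => rw [map_zero]; exact zero
  | add x y _ _ hx hy => rw [map_add]; exact add _ _ hx hy
  | smul a x _ hx => rw [_root_.map_smul]; exact smul _ _ hx

lemma Form.map_comp {E : Type u} [CommRing E] [Algebra k E] [TopologicalSpace E] (φ : B →A[k] C)
    (ψ : C →A[k] E) (w : Form k B) :
    Form.map k ψ (Form.map k φ w) = Form.map k (ψ.comp φ) w := by
  induction w using Form.induction with
  | d a => rw [Form.map_d, Form.map_d, Form.map_d]; rfl
  | zero => simp only [map_zero]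
  | add x y hx hy => simp only [map_add, hx, hy]
  | smul c x hx => rw [Form.map_smul, Form.map_smul, Form.map_smul, hx]; rfl

lemma Form.map_formValue (φ : B →A[k] C) {y' : Fin 3 → PowerSeries B} (hy : ∀ i, IsUnit (y' i))
    (y'' : Fin 3 → PowerSeries B) :
    Form.map k φ (formValue k y' y'') =
      formValue k (fun i => PowerSeries.map (φ : B →ₐ[k] C).toRingHom (y' i))
        (fun i => PowerSeries.map (φ : B →ₐ[k] C).toRingHom (y'' i)) := by
  have hφ : ∀ a, IsUnit a → φ (Ring.inverse a) = Ring.inverse (φ a) := fun a ha =>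
    map_inverse_of_isUnit (φ : B →ₐ[k] C).toRingHom ha
  have hφ' : ∀ a, (φ : B →ₐ[k] C).toRingHom a = φ a := fun a => rfl
  rw [formValue, map_sum, formValue]
  refine Finset.sum_congr rfl fun σ _ => ?_
  rw [map_zsmul, Form.map_smul, Form.map_dlog _ _ (coeff_zero_isUnit (hy _))]
  simp only [coeff_map, hφ', map_mul, map_sub, hφ _ (coeff_zero_isUnit (hy _))]

/-- Functionals coming from continuous derivations are defined on continuous differentials. -/
lemma Form.exists_lift {M : Type u} [AddCommGroup M] [Module B M] [Module k M]
    [IsScalarTower k B M] [TopologicalSpace M] [T2Space M] [IsTopologicalAddGroup M]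
    [ContinuousSMul B M] (D : Derivation k B M) (hD : Continuous D) :
    ∃ L : Form k B →ₗ[B] M, ∀ a, L (Form.d k a) = D a :=
  ⟨(nullForms k B).liftQ D.liftKaehlerDifferential fun _ hw => hw M D hD, fun a =>
    D.liftKaehlerDifferential_comp_D a⟩

end Formula

/-! ### Independence of the explicit formula from the presentation -/

section Comparison

/-- The continuous differentials of the Hausdorff ring `F` form a torsion-free module of rank one,
with `dx` as a generator up to torsion. -/
structure HasRankOneForms (k : Type u) [Field k] (F : Type u) [CommRing F] [Algebra k F]
    [TopologicalSpace F] : Prop where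
  t2 : T2Space F
  exists_generator : ∃ x : F, ∀ w : Form k F, ∃ c : F, c ≠ 0 ∧ ∃ c' : F, c • w = c' • Form.d k x
  torsionFree : ∀ (c : F) (w : Form k F), c • w = 0 → c = 0 ∨ w = 0

variable {k : Type u} [Field k]

/-- In rank one, any two differentials are linearly dependent. -/
lemma HasRankOneForms.exists_relation {F : Type u} [CommRing F] [IsDomain F] [Algebra k F]
    [TopologicalSpace F] (hF : HasRankOneForms k F) (a b : F) :
    ∃ c c' : F, (c ≠ 0 ∨ c' ≠ 0) ∧ c • Form.d k a = c' • Form.d k b := by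
  obtain ⟨x, hx⟩ := hF.exists_generator
  obtain ⟨c, hc, c', h⟩ := hx (Form.d k a)
  obtain ⟨e, he, e', h'⟩ := hx (Form.d k b)
  by_cases hc' : c' = 0
  · exact ⟨c, 0, Or.inl hc, by rw [h, hc', zero_smul, zero_smul]⟩
  · exact ⟨e' * c, c' * e, Or.inr (mul_ne_zero hc' he), by
      rw [mul_smul, h, mul_smul, h', smul_comm]⟩

/-- Let `E` be a continuous derivation along an injective homomorphism `h` of rings with
differentials of rank one; then `E(a) dh(b) = E(b) dh(a)`. The derivation is given on a ring `P`
with quotient `F`. -/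
lemma derivation_smul_d_comm {F B P : Type u} [CommRing F] [IsDomain F] [Algebra k F]
    [TopologicalSpace F] [CommRing B] [IsDomain B] [Algebra k B] [TopologicalSpace B]
    [IsTopologicalRing B] [CommRing P] [TopologicalSpace P]
    (hF : HasRankOneForms k F) (hB : HasRankOneForms k B) (h : F →A[k] B)
    (hinj : Function.Injective h) (π : P →+* F) (hπ : Topology.IsQuotientMap π) (e : P → B)
    (he : Continuous e) (hadd : ∀ p q, e (p + q) = e p + e q)
    (hmul : ∀ p q, e (p * q) = h (π p) * e q + h (π q) * e p)
    (hker : ∀ p, π p = 0 → e p = 0)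
    (hk : ∀ c : k, ∃ p, π p = algebraMap k F c ∧ e p = 0) (p q : P) :
    e p • Form.d k (h (π q)) = e q • Form.d k (h (π p)) := by
  have hwd : ∀ p q, π p = π q → e p = e q := by
    intro p q hpq
    have h1 : e (p - q) = 0 := hker _ (by rw [map_sub, hpq, sub_self])
    rw [← sub_add_cancel p q, hadd, h1, zero_add]
  obtain ⟨E, hE⟩ : ∃ E : F → B, ∀ p, E (π p) = e p :=
    ⟨fun f => e (Function.surjInv hπ.surjective f), fun p =>
      hwd _ _ (Function.surjInv_eq hπ.surjective _)⟩
  have hEc : Continuous E := by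
    rw [hπ.continuous_iff]
    convert he using 1
    ext p; exact hE p
  have hEadd : ∀ a b, E (a + b) = E a + E b := by
    intro a b
    obtain ⟨p, rfl⟩ := hπ.surjective a
    obtain ⟨q, rfl⟩ := hπ.surjective b
    rw [← map_add, hE, hE, hE, hadd]
  have hEmul : ∀ a b, E (a * b) = h a * E b + h b * E a := by
    intro a b
    obtain ⟨p, rfl⟩ := hπ.surjective a
    obtain ⟨q, rfl⟩ := hπ.surjective b
    rw [← map_mul, hE, hE, hE, hmul]
  have hEk : ∀ c : k, E (algebraMap k F c) = 0 := by
    intro c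
    obtain ⟨p, hp, hp'⟩ := hk c
    rw [← hp, hE, hp']
  let : Module F B := Module.compHom B (h : F →ₐ[k] B).toRingHom
  have hsm : ∀ (b : F) (m : B), b • m = h b * m := fun _ _ => rfl
  have : IsScalarTower k F B := ⟨fun x y z => by
    rw [hsm, hsm, show h (x • y) = x • h y from map_smul (h : F →ₐ[k] B) x y, smul_mul_assoc]⟩
  have : ContinuousSMul F B := ⟨by
    change Continuous fun p : F × B => h p.1 * p.2
    exact (h.continuous.comp continuous_fst).mul continuous_snd⟩
  have := hB.t2
  let D : Derivation k F B :=
    { toFun := E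
      map_add' := hEadd
      map_smul' := fun c b => by
        rw [Algebra.smul_def, hEmul, hEk, mul_zero, add_zero, RingHom.id_apply, Algebra.smul_def,
          show h (algebraMap k F c) = algebraMap k B c from (h : F →ₐ[k] B).commutes c]
      map_one_eq_zero' := by
        change E 1 = 0
        rw [← map_one (algebraMap k F), hEk]
      leibniz' := fun a b => hEmul a b }
  obtain ⟨L, hL⟩ := Form.exists_lift k D hEc
  obtain ⟨c, c', hcc, hrel⟩ := hF.exists_relation (π p) (π q)
  have h1 : h c * e p = h c' * e q := by
    have := congrArg L hrel
    rw [map_smul, map_smul, hL, hL, hsm, hsm] at this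
    change h c * E _ = h c' * E _ at this
    rwa [hE, hE] at this
  have h2 : h c • Form.d k (h (π p)) = h c' • Form.d k (h (π q)) := by
    rw [← Form.map_d, ← Form.map_d, ← Form.map_smul, hrel, Form.map_smul]
  have h0 : ∀ a, a ≠ 0 → h a ≠ 0 := fun a ha hha => ha (hinj (hha.trans (map_zero h).symm))
  rcases hcc with hc | hc
  · refine sub_eq_zero.1 ((hB.torsionFree (h c) _ ?_).resolve_left (h0 c hc))
    rw [smul_sub, smul_smul, h1, smul_comm, h2, smul_smul, mul_comm (e q), sub_self]
  · refine sub_eq_zero.1 ((hB.torsionFree (h c') _ ?_).resolve_left (h0 c' hc))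
    rw [smul_sub, smul_smul (h c') (e q), ← h1, smul_comm, ← h2, smul_smul, mul_comm (e p),
      sub_self]

/-- A presentation of `χ : X|_{t²} ≅ Y|_{t²}` by power series over `B`, along a homomorphism
`h : Y/(t) → B`: continuous homomorphisms over `k⟦t⟧` from `Y` and from `X` to `B⟦t⟧`, of which the
first lifts `h` and the second is compatible with the first and `χ` modulo `t²`. -/
structure IsPresentation {X Y : Obj k} (χ : X.Iso₂ Y) {B : Type u} [CommRing B] [Algebra k B]
    [TopologicalSpace B] (h : Fibre k Y →A[k] B) (l : X →+* PowerSeries B)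
    (κ : Y →+* PowerSeries B) : Prop where
  cont_left : Continuous l
  cont_right : Continuous κ
  algebraMap_left : ∀ a, l (algebraMap (PowerSeries k) X a) = PowerSeries.map (algebraMap k B) a
  algebraMap_right : ∀ a, κ (algebraMap (PowerSeries k) Y a) = PowerSeries.map (algebraMap k B) a
  constantCoeff : ∀ y, PowerSeries.constantCoeff (κ y) = h (Y.red y)
  compat : ∀ x y, χ (X.red₂ x) = Y.red₂ y → PowerSeries.X ^ 2 ∣ l x - κ y

open PowerSeries

lemma coeff_one_mul_eq {B : Type*} [CommRing B] (f g : PowerSeries B) :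
    coeff 1 (f * g) = coeff 0 f * coeff 1 g + coeff 0 g * coeff 1 f := by
  rw [coeff_mul, Finset.Nat.sum_antidiagonal_eq_sum_range_succ_mk, Finset.sum_range_succ,
    Finset.sum_range_one]
  simp only [Nat.sub_zero, Nat.sub_self]
  ring

lemma coeff_two_mul_eq {B : Type*} [CommRing B] (f g : PowerSeries B) :
    coeff 2 (f * g) = coeff 0 f * coeff 2 g + coeff 0 g * coeff 2 f + coeff 1 f * coeff 1 g := by
  rw [coeff_mul, Finset.Nat.sum_antidiagonal_eq_sum_range_succ_mk, Finset.sum_range_succ,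
    Finset.sum_range_succ, Finset.sum_range_one]
  simp only [Nat.sub_zero, Nat.sub_self, Nat.reduceSub]
  ring

/-- The explicit formula is unchanged if the coefficients of `t`, and the differences of the
coefficients of `t²`, are modified by terms `Eᵢ`, `Hᵢ` for which `Eᵢ dαⱼ` and `Hᵢ dαⱼ` are symmetric in
`i` and `j`. -/
lemma formValue_eq_of_antisymmetric {B : Type u} [CommRing B] [Algebra k B] [TopologicalSpace B]
    {l l' κ κ' : Fin 3 → PowerSeries B} (h0 : ∀ i, coeff 0 (l' i) = coeff 0 (l i))
    (h1 : ∀ i j, (coeff 1 (l' i) - coeff 1 (l i)) • Form.d k (coeff 0 (l j)) =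
      (coeff 1 (l' j) - coeff 1 (l j)) • Form.d k (coeff 0 (l i)))
    (h2 : ∀ i j, ((coeff 2 (l' i) - coeff 2 (κ' i)) - (coeff 2 (l i) - coeff 2 (κ i))) •
        Form.d k (coeff 0 (l j)) =
      ((coeff 2 (l' j) - coeff 2 (κ' j)) - (coeff 2 (l j) - coeff 2 (κ j))) •
        Form.d k (coeff 0 (l i))) :
    formValue k l κ = formValue k l' κ' := by
  rw [eq_comm, ← sub_eq_zero, formValue, formValue, ← Finset.sum_sub_distrib]
  set a : Fin 3 → B := fun i => Ring.inverse (coeff 0 (l i)) with ha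
  set E : Fin 3 → B := fun i => a i * (coeff 1 (l' i) - coeff 1 (l i)) with hE
  set H : Fin 3 → B := fun i =>
    a i * ((coeff 2 (l' i) - coeff 2 (κ' i)) - (coeff 2 (l i) - coeff 2 (κ i))) with hH
  set w : Fin 3 → Form k B := fun i => Form.dlog k (coeff 0 (l i)) with hw
  have hEw : ∀ i j, E i • w j = E j • w i := by
    intro i j
    simp only [hE, hw, Form.dlog, ha, mul_smul]
    rw [smul_comm _ (Ring.inverse _), h1, smul_comm, smul_comm (Ring.inverse (coeff 0 (l j)))]
    rw [smul_comm _ (Ring.inverse (coeff 0 (l i))), smul_comm _ (Ring.inverse (coeff 0 (l i)))]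
  have hHw : ∀ i j, H i • w j = H j • w i := by
    intro i j
    simp only [hH, hw, Form.dlog, ha, mul_smul]
    rw [smul_comm _ (Ring.inverse _), h2, smul_comm, smul_comm (Ring.inverse (coeff 0 (l j)))]
    rw [smul_comm _ (Ring.inverse (coeff 0 (l i))), smul_comm _ (Ring.inverse (coeff 0 (l i)))]
  set P : Fin 3 → B := fun i => a i * coeff 1 (l' i) with hP
  set Q : Fin 3 → B := fun i => a i * (coeff 2 (l i) - coeff 2 (κ i)) with hQ
  -- A summand changes by one term with the factor `H(σ 2) w(σ 1)` and one with `E(σ 0) w(σ 1)`.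
  have split : ∀ σ : Equiv.Perm (Fin 3),
      ((Equiv.Perm.sign σ : ℤ) • ((Ring.inverse (coeff 0 (l' (σ 0))) * coeff 1 (l' (σ 0)) *
      (Ring.inverse (coeff 0 (l' (σ 2))) * (coeff 2 (l' (σ 2)) - coeff 2 (κ' (σ 2))))) •
        Form.dlog k (coeff 0 (l' (σ 1)))) -
      (Equiv.Perm.sign σ : ℤ) • ((Ring.inverse (coeff 0 (l (σ 0))) * coeff 1 (l (σ 0)) *
      (Ring.inverse (coeff 0 (l (σ 2))) * (coeff 2 (l (σ 2)) - coeff 2 (κ (σ 2))))) •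
        Form.dlog k (coeff 0 (l (σ 1))))) =
      (Equiv.Perm.sign σ : ℤ) • (P (σ 0) • H (σ 2) • w (σ 1)) +
      (Equiv.Perm.sign σ : ℤ) • (Q (σ 2) • E (σ 0) • w (σ 1)) := by
    intro σ
    rw [← smul_sub, ← smul_add, h0, h0, h0, ← sub_smul, smul_smul, smul_smul, ← add_smul]
    congr 2
    simp only [hP, hH, hQ, hE, ha]
    ring
  rw [Finset.sum_congr rfl fun σ _ => split σ, Finset.sum_add_distrib]
  -- The terms are symmetric under a transposition of the indices, so the alternating sums vanish.
  have sum1 : ∑ σ : Equiv.Perm (Fin 3),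
      (Equiv.Perm.sign σ : ℤ) • (P (σ 0) • H (σ 2) • w (σ 1)) = 0 := by
    refine Finset.sum_involution (fun σ _ => σ * Equiv.swap 1 2) ?_ ?_ (by simp) (by simp)
    · intro σ _
      rw [Equiv.Perm.sign_mul, Equiv.Perm.sign_swap (by decide)]
      simp only [Equiv.Perm.mul_apply, Equiv.swap_apply_left, Equiv.swap_apply_right,
        Equiv.swap_apply_of_ne_of_ne (show (0 : Fin 3) ≠ 1 by decide)
          (show (0 : Fin 3) ≠ 2 by decide)]
      rw [hHw (σ 1) (σ 2)]
      simp
    · intro σ _ _ h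
      have := mul_eq_left.1 h
      simp at this
  have sum2 : ∑ σ : Equiv.Perm (Fin 3),
      (Equiv.Perm.sign σ : ℤ) • (Q (σ 2) • E (σ 0) • w (σ 1)) = 0 := by
    refine Finset.sum_involution (fun σ _ => σ * Equiv.swap 0 1) ?_ ?_ (by simp) (by simp)
    · intro σ _
      rw [Equiv.Perm.sign_mul, Equiv.Perm.sign_swap (by decide)]
      simp only [Equiv.Perm.mul_apply, Equiv.swap_apply_left, Equiv.swap_apply_right,
        Equiv.swap_apply_of_ne_of_ne (show (2 : Fin 3) ≠ 0 by decide)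
          (show (2 : Fin 3) ≠ 1 by decide)]
      rw [hEw (σ 1) (σ 0)]
      simp
    · intro σ _ _ h
      have := mul_eq_left.1 h
      simp at this
  rw [sum1, sum2, add_zero]

lemma algebraMap_eq_algebraMap_C (X : Obj k) (c : k) :
    algebraMap k X c = algebraMap (PowerSeries k) X (C c) :=
  IsScalarTower.algebraMap_apply k (PowerSeries k) X c

section

variable {X Y : Obj k} {χ : X.Iso₂ Y} {B : Type u} [CommRing B] [Algebra k B]
  [TopologicalSpace B] {h : Fibre k Y →A[k] B} {l l' : X →+* PowerSeries B}
  {κ κ' : Y →+* PowerSeries B}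

lemma IsPresentation.par_left (hp : IsPresentation χ h l κ) : l (par k X) = PowerSeries.X := by
  rw [hp.algebraMap_left, map_X]

lemma IsPresentation.par_right (hp : IsPresentation χ h l κ) : κ (par k Y) = PowerSeries.X := by
  rw [hp.algebraMap_right, map_X]

lemma IsPresentation.coeff_eq (hp : IsPresentation χ h l κ) {x : X} {y : Y}
    (hxy : χ (X.red₂ x) = Y.red₂ y) :
    coeff 0 (l x) = coeff 0 (κ y) ∧ coeff 1 (l x) = coeff 1 (κ y) := by
  have := X_pow_dvd_iff.1 (hp.compat x y hxy)
  constructor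
  · have := this 0 (by norm_num)
    rwa [map_sub, sub_eq_zero] at this
  · have := this 1 (by norm_num)
    rwa [map_sub, sub_eq_zero] at this

lemma IsPresentation.coeff_zero (hp : IsPresentation χ h l κ) (y : Y) :
    coeff 0 (κ y) = h (Y.red y) := by
  rw [coeff_zero_eq_constantCoeff_apply, hp.constantCoeff]

lemma red_eq_zero_iff {Y : Obj k} {y : Y} : Y.red y = 0 ↔ par k Y ∣ y := by
  rw [Ideal.Quotient.eq_zero_iff_mem, Ideal.mem_span_singleton]

lemma red₂_eq_iff {Y : Obj k} {y y' : Y} : Y.red₂ y = Y.red₂ y' ↔ par k Y ^ 2 ∣ y - y' := by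
  rw [Ideal.Quotient.eq, Ideal.mem_span_singleton]

lemma iso₂_par (χ : X.Iso₂ Y) : χ (X.red₂ (par k X)) = Y.red₂ (par k Y) :=
  χ.toAlgEquiv.commutes (PowerSeries.X : PowerSeries k)

lemma exists_iso₂_lift (χ : X.Iso₂ Y) (x : X) : ∃ y : Y, χ (X.red₂ x) = Y.red₂ y := by
  obtain ⟨y, hy⟩ := Ideal.Quotient.mk_surjective (χ (X.red₂ x))
  exact ⟨y, hy.symm⟩

lemma exists_iso₂_lift' (χ : X.Iso₂ Y) (y : Y) : ∃ x : X, χ (X.red₂ x) = Y.red₂ y := by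
  obtain ⟨x, hx⟩ := Ideal.Quotient.mk_surjective (χ.symm (Y.red₂ y))
  exact ⟨x, by rw [hx]; exact χ.apply_symm_apply _⟩

/-- Multiplication by `t` is injective on objects. -/
lemma par_mul_cancel (X : Obj k) {x : X} (h : par k X * x = 0) : x = 0 := by
  have := X.flat
  have := X.domain
  have h1 : Module.IsTorsionFree (PowerSeries k) X := by
    rw [Submodule.isTorsionFree_iff_torsion_eq_bot, ← IsDedekindDomain.flat_iff_torsion_eq_bot]
    exact X.flat
  rw [← Algebra.smul_def, smul_eq_zero] at h
  exact h.resolve_left X_ne_zero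

/-- If `χ` sends the class of `x` to a class in `(t)`, then `x` lies in `(t)`. -/
lemma par_dvd_of_iso₂ (χ : X.Iso₂ Y) {x : X} {y : Y} (h : χ (X.red₂ x) = Y.red₂ y)
    (hy : par k Y ∣ y) : par k X ∣ x := by
  obtain ⟨y, rfl⟩ := hy
  have h1 : χ (X.red₂ (par k X * x)) = χ 0 := by
    rw [map_mul, map_mul, h, map_zero, iso₂_par, ← map_mul, ← mul_assoc, ← pow_two,
      Ideal.Quotient.eq_zero_iff_mem]
    exact Ideal.mul_mem_right _ _ (Ideal.mem_span_singleton_self _)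
  have h2 := χ.injective h1
  rw [Ideal.Quotient.eq_zero_iff_mem, Ideal.mem_span_singleton] at h2
  obtain ⟨z, hz⟩ := h2
  refine ⟨z, sub_eq_zero.1 (par_mul_cancel X ?_)⟩
  rw [mul_sub, hz]; ring

/-- The value of the explicit formula does not depend on the presentation: a change of the chart
and of the lifting of `χ` changes the coefficients by continuous derivations, and these
contributions cancel since the differentials have rank one. -/
theorem formValue_eq_of_isPresentation [IsDomain B] [IsTopologicalRing B]
    (hY : HasRankOneForms k (Fibre k Y)) (hB : HasRankOneForms k B) (hinj : Function.Injective h)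
    (hp : IsPresentation χ h l κ) (hp' : IsPresentation χ h l' κ') (p : Beta3 χ) :
    formValue k (fun i => l (p.fst i)) (fun i => κ (p.snd i)) =
      formValue k (fun i => l' (p.fst i)) (fun i => κ' (p.snd i)) := by
  have := Y.fibreDomain
  have h0 : ∀ y, coeff 0 (κ' y) = coeff 0 (κ y) := fun y => by rw [hp'.coeff_zero, hp.coeff_zero]
  -- The difference of the charts in degree one.
  let e : Y → B := fun y => coeff 1 (κ' y) - coeff 1 (κ y)
  have e_par : ∀ y, e (par k Y * y) = 0 := fun y => by
    simp only [e]
    rw [map_mul κ', map_mul κ, hp.par_right, hp'.par_right, ← zero_add 1, coeff_succ_X_mul,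
      coeff_succ_X_mul, h0, sub_self]
  have e_add : ∀ y z, e (y + z) = e y + e z := fun y z => by simp only [e, map_add]; ring
  have e_red : ∀ y z, Y.red y = Y.red z → e y = e z := fun y z hyz => by
    rw [← sub_eq_zero, ← map_sub, red_eq_zero_iff] at hyz
    obtain ⟨w, hw⟩ := hyz
    rw [sub_eq_iff_eq_add.1 hw, e_add, e_par, zero_add]
  have E := derivation_smul_d_comm (P := Y) hY hB h hinj Y.red isQuotientMap_quot_mk e
    (((PowerSeries.WithPiTopology.continuous_coeff B 1).comp hp'.cont_right).sub
      ((PowerSeries.WithPiTopology.continuous_coeff B 1).comp hp.cont_right)) e_add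
    (fun y z => by
      simp only [e]
      rw [map_mul κ', map_mul κ, coeff_one_mul_eq, coeff_one_mul_eq, h0, h0, hp.coeff_zero, hp.coeff_zero]
      ring)
    (fun y hy => by
      obtain ⟨w, rfl⟩ := red_eq_zero_iff.1 hy
      exact e_par w)
    (fun c => ⟨algebraMap k Y c, rfl, by
      simp only [e]
      rw [algebraMap_eq_algebraMap_C, hp.algebraMap_right, hp'.algebraMap_right, sub_self]⟩)
  -- The difference of the presentations in degree two, a derivation on the fibre product.
  let P : Subring (X × Y) := RingHom.eqLocus
    ((χ.toAlgEquiv.toRingEquiv.toRingHom.comp X.red₂).comp (RingHom.fst X Y))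
    (Y.red₂.comp (RingHom.snd X Y))
  have hPmem : ∀ z : X × Y, z ∈ P ↔ χ (X.red₂ z.1) = Y.red₂ z.2 := fun z => Iff.rfl
  let π : P →+* Fibre k Y := (Y.red.comp (RingHom.snd X Y)).comp P.subtype
  have hπ : Topology.IsQuotientMap π := by
    refine IsOpenMap.isQuotientMap ?_ ?_ ?_
    · have h1 : IsOpenMap (fun z : P => z.1.2) := by
        intro W hW
        obtain ⟨W', hW', rfl⟩ := isOpen_induced_iff.1 hW
        rw [isOpen_iff_forall_mem_open]
        rintro _ ⟨z, hz, rfl⟩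
        obtain ⟨U, V, hU, hV, hzU, hzV, hUV⟩ := isOpen_prod_iff.1 hW' z.1.1 z.1.2 hz
        refine ⟨V ∩ Y.red₂ ⁻¹' (χ '' (X.red₂ '' U)), ?_, ?_, ?_⟩
        · rintro y ⟨hyV, _, ⟨x, hxU, rfl⟩, hxy⟩
          exact ⟨⟨(x, y), hxy⟩, hUV ⟨hxU, hyV⟩, rfl⟩
        · refine hV.inter (IsOpen.preimage continuous_quot_mk ?_)
          refine χ.toHomeomorph.isOpenMap _ ?_
          exact QuotientRing.isOpenMap_coe (Ideal.span {par k X ^ 2}) U hU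
        · exact ⟨hzV, _, ⟨z.1.1, hzU, rfl⟩, z.2⟩
      exact (QuotientRing.isOpenMap_coe (Ideal.span {par k Y})).comp h1
    · exact continuous_quot_mk.comp (continuous_snd.comp continuous_subtype_val)
    · intro f
      obtain ⟨y, rfl⟩ := Ideal.Quotient.mk_surjective f
      obtain ⟨x, hx⟩ := exists_iso₂_lift' χ y
      exact ⟨⟨(x, y), hx⟩, rfl⟩
  let G : P → B := fun z => (coeff 2 (l' z.1.1) - coeff 2 (κ' z.1.2)) -
    (coeff 2 (l z.1.1) - coeff 2 (κ z.1.2))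
  have G_add : ∀ y z, G (y + z) = G y + G z := fun y z => by
    simp only [G]
    rw [Subring.coe_add, Prod.fst_add, Prod.snd_add]
    simp only [map_add]; ring
  have H := derivation_smul_d_comm (P := P) hY hB h hinj π hπ G
    (by
      have c1 : Continuous fun z : P => z.1.1 := continuous_fst.comp continuous_subtype_val
      have c2 : Continuous fun z : P => z.1.2 := continuous_snd.comp continuous_subtype_val
      have c := PowerSeries.WithPiTopology.continuous_coeff B 2
      exact ((c.comp (hp'.cont_left.comp c1)).sub (c.comp (hp'.cont_right.comp c2))).sub
        ((c.comp (hp.cont_left.comp c1)).sub (c.comp (hp.cont_right.comp c2))))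
    G_add
    (fun y z => by
      simp only [G]
      rw [Subring.coe_mul, Prod.fst_mul, Prod.snd_mul]
      simp only [map_mul, coeff_two_mul_eq]
      have a1 := hp.coeff_eq y.2
      have a2 := hp.coeff_eq z.2
      have a3 := hp'.coeff_eq y.2
      have a4 := hp'.coeff_eq z.2
      simp only [RingHom.coe_fst, RingHom.coe_snd] at a1 a2 a3 a4
      rw [a1.1, a1.2, a2.1, a2.2, a3.1, a3.2, a4.1, a4.2, h0, h0, hp.coeff_zero, hp.coeff_zero]
      change _ = h (Y.red y.1.2) * _ + h (Y.red z.1.2) * _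
      ring)
    (by
      rintro ⟨⟨x, y⟩, hxy⟩ hz
      have hxy' : χ (X.red₂ x) = Y.red₂ y := hxy
      obtain ⟨y, rfl⟩ := red_eq_zero_iff.1 hz
      obtain ⟨x, rfl⟩ := par_dvd_of_iso₂ χ hxy' (Dvd.intro _ rfl)
      obtain ⟨y', hy'⟩ := exists_iso₂_lift χ x
      have hyy : Y.red y' = Y.red y := by
        rw [map_mul, map_mul, hy', iso₂_par, ← map_mul, red₂_eq_iff] at hxy'
        obtain ⟨w, hw⟩ := hxy'
        rw [← sub_eq_zero, ← map_sub, red_eq_zero_iff]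
        refine ⟨w, sub_eq_zero.1 (par_mul_cancel Y ?_)⟩
        rw [mul_sub, mul_sub, hw]; ring
      have a1 := e_red _ _ hyy
      simp only [e] at a1
      simp only [G]
      rw [map_mul l', map_mul κ', map_mul l, map_mul κ, hp.par_left, hp.par_right, hp'.par_left,
        hp'.par_right, show (2 : ℕ) = 1 + 1 from rfl, coeff_succ_X_mul, coeff_succ_X_mul,
        coeff_succ_X_mul, coeff_succ_X_mul, (hp.coeff_eq hy').2, (hp'.coeff_eq hy').2]
      linear_combination a1)
    (fun c => ⟨⟨(algebraMap k X c, algebraMap k Y c), by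
        rw [hPmem]
        change χ (X.red₂ (algebraMap k X c)) = Y.red₂ (algebraMap k Y c)
        rw [algebraMap_eq_algebraMap_C, algebraMap_eq_algebraMap_C]
        exact χ.toAlgEquiv.commutes (C c : PowerSeries k)⟩, rfl, by
      simp only [G]
      rw [algebraMap_eq_algebraMap_C, algebraMap_eq_algebraMap_C, hp.algebraMap_right,
        hp'.algebraMap_right, hp.algebraMap_left, hp'.algebraMap_left]
      ring⟩)
  have c0 := fun i => (hp.coeff_eq (p.compat i)).1
  have c1 := fun i => (hp.coeff_eq (p.compat i)).2
  have c0' := fun i => (hp'.coeff_eq (p.compat i)).1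
  have c1' := fun i => (hp'.coeff_eq (p.compat i)).2
  refine formValue_eq_of_antisymmetric (fun i => ?_) (fun i j => ?_) (fun i j => ?_)
  · rw [c0, c0', h0]
  · rw [c1, c1', c1, c1', c0, c0, hp.coeff_zero, hp.coeff_zero]
    exact E _ _
  · rw [c0, c0, hp.coeff_zero, hp.coeff_zero]
    exact H ⟨(p.fst i, p.snd i), p.compat i⟩ ⟨(p.fst j, p.snd j), p.compat j⟩

end

end Comparison

/-! ### Automorphisms and derivations of power series rings -/

section PowerSeriesTopology

open PowerSeries

lemma continuous_powerSeries_iff {T B : Type*} [TopologicalSpace T] [CommRing B]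
    [TopologicalSpace B] {f : T → PowerSeries B} :
    Continuous f ↔ ∀ n, Continuous fun x => coeff n (f x) := by
  simp only [continuous_iff_continuousAt, ContinuousAt,
    PowerSeries.WithPiTopology.tendsto_iff_coeff_tendsto]
  exact forall_comm

lemma continuous_powerSeries_map {A B : Type*} [CommRing A] [CommRing B] [TopologicalSpace A]
    [TopologicalSpace B] {f : A →+* B} (hf : Continuous f) : Continuous (PowerSeries.map f) := by
  rw [continuous_powerSeries_iff]
  intro n
  simp only [coeff_map]
  exact hf.comp (PowerSeries.WithPiTopology.continuous_coeff A n)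

variable {A B : Type*} [CommRing A] [CommRing B]

/-- A homomorphism to `B⟦X⟧` whose image contains `X` and all constant terms has dense image. -/
lemma exists_approx_of_surjective {R B : Type*} [CommRing R] [CommRing B] {κ : R →+* PowerSeries B}
    {t : R} (ht : κ t = X) (hκ : ∀ b, ∃ r, coeff 0 (κ r) = b) (n : ℕ) (g : PowerSeries B) :
    ∃ r, X ^ n ∣ g - κ r := by
  induction n with
  | zero => exact ⟨0, by rw [pow_zero]; exact one_dvd _⟩
  | succ n ih =>
    obtain ⟨y, h, hy⟩ := ih
    obtain ⟨z, hz⟩ := hκ (coeff 0 h)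
    refine ⟨y + t ^ n * z, ?_⟩
    have h1 : X ∣ h - κ z := by
      rw [X_dvd_iff, ← coeff_zero_eq_constantCoeff_apply, map_sub, hz, sub_self]
    rw [map_add, map_mul κ, map_pow, ht, ← sub_sub, hy, ← mul_sub, pow_succ]
    exact mul_dvd_mul_left _ h1

/-- The coefficients of the image of `∑ aᵢ Xⁱ` under a homomorphism fixing `X`. -/
lemma coeff_eval_eq_sum {E : PowerSeries A →+* PowerSeries B} (hX : E X = X) (f : PowerSeries A)
    (n : ℕ) : coeff n (E f) =
      ∑ i ∈ Finset.range (n + 1), coeff (n - i) (E (C (coeff i f))) := by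
  obtain ⟨g, hg⟩ := exists_eq_trunc_add f (n + 1)
  conv_lhs => rw [hg]
  rw [map_add, map_polynomial_eq, eval₂_trunc_eq_sum_range, hX, map_mul, map_pow, hX, map_add,
    map_sum, coeff_X_pow_mul', if_neg (by omega), add_zero]
  refine Finset.sum_congr rfl fun i hi => ?_
  rw [coeff_mul_X_pow', if_pos (by have := Finset.mem_range.1 hi; omega)]
  rfl

/-- A continuous homomorphism `φ : A → B⟦X⟧` whose constant term is a topological isomorphism
`A ≅ B` extends to a topological isomorphism `A⟦X⟧ ≅ B⟦X⟧`. -/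
lemma exists_powerSeries_homeomorph [TopologicalSpace A] [TopologicalSpace B]
    [IsTopologicalRing B] (φ : A →+* PowerSeries B) (hφ : Continuous φ) (χ : A ≃ B)
    (hχ : Continuous χ.symm) (hφχ : ∀ a, coeff 0 (φ a) = χ a) :
    ∃ F : PowerSeries A ≃+* PowerSeries B, (∀ a, F (C a) = φ a) ∧ F X = X ∧
      Continuous F ∧ Continuous F.symm := by
  obtain ⟨E, hC, hX⟩ := exists_powerSeries_eval (X : PowerSeries B) φ
  have hχ0 : ∀ a, χ a = 0 → a = 0 := fun a ha => by
    have h0 : χ 0 = 0 := by rw [← hφχ, map_zero, map_zero]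
    exact χ.injective (ha.trans h0.symm)
  have hb : Function.Bijective E := powerSeries_eval_bijective (S := X) (φ := φ)
    (fun x hx => by
      ext n
      have := congrArg (coeff (n + 1)) hx
      rwa [coeff_succ_X_mul, map_zero] at this)
    (fun a ha => hχ0 a (by
      rw [← hφχ, coeff_zero_eq_constantCoeff_apply]; exact X_dvd_iff.1 ha))
    (fun c => ⟨χ.symm (coeff 0 c), X_dvd_iff.2 (by
      rw [map_sub, ← coeff_zero_eq_constantCoeff_apply, ← coeff_zero_eq_constantCoeff_apply, hφχ,
        Equiv.apply_symm_apply, sub_self])⟩) hC hX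
  refine ⟨RingEquiv.ofBijective E hb, hC, hX, ?_, ?_⟩
  · change Continuous E
    rw [continuous_powerSeries_iff]
    intro n
    simp only [coeff_eval_eq_sum hX, hC]
    refine continuous_finsetSum _ fun i _ => ?_
    exact (PowerSeries.WithPiTopology.continuous_coeff B _).comp
      (hφ.comp (PowerSeries.WithPiTopology.continuous_coeff A i))
  · -- The coefficients of the inverse are obtained recursively.
    set F := RingEquiv.ofBijective E hb with hF
    rw [continuous_powerSeries_iff]
    intro n
    induction n using Nat.strong_induction_on with
    | _ n ih =>
      have h1 : ∀ g, coeff n (F.symm g) = χ.symm (coeff n g -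
          ∑ i ∈ Finset.range n, coeff (n - i) (φ (coeff i (F.symm g)))) := by
        intro g
        rw [Equiv.eq_symm_apply]
        have h2 : coeff n g = coeff n (E (F.symm g)) := by
          congr 1; exact (F.apply_symm_apply g).symm
        rw [h2, coeff_eval_eq_sum hX, Finset.sum_range_succ, Nat.sub_self, hC, hφχ]
        simp only [hC]
        ring
      simp only [h1]
      refine hχ.comp ((PowerSeries.WithPiTopology.continuous_coeff B n).sub
        (continuous_finsetSum _ fun i hi => ?_))
      exact (PowerSeries.WithPiTopology.continuous_coeff B _).comp
        (hφ.comp (ih i (Finset.mem_range.1 hi)))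

/-- The homomorphism `exp(t δ) : B → B⟦t⟧` attached to a derivation `δ`; it is multiplicative
because `exp(t δ)(b)` is the unique solution of `f' = δ f` with constant term `b`. -/
lemma exists_exp_derivation (k : Type u) [Field k] [CharZero k] {B : Type u} [CommRing B]
    [Algebra k B] [TopologicalSpace B] [IsTopologicalRing B] (δ : Derivation k B B)
    (hδ : Continuous δ) :
    ∃ φ : B →+* PowerSeries B, Continuous φ ∧ (∀ b, coeff 0 (φ b) = b) ∧
      (∀ b, coeff 1 (φ b) = δ b) ∧ ∀ c : k, φ (algebraMap k B c) = C (algebraMap k B c) := by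
  let Δ : PowerSeries B → PowerSeries B := fun f => PowerSeries.mk fun n => δ (coeff n f)
  have hΔ : ∀ f n, coeff n (Δ f) = δ (coeff n f) := fun f n => coeff_mk _ _
  have hΔadd : ∀ f g, Δ (f + g) = Δ f + Δ g := fun f g => by
    ext n; simp only [hΔ, map_add]
  have hΔmul : ∀ f g, Δ (f * g) = f * Δ g + g * Δ f := fun f g => by
    ext n
    rw [hΔ, map_add, coeff_mul, map_sum, mul_comm g, coeff_mul, coeff_mul,
      ← Finset.sum_add_distrib]
    refine Finset.sum_congr rfl fun p _ => ?_
    rw [δ.leibniz, hΔ, hΔ, smul_eq_mul, smul_eq_mul]; ring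
  -- Uniqueness of solutions of `f' = δ f`.
  have uniq : ∀ f g, d⁄dX B f = Δ f → d⁄dX B g = Δ g → coeff 0 f = coeff 0 g → f = g := by
    intro f g hf hg h0
    ext n
    induction n with
    | zero => exact h0
    | succ n ih =>
      have e1 := congrArg (coeff n) hf
      have e2 := congrArg (coeff n) hg
      rw [coeff_derivative, hΔ, mul_comm] at e1 e2
      exact natCast_succ_mul_cancel k (n := n) (by rw [e1, e2, ih])
  let a : ℕ → B := fun n => algebraMap k B ((n.factorial : k)⁻¹)
  have ha : ∀ n : ℕ, a (n + 1) * (n + 1 : B) = a n := fun n => by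
    simp only [a]
    rw [show (n + 1 : B) = algebraMap k B (n + 1) by simp, ← map_mul, Nat.factorial_succ,
      Nat.cast_mul, mul_inv, Nat.cast_succ, mul_right_comm,
      inv_mul_cancel₀ (by exact_mod_cast n.succ_ne_zero), one_mul]
  have ha0 : a 0 = 1 := by simp [a]
  have hδa : ∀ n b, δ (a n * b) = a n * δ b := fun n b => by
    simp only [a]
    rw [← Algebra.smul_def, ← Algebra.smul_def, δ.map_smul]
  let φ : B → PowerSeries B := fun b => PowerSeries.mk fun n => a n * (δ^[n]) b
  have hφ : ∀ b n, coeff n (φ b) = a n * (δ^[n]) b := fun b n => coeff_mk _ _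
  have hφ0 : ∀ b, coeff 0 (φ b) = b := fun b => by
    rw [hφ, ha0, one_mul, Function.iterate_zero_apply]
  have hφ' : ∀ b, d⁄dX B (φ b) = Δ (φ b) := fun b => by
    ext n
    rw [coeff_derivative, hΔ, hφ, hφ, hδa, Function.iterate_succ_apply', mul_right_comm, ha]
  have hconst : ∀ b, δ b = 0 → φ b = C b := fun b hb => by
    refine uniq _ _ (hφ' b) ?_ (by rw [hφ0, coeff_zero_C])
    ext n
    rw [derivative_C, hΔ, coeff_C, map_zero]
    split_ifs
    · exact hb.symm
    · exact (map_zero δ).symm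
  refine ⟨{ toFun := φ
            map_one' := by rw [hconst 1 δ.map_one_eq_zero, map_one]
            map_zero' := by rw [hconst 0 (map_zero δ), map_zero]
            map_add' := fun b c => ?_
            map_mul' := fun b c => ?_ }, ?_, hφ0, fun b => ?_, fun c => ?_⟩
  · refine uniq _ _ (hφ' _) ?_ ?_
    · rw [Derivation.leibniz, hφ', hφ', hΔmul, smul_eq_mul, smul_eq_mul]
    · rw [coeff_zero_eq_constantCoeff_apply, coeff_zero_eq_constantCoeff_apply, map_mul,
        ← coeff_zero_eq_constantCoeff_apply, ← coeff_zero_eq_constantCoeff_apply,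
        ← coeff_zero_eq_constantCoeff_apply, hφ0, hφ0, hφ0]
  · refine uniq _ _ (hφ' _) ?_ ?_
    · rw [map_add, hφ', hφ', hΔadd]
    · rw [map_add, hφ0, hφ0, hφ0]
  · rw [continuous_powerSeries_iff]
    intro n
    change Continuous fun b => coeff n (φ b)
    simp only [hφ]
    exact (hδ.iterate n).const_mul _
  · change coeff 1 (φ b) = _
    rw [hφ]
    simp [a]
  · exact hconst _ (δ.map_algebraMap c)

end PowerSeriesTopology

/-! ### The object of power series over the closed fibre -/

section Tube

/-- The ring `F⟦t⟧` as a topological algebra over `k⟦t⟧`; the type is kept opaque to instance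
search, so that its only structure of algebra over `k⟦t⟧` is the coefficientwise one. -/
def Tube (F : Type u) [CommRing F] : Type u := PowerSeries F

variable (k : Type u) [Field k] (F : Type u) [CommRing F] [Algebra k F] [TopologicalSpace F]
  [IsTopologicalRing F]

instance (F : Type u) [CommRing F] : CommRing (Tube F) := inferInstanceAs (CommRing (PowerSeries F))

/-- The product topology. -/
instance (F : Type u) [CommRing F] [TopologicalSpace F] : TopologicalSpace (Tube F) :=
  inferInstanceAs (TopologicalSpace (PowerSeries F))

instance (F : Type u) [CommRing F] [TopologicalSpace F] [IsTopologicalRing F] :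
    IsTopologicalRing (Tube F) :=
  inferInstanceAs (IsTopologicalRing (PowerSeries F))

instance (F : Type u) [CommRing F] [IsDomain F] : IsDomain (Tube F) :=
  inferInstanceAs (IsDomain (PowerSeries F))

instance (k : Type u) [Field k] (F : Type u) [CommRing F] [Algebra k F] :
    Algebra (PowerSeries k) (Tube F) :=
  RingHom.toAlgebra (S := Tube F) (PowerSeries.map (algebraMap k F))

instance (k : Type u) [Field k] (F : Type u) [CommRing F] [Algebra k F] : Algebra k (Tube F) :=
  Algebra.compHom (Tube F) (algebraMap k (PowerSeries k))

instance (k : Type u) [Field k] (F : Type u) [CommRing F] [Algebra k F] :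
    IsScalarTower k (PowerSeries k) (Tube F) :=
  IsScalarTower.of_algebraMap_eq fun _ => rfl

/-- The elements of `Tube F` are the power series over `F`. -/
def tubeEquiv (F : Type u) [CommRing F] : Tube F ≃+* PowerSeries F := RingEquiv.refl _

lemma tubeEquiv_par (k : Type u) [Field k] (F : Type u) [CommRing F] [Algebra k F] :
    tubeEquiv F (par k (Tube F)) = PowerSeries.X := PowerSeries.map_X _

/-- The object `F⟦t⟧`, if its topology is of one of the admissible kinds. -/
def tube [IsDomain F] [IsNoetherianRing F] (h : IsCurveKind k (Tube F) ∨
    IsFunctionFieldKind k (Tube F) ∨ IsDiscKind k (Tube F) ∨ IsPuncturedDiscKind k (Tube F)) :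
    Obj k where
  carrier := Tube F
  noetherian := inferInstanceAs (IsNoetherianRing (PowerSeries F))
  domain := inferInstance
  flat := flat_of_injective k _ (PowerSeries.map_injective _ (algebraMap k F).injective)
  fibreDomain := by
    rw [Ideal.Quotient.isDomain_iff_prime,
      show par k (Tube F) = (PowerSeries.X : PowerSeries F) from PowerSeries.map_X _]
    exact PowerSeries.span_X_isPrime (R := F)
  kind := h

end Tube

/-! ### Adic topologies -/

section Adic

open PowerSeries

open scoped Topology in
/-- Neighbourhoods of zero in the product topology only restrict finitely many coefficients. -/
lemma exists_nhds_coeff {B : Type*} [CommRing B] [TopologicalSpace B] {U : Set (PowerSeries B)}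
    (hU : U ∈ 𝓝 0) : ∃ M : ℕ, ∃ W ∈ 𝓝 (0 : B),
      ∀ f : PowerSeries B, (∀ i < M, coeff i f ∈ W) → f ∈ U := by
  have h : Filter.comap (fun (f : PowerSeries B) (n : ℕ) => coeff n f) (𝓝 fun _ => 0) ≤ 𝓝 0 := by
    have : Filter.Tendsto (fun f : PowerSeries B => f)
        (Filter.comap (fun (f : PowerSeries B) (n : ℕ) => coeff n f) (𝓝 fun _ => 0)) (𝓝 0) := by
      rw [PowerSeries.WithPiTopology.tendsto_iff_coeff_tendsto]
      intro d
      have h1 := (continuous_apply d).tendsto (fun _ : ℕ => (0 : B))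
      rw [map_zero]
      exact h1.comp Filter.tendsto_comap
    exact this
  obtain ⟨V, hV, hVU⟩ := h hU
  rw [nhds_pi, Filter.mem_pi] at hV
  obtain ⟨I, hI, t, ht, hIt⟩ := hV
  obtain ⟨M, hM⟩ := hI.bddAbove
  refine ⟨M + 1, ⋂ i ∈ I, t i, (Filter.biInter_mem hI).2 fun i _ => ht i, fun f hf => hVU (hIt ?_)⟩
  intro i hi
  exact Set.mem_iInter₂.1 (hf i (Nat.lt_succ_of_le (hM hi))) i hi

lemma isAdic_map_quotient {R : Type*} [CommRing R] [TopologicalSpace R] [IsTopologicalRing R]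
    {J : Ideal R} (hJ : IsAdic J) (I : Ideal R) : IsAdic (J.map (Ideal.Quotient.mk I)) := by
  rw [isAdic_iff] at hJ ⊢
  have himg : ∀ n : ℕ, (((J.map (Ideal.Quotient.mk I)) ^ n : Ideal (R ⧸ I)) : Set (R ⧸ I)) =
      Ideal.Quotient.mk I '' ((J ^ n : Ideal R) : Set R) := fun n => by
    rw [← Ideal.map_pow]
    ext x
    exact Ideal.mem_map_iff_of_surjective _ Ideal.Quotient.mk_surjective
  refine ⟨fun n => ?_, fun s hs => ?_⟩
  · rw [himg]
    exact QuotientRing.isOpenMap_coe I _ (hJ.1 n)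
  · obtain ⟨n, hn⟩ := hJ.2 (Ideal.Quotient.mk I ⁻¹' s)
      (continuous_quot_mk.continuousAt.preimage_mem_nhds (by exact hs))
    exact ⟨n, by rw [himg]; exact Set.image_subset_iff.2 hn⟩

variable {R B : Type*} [CommRing R] [CommRing B]

/-- For a chart `κ : R → B⟦X⟧` lifting `π : R → R/t = B` and an ideal `J ∋ t`, membership in `Jᴺ`
is read off from the coefficients. -/
lemma mem_pow_iff_coeff {π : R →+* B} (hπ : Function.Surjective π) {t : R}
    (hker : ∀ x, π x = 0 → t ∣ x) {κ : R →+* PowerSeries B} (hκt : κ t = X)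
    (hκ : ∀ x, coeff 0 (κ x) = π x) {J : Ideal R} (htJ : t ∈ J) (N : ℕ) (y : R) :
    y ∈ J ^ N ↔ ∀ i < N, coeff i (κ y) ∈ (J.map π) ^ (N - i) := by
  have forw : ∀ (N : ℕ) (y : R), y ∈ J ^ N → ∀ i, coeff i (κ y) ∈ (J.map π) ^ (N - i) := by
    intro N
    induction N with
    | zero => intro y _ i; simp
    | succ N ih =>
      intro y hy
      rw [pow_succ] at hy
      induction hy using Submodule.mul_induction_on' with
      | mem_mul_mem m hm n hn =>
        intro i
        rw [map_mul, coeff_mul]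
        refine Ideal.sum_mem _ fun p hp => ?_
        have hp' := Finset.HasAntidiagonal.mem_antidiagonal.1 hp
        have h1 : coeff p.2 (κ n) ∈ (J.map π) ^ (1 - p.2) := by
          rcases p with ⟨a, _ | b⟩
          · rw [Nat.sub_zero, pow_one, hκ]; exact Ideal.mem_map_of_mem _ hn
          · simp
        have h2 := Ideal.mul_mem_mul (ih m hm p.1) h1
        rw [← pow_add] at h2
        exact Ideal.pow_le_pow_right (by omega) h2
      | add x _ y _ hx hy =>
        intro i
        rw [map_add, map_add]
        exact Ideal.add_mem _ (hx i) (hy i)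
  refine ⟨fun hy i _ => forw N y hy i, ?_⟩
  -- Subtract an element of `Jᴺ` with the same constant term; the difference is divisible by `t`.
  induction N generalizing y with
  | zero => intro _; simp
  | succ N ih =>
    intro hy
    have h0 := hy 0 N.succ_pos
    rw [hκ, Nat.sub_zero, ← Ideal.map_pow, Ideal.mem_map_iff_of_surjective _ hπ] at h0
    obtain ⟨j, hj, hjy⟩ := h0
    obtain ⟨z, hz⟩ := hker (y - j) (by rw [map_sub, hjy, sub_self])
    have hzN : z ∈ J ^ N := ih z fun i hi => by
      have h1 : coeff (i + 1) (κ (y - j)) = coeff i (κ z) := by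
        rw [hz, map_mul, hκt, coeff_succ_X_mul]
      rw [← h1, map_sub, map_sub]
      have h2 := Ideal.sub_mem _ (hy (i + 1) (by omega)) (forw (N + 1) j hj (i + 1))
      rwa [Nat.add_sub_add_right] at h2
    rw [sub_eq_iff_eq_add.1 hz, pow_succ']
    exact Ideal.add_mem _ (Ideal.mul_mem_mul htJ hzN) (by rwa [← pow_succ'])

/-- A chart is a topological embedding for the `J`-adic topologies. -/
lemma isInducing_of_isAdic [TopologicalSpace R] [IsTopologicalRing R] [TopologicalSpace B]
    [IsTopologicalRing B] {π : R →+* B} (hπ : Function.Surjective π) {t : R}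
    (hker : ∀ x, π x = 0 → t ∣ x) {κ : R →+* PowerSeries B} (hκt : κ t = X)
    (hκ : ∀ x, coeff 0 (κ x) = π x) {J : Ideal R} (htJ : t ∈ J) (hJ : IsAdic J)
    (hJB : IsAdic (J.map π)) : Topology.IsInducing κ := by
  rw [IsTopologicalAddGroup.isInducing_iff_nhds_zero]
  rw [isAdic_iff] at hJ hJB
  ext s
  rw [Filter.mem_comap]
  constructor
  · intro hs
    obtain ⟨n, hn⟩ := hJ.2 s hs
    refine ⟨⋂ i ∈ Finset.range n, coeff (R := B) i ⁻¹' (((J.map π) ^ n : Ideal B) : Set B),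
      ?_, ?_⟩
    · refine (Filter.biInter_mem (Finset.finite_toSet _)).2 fun i _ => ?_
      refine (PowerSeries.WithPiTopology.continuous_coeff B i).continuousAt.preimage_mem_nhds ?_
      rw [map_zero]
      exact (hJB.1 n).mem_nhds (Ideal.zero_mem _)
    · intro y hy
      refine hn ((mem_pow_iff_coeff hπ hker hκt hκ htJ n y).2 fun i hi => ?_)
      exact Ideal.pow_le_pow_right (Nat.sub_le _ _)
        (Set.mem_iInter₂.1 hy i (Finset.mem_range.2 hi))
  · rintro ⟨U, hU, hUs⟩
    obtain ⟨M, W, hW, hMW⟩ := exists_nhds_coeff hU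
    obtain ⟨m, hm⟩ := hJB.2 W hW
    refine Filter.mem_of_superset ((hJ.1 (M + m)).mem_nhds (Ideal.zero_mem _)) fun y hy => ?_
    refine hUs (hMW _ fun i hi => hm ?_)
    exact Ideal.pow_le_pow_right (by omega)
      ((mem_pow_iff_coeff hπ hker hκt hκ htJ _ y).1 hy i (by omega))

/-- If `B` is `I`-adic, the product topology on `B⟦X⟧` is `(I, X)`-adic. -/
lemma isAdic_powerSeries [TopologicalSpace B] [IsTopologicalRing B] {I : Ideal B} (hI : IsAdic I) :
    IsAdic (I.comap (constantCoeff (R := B))) := by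
  have hmem := mem_pow_iff_coeff (R := PowerSeries B) (κ := RingHom.id _)
    (π := constantCoeff (R := B)) constantCoeff_surj (t := X) (fun x hx => X_dvd_iff.2 hx) rfl
    (fun x => coeff_zero_eq_constantCoeff_apply x) (J := I.comap (constantCoeff (R := B)))
    (by rw [Ideal.mem_comap, constantCoeff_X]; exact Ideal.zero_mem _)
  rw [Ideal.map_comap_of_surjective _ constantCoeff_surj] at hmem
  rw [isAdic_iff] at hI ⊢
  constructor
  · intro n
    have : (((I.comap (constantCoeff (R := B))) ^ n : Ideal (PowerSeries B)) : Set _) =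
        ⋂ i ∈ Finset.range n, coeff (R := B) i ⁻¹' ((I ^ (n - i) : Ideal B) : Set B) := by
      ext y
      rw [SetLike.mem_coe, hmem]
      simp
    rw [this]
    refine isOpen_biInter_finset fun i _ => ?_
    exact (hI.1 _).preimage (PowerSeries.WithPiTopology.continuous_coeff B i)
  · intro s hs
    obtain ⟨M, W, hW, hMW⟩ := exists_nhds_coeff hs
    obtain ⟨m, hm⟩ := hI.2 W hW
    refine ⟨M + m, fun y hy => hMW _ fun i hi => hm ?_⟩
    exact Ideal.pow_le_pow_right (by omega) ((hmem _ y).1 hy i (by omega))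

end Adic

/-! ### Charts from sections of the completion -/

section Sections

open PowerSeries

variable {R : Type*} [CommRing R]

/-- The kernel of the projection of the `t`-adic completion of `R` to `R/(t)` is generated by `t`. -/
lemma adicCompletion_dvd_iff (t : R) (x : AdicCompletion (Ideal.span {t}) R) :
    algebraMap R _ t ∣ x ↔ AdicCompletion.evalOneₐ (Ideal.span {t}) x = 0 := by
  have h := AdicCompletion.ker_evalOneₐ_eq_map (I := Ideal.span {t})
    ⟨{t}, by rw [Finset.coe_singleton]⟩
  rw [Ideal.map_span, Set.image_singleton] at h
  rw [← Ideal.mem_span_singleton, ← h, RingHom.mem_ker]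
  rfl

lemma adicCompletion_mul_cancel {t : R} (ht : ∀ x, t * x = 0 → x = 0)
    (x : AdicCompletion (Ideal.span {t}) R) (hx : algebraMap R _ t * x = 0) : x = 0 := by
  obtain ⟨r, rfl⟩ := AdicCompletion.mk_surjective _ _ x
  refine AdicCompletion.ext_evalₐ fun n => ?_
  rw [AdicCompletion.evalₐ_mk, map_zero, ← AdicCompletion.Ideal.mk_eq_mk _ n.le_succ]
  have h := congrArg (AdicCompletion.evalₐ (Ideal.span {t}) (n + 1)) hx
  rw [map_mul, AlgHom.commutes, map_zero, AdicCompletion.evalₐ_mk, Ideal.Quotient.algebraMap_eq,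
    ← map_mul, Ideal.Quotient.eq_zero_iff_mem, mem_span_pow_iff_dvd] at h
  obtain ⟨y, hy⟩ := h
  rw [Ideal.Quotient.eq_zero_iff_mem, mem_span_pow_iff_dvd]
  refine ⟨y, sub_eq_zero.1 (ht _ ?_)⟩
  rw [mul_sub, hy]; ring

instance adicCompletion_isAdicComplete (t : R) :
    IsAdicComplete (Ideal.span {algebraMap R (AdicCompletion (Ideal.span {t}) R) t})
      (AdicCompletion (Ideal.span {t}) R) := by
  have h := (IsAdicComplete.map_algebraMap_iff (I := Ideal.span {t})
    (S := AdicCompletion (Ideal.span {t}) R) (M := AdicCompletion (Ideal.span {t}) R)).2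
    (AdicCompletion.isAdicComplete ⟨{t}, by rw [Finset.coe_singleton]⟩)
  rwa [Ideal.map_span, Set.image_singleton] at h

/-- A section of `R̂ → R/t` over the `t`-adic completion identifies `R̂` with `(R/t)⟦X⟧`, hence gives
a chart `R → (R/t)⟦X⟧`. -/
lemma exists_chart_of_section {t : R} (ht : ∀ x, t * x = 0 → x = 0)
    (φ : R ⧸ Ideal.span {t} →+* AdicCompletion (Ideal.span {t}) R)
    (hφ : ∀ b, AdicCompletion.evalOneₐ (Ideal.span {t}) (φ b) = b) :
    ∃ κ : R →+* PowerSeries (R ⧸ Ideal.span {t}), κ t = X ∧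
      (∀ r, coeff 0 (κ r) = Ideal.Quotient.mk _ r) ∧
      ∀ r b, algebraMap R _ r = φ b → κ r = C b := by
  obtain ⟨E, hC, hX⟩ := exists_powerSeries_eval (algebraMap R _ t) φ
  have hb : Function.Bijective E := powerSeries_eval_bijective
    (adicCompletion_mul_cancel ht) (φ := φ)
    (fun a ha => by rw [adicCompletion_dvd_iff, hφ] at ha; exact ha)
    (fun c => ⟨AdicCompletion.evalOneₐ _ c, by
      rw [adicCompletion_dvd_iff, map_sub, hφ, sub_self]⟩) hC hX
  let e := RingEquiv.ofBijective E hb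
  have he : ∀ f, e f = E f := fun f => rfl
  refine ⟨e.symm.toRingHom.comp (algebraMap R _), ?_, ?_, ?_⟩
  · change e.symm (algebraMap R _ t) = X
    rw [RingEquiv.symm_apply_eq, he, hX]
  · intro r
    change coeff 0 (e.symm (algebraMap R _ r)) = _
    set f := e.symm (algebraMap R _ r) with hf
    have h1 : E f = algebraMap R _ r := e.apply_symm_apply _
    obtain ⟨g, hg⟩ := exists_eq_trunc_add f 1
    have h2 : AdicCompletion.evalOneₐ _ (E f) = coeff 0 f := by
      conv_lhs => rw [hg]
      rw [map_add, map_mul, map_pow, pow_one, hX, map_add, trunc_one_left, Polynomial.coe_C, hC, hφ,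
        (adicCompletion_dvd_iff _ _).1 (Dvd.intro _ rfl), add_zero]
    rw [← h2, h1]
    rfl
  · intro r b hrb
    change e.symm (algebraMap R _ r) = C b
    rw [RingEquiv.symm_apply_eq, he, hC, hrb]

end Sections

/-! ### Existence of charts -/

section Charts

open PowerSeries

variable {k : Type u} [Field k]

lemma isQuotientMap_red (Y : Obj k) : Topology.IsQuotientMap Y.red :=
  isQuotientMap_quot_mk

/-- A chart of `Y`: a homomorphism over `k⟦t⟧` to the ring `(Y/(t))⟦t⟧` that lifts the reduction
`Y → Y/(t)` and induces the topology of `Y`. -/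
structure IsChart (Y : Obj k) (κ : Y →+* PowerSeries (Fibre k Y)) : Prop where
  inducing : Topology.IsInducing κ
  algebraMap : ∀ a, κ (algebraMap (PowerSeries k) Y a) = PowerSeries.map (algebraMap k (Fibre k Y)) a
  coeff_zero : ∀ y, coeff 0 (κ y) = Y.red y

/-- If `Y/(t) ≅ k'⟦s⟧`, the reduction from the `t`-adic completion of `Y` has a section: `k'` lifts
since it is étale over `k`, and any lift of `s` can be substituted into power series. -/
lemma exists_section_of_powerSeries [CharZero k] (Y : Obj k) {k' : Type u} [Field k'] [Algebra k k']
    [FiniteDimensional k k'] (e : Fibre k Y ≃ₐ[k] PowerSeries k') :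
    ∃ φ : Fibre k Y →ₐ[k] AdicCompletion (Ideal.span {par k Y}) Y,
      ∀ b, AdicCompletion.evalOneₐ (Ideal.span {par k Y}) (φ b) = b := by
  set I := Ideal.span {par k Y} with hI
  have : Algebra.FormallyEtale k k' := Algebra.FormallyEtale.of_isSeparable k k'
  obtain ⟨g, hg⟩ := Algebra.FormallySmooth.exists_adicCompletionEvalOneₐ_comp_eq (R := k) (I := I)
    (e.symm.toAlgHom.comp (IsScalarTower.toAlgHom k k' (PowerSeries k')))
  have hg' : ∀ a, e (AdicCompletion.evalOneₐ I (g a)) = C a := fun a => by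
    have h1 : AdicCompletion.evalOneₐ I (g a) = e.symm (C a) := DFunLike.congr_fun hg a
    rw [h1]; exact e.apply_symm_apply _
  obtain ⟨S, hS⟩ := AdicCompletion.evalOneₐ_surjective I (e.symm X)
  let ev : AdicCompletion I Y →+* PowerSeries k' :=
    e.toRingEquiv.toRingHom.comp (AdicCompletion.evalOneₐ I).toRingHom
  have hev : ∀ x, algebraMap Y (AdicCompletion I Y) (par k Y) ∣ x ↔ ev x = 0 := fun x => by
    rw [adicCompletion_dvd_iff]
    exact (map_eq_zero_iff e e.injective).symm
  have hevS : ev S = X := by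
    change e (AdicCompletion.evalOneₐ I S) = X
    rw [hS]; exact e.apply_symm_apply _
  have hevsurj : Function.Surjective ev :=
    e.surjective.comp (AdicCompletion.evalOneₐ_surjective I)
  have : IsAdicComplete (Ideal.span {S}) (AdicCompletion I Y) := by
    refine isAdicComplete_of_quotient
      (t := algebraMap Y (AdicCompletion I Y) (par k Y))
      (adicCompletion_mul_cancel fun x => par_mul_cancel Y) ?_ ?_ ?_
    · intro x hx
      rw [hev, map_mul, hevS] at hx
      rw [hev]
      exact (mul_eq_zero.1 hx).resolve_left X_ne_zero
    · intro x hx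
      rw [hev]
      refine eq_zero_of_forall_pow_dvd (S := (X : PowerSeries k')) fun n => ?_
      obtain ⟨y, hy⟩ := hx n
      rw [hev, map_sub, map_mul, map_pow, hevS, sub_eq_zero] at hy
      exact ⟨_, hy⟩
    · intro u
      choose v hv using fun n => hevsurj (PowerSeries.mk fun m =>
        ∑ i ∈ Finset.range (m + 1), coeff (m - i) (ev (u (n + i))))
      refine ⟨v, fun n => ?_⟩
      rw [hev, map_sub, map_add, map_mul, hevS, sub_eq_zero, hv, hv]
      ext m
      rw [coeff_mk, map_add]
      cases m with
      | zero => simp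
      | succ m =>
        rw [coeff_succ_X_mul, coeff_mk, Finset.sum_range_succ', add_comm]
        congr 1
        refine Finset.sum_congr rfl fun i _ => ?_
        rw [Nat.add_sub_add_right, add_assoc n 1 i, add_comm 1 i]
  obtain ⟨E, hC, hX⟩ := exists_powerSeries_eval S (g : k' →+* AdicCompletion I Y)
  have hid : ev.comp E = RingHom.id _ := by
    have hh : IsHausdorff (Ideal.span {(ev.comp E) X}) (PowerSeries k') := by
      rw [RingHom.comp_apply, hX, hevS]; infer_instance
    refine powerSeries_hom_ext (fun a => ?_) ?_
    · rw [RingHom.comp_apply, hC]; exact hg' a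
    · rw [RingHom.comp_apply, hX, hevS]; rfl
  refine ⟨{ E.comp e.toRingEquiv.toRingHom with
    commutes' := fun c => ?_ }, fun b => ?_⟩
  · change E (e (algebraMap k _ c)) = _
    rw [e.commutes, IsScalarTower.algebraMap_apply k k' (PowerSeries k'), algebraMap_eq, hC]
    exact g.commutes c
  · refine e.injective ?_
    exact DFunLike.congr_fun hid (e b)

/-- If the closed fibre is formally smooth, it lifts to the completion. -/
lemma exists_section_of_formallySmooth (Y : Obj k) [Algebra.FormallySmooth k (Fibre k Y)] :
    ∃ φ : Fibre k Y →ₐ[k] AdicCompletion (Ideal.span {par k Y}) Y,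
      ∀ b, AdicCompletion.evalOneₐ (Ideal.span {par k Y}) (φ b) = b := by
  obtain ⟨g, hg⟩ := Algebra.FormallySmooth.exists_adicCompletionEvalOneₐ_comp_eq (R := k)
    (I := Ideal.span {par k Y}) (AlgHom.id k (Fibre k Y))
  exact ⟨g, fun b => DFunLike.congr_fun hg b⟩

lemma formallySmooth_of_isFunctionFieldKind [CharZero k] {R : Type u} [CommRing R]
    [TopologicalSpace R] [Algebra k R] [Algebra (PowerSeries k) R] [IsScalarTower k (PowerSeries k) R]
    (h : IsFunctionFieldKind k R) : Algebra.FormallySmooth k (Fibre k R) := by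
  obtain ⟨-, hF, hE, -⟩ := h
  let : Field (Fibre k R) := hF.toField
  exact Algebra.FormallySmooth.of_perfectField

/-- If the topology is adic, a lift of the closed fibre to the `t`-adic completion of `Y` defines a
chart: the completion is then a ring of power series over the closed fibre. -/
lemma exists_isChart_of_section (Y : Obj k) {J : Ideal Y} (hJ : IsAdic J) (hpar : par k Y ∈ J)
    (φ : Fibre k Y →ₐ[k] AdicCompletion (Ideal.span {par k Y}) Y)
    (hφ : ∀ b, AdicCompletion.evalOneₐ (Ideal.span {par k Y}) (φ b) = b) :
    ∃ κ, IsChart Y κ := by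
  obtain ⟨κ, hX, h0, hc⟩ := exists_chart_of_section (t := par k Y) (fun x => par_mul_cancel Y)
    (φ : Fibre k Y →+* _) hφ
  refine ⟨κ, ?_, ?_, h0⟩
  · exact isInducing_of_isAdic (π := Y.red) Ideal.Quotient.mk_surjective
      (fun x hx => red_eq_zero_iff.1 hx) hX h0 hpar hJ (isAdic_map_quotient hJ _)
  · intro a
    have hX' : κ (algebraMap (PowerSeries k) Y X) = X := hX
    refine DFunLike.congr_fun (f := κ.comp (algebraMap (PowerSeries k) Y)) ?_ a
    have hh : IsHausdorff (Ideal.span {(κ.comp (algebraMap (PowerSeries k) Y)) X})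
        (PowerSeries (Fibre k Y)) := by
      rw [RingHom.comp_apply, hX']; infer_instance
    refine powerSeries_hom_ext (fun c => ?_) ?_
    · rw [map_C, RingHom.comp_apply]
      refine hc _ _ ?_
      have h1 := φ.commutes c
      change φ (algebraMap k (Fibre k Y) c) = _ at h1
      change _ = φ (algebraMap k (Fibre k Y) c)
      rw [h1, IsScalarTower.algebraMap_apply k Y (AdicCompletion _ _),
        IsScalarTower.algebraMap_apply k (PowerSeries k) Y]
      rfl
    · rw [map_X, RingHom.comp_apply, hX']

open scoped Topology in
/-- For an object of the last kind, the closed fibre is topologically isomorphic to `k'((s))`. -/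
lemma IsPuncturedDiscKind.exists_equiv {Y : Obj k} (h : IsPuncturedDiscKind k Y) :
    ∃ (k' : Type u) (_ : Field k') (_ : Algebra k k') (_ : FiniteDimensional k k')
      (e : Fibre k Y ≃A[k] LaurentSeries k') (ι : Y →+* PowerSeries (LaurentSeries k')),
      (∀ a : PowerSeries k, ι (algebraMap (PowerSeries k) Y a) =
        PowerSeries.map (algebraMap k (LaurentSeries k')) a) ∧
      Topology.IsInducing ι ∧ ∀ y, coeff 0 (ι y) = e (Y.red y) := by
  obtain ⟨k', _, _, hk', ι, hι, hind, hadic⟩ := h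
  have hpar : ι (par k Y) = X := by rw [hι, map_X]
  let f : Y →+* LaurentSeries k' := (constantCoeff (R := LaurentSeries k')).comp ι
  have hf : ∀ y, f y = coeff 0 (ι y) := fun y => (coeff_zero_eq_constantCoeff_apply _).symm
  have hf0 : ∀ y, f y = 0 → par k Y ∣ y := fun y hy => by
    have h1 : ι (par k Y) ^ 1 ∣ ι y := by rw [pow_one, hpar]; exact X_dvd_iff.2 hy
    have := (hadic 1).1 y h1
    rwa [pow_one] at this
  have happrox : ∀ g n, ∃ y, ∀ i < n, coeff i (ι y) = coeff i g := fun g n => by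
    obtain ⟨y, hy⟩ := (hadic n).2 g
    rw [hpar, X_pow_dvd_iff] at hy
    exact ⟨y, fun i hi => by have := hy i hi; rw [map_sub, sub_eq_zero] at this; exact this.symm⟩
  have hfsurj : Function.Surjective f := fun l => by
    obtain ⟨y, hy⟩ := happrox (C l) 1
    exact ⟨y, by rw [hf, hy 0 one_pos, coeff_zero_C]⟩
  have hfc : Continuous f := (PowerSeries.WithPiTopology.continuous_constantCoeff _).comp
    hind.continuous
  have hfo : IsOpenMap f := by
    rw [IsTopologicalAddGroup.isOpenMap_iff_nhds_zero]
    intro s hs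
    rw [Filter.mem_map, hind.nhds_eq_comap, map_zero] at hs
    obtain ⟨V, hV, hVs⟩ := hs
    obtain ⟨M, W, hW, hMW⟩ := exists_nhds_coeff hV
    refine Filter.mem_of_superset hW fun l hl => ?_
    obtain ⟨y, hy⟩ := happrox (C l) (M + 1)
    have h1 : ι y ∈ V := hMW _ fun i hi => by
      rw [hy i (by omega), coeff_C]
      split_ifs
      · exact hl
      · exact mem_of_mem_nhds hW
    have h2 : f y = l := by rw [hf, hy 0 (by omega), coeff_zero_C]
    rw [← h2]
    exact hVs h1
  have hker : RingHom.ker f = Ideal.span {par k Y} := by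
    ext y
    rw [RingHom.mem_ker, Ideal.mem_span_singleton]
    refine ⟨hf0 y, ?_⟩
    rintro ⟨z, rfl⟩
    rw [hf, map_mul, hpar, coeff_zero_eq_constantCoeff_apply, map_mul, constantCoeff_X, zero_mul]
  let fbar : Fibre k Y →+* LaurentSeries k' := Ideal.Quotient.lift _ f fun a ha => by
    rwa [← hker] at ha
  have hfbar : ∀ y, fbar (Y.red y) = f y := fun y => rfl
  have hbij : Function.Bijective fbar := by
    constructor
    · rw [injective_iff_map_eq_zero]
      intro a ha
      obtain ⟨y, rfl⟩ := Ideal.Quotient.mk_surjective a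
      exact red_eq_zero_iff.2 (hf0 y ha)
    · intro l
      obtain ⟨y, rfl⟩ := hfsurj l
      exact ⟨Y.red y, rfl⟩
  have hcont : Continuous fbar := by
    exact (isQuotientMap_red Y).continuous_iff.2 hfc
  have hopen : IsOpenMap fbar := by
    intro U hU
    have h1 : fbar '' U = f '' (Y.red ⁻¹' U) := by
      ext l
      constructor
      · rintro ⟨a, ha, rfl⟩
        obtain ⟨y, rfl⟩ := Ideal.Quotient.mk_surjective a
        exact ⟨y, ha, rfl⟩
      · rintro ⟨y, hy, rfl⟩
        exact ⟨Y.red y, hy, rfl⟩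
    rw [h1]
    exact hfo _ (hU.preimage continuous_quot_mk)
  let e₀ := RingEquiv.ofBijective fbar hbij
  let e₁ : Fibre k Y ≃ₐ[k] LaurentSeries k' := AlgEquiv.ofRingEquiv (f := e₀) fun c => by
    change f (algebraMap k Y c) = _
    rw [hf, algebraMap_eq_algebraMap_C, hι, map_C, coeff_zero_C]
  let e : Fibre k Y ≃A[k] LaurentSeries k' :=
    { e₁ with
      continuous_toFun := hcont
      continuous_invFun := by
        have := (Equiv.toHomeomorphOfContinuousOpen e₁.toEquiv hcont hopen).symm.continuous
        exact this }
  exact ⟨k', inferInstance, inferInstance, hk', e, ι, hι, hind, fun y => (hf y).symm⟩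

/-- Every object has a chart. -/
theorem exists_isChart [CharZero k] (Y : Obj k) : ∃ κ, IsChart Y κ := by
  rcases Y.kind with h | h | h | h
  · have := h.2.1
    obtain ⟨φ, hφ⟩ := exists_section_of_formallySmooth Y
    exact exists_isChart_of_section Y h.1 (Ideal.mem_span_singleton_self _) φ hφ
  · have := formallySmooth_of_isFunctionFieldKind h
    obtain ⟨φ, hφ⟩ := exists_section_of_formallySmooth Y
    exact exists_isChart_of_section Y h.1 (Ideal.mem_span_singleton_self _) φ hφ
  · obtain ⟨k', _, _, hk', ⟨e⟩, J, -, hpar, hJ⟩ := h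
    obtain ⟨φ, hφ⟩ := exists_section_of_powerSeries Y e
    exact exists_isChart_of_section Y hJ hpar φ hφ
  · obtain ⟨k', _, _, hk', e, ι, hι, hind, h0⟩ := h.exists_equiv
    let e' : LaurentSeries k' →+* Fibre k Y := e.symm.toAlgEquiv.toRingEquiv.toRingHom
    have he' : ∀ l, e' l = e.symm l := fun l => rfl
    have h1 : Topology.IsInducing (PowerSeries.map e') := by
      have hc : Continuous (PowerSeries.map e') := continuous_powerSeries_map e.symm.continuous
      refine Topology.IsInducing.of_comp hc
        (g := PowerSeries.map (e.toAlgEquiv.toRingEquiv.toRingHom))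
        (continuous_powerSeries_map e.continuous) ?_
      convert Topology.IsInducing.id
      ext f n
      simp only [Function.comp_apply, coeff_map, id_eq]
      rw [he']
      exact congrArg (fun z => HahnSeries.coeff z _) (e.apply_symm_apply _)
    refine ⟨(PowerSeries.map e').comp ι, h1.comp hind, fun a => ?_, fun y => ?_⟩
    · rw [RingHom.comp_apply, hι]
      ext n
      rw [coeff_map, coeff_map, coeff_map, he']
      exact e.symm.toAlgEquiv.commutes _
    · rw [RingHom.comp_apply, coeff_map, h0, he']
      exact e.symm_apply_apply _

end Charts

/-! ### The completion of an object -/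

section TubeKinds

open PowerSeries

variable {k : Type u} [Field k]

/-- The closed fibre of `F⟦t⟧` is `F`. -/
def tubeFibre (k : Type u) [Field k] (F : Type u) [CommRing F] [Algebra k F] :
    Fibre k (Tube F) ≃ₐ[k] F :=
  let f : Tube F →ₐ[k] F :=
    { (constantCoeff (R := F)).comp (tubeEquiv F).toRingHom with
      commutes' := fun c => by
        change constantCoeff (PowerSeries.map (algebraMap k F) (C c)) = _
        rw [map_C, constantCoeff_C] }
  (Ideal.quotientEquivAlgOfEq k (by
    ext x
    rw [Ideal.mem_span_singleton, RingHom.mem_ker]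
    change par k (Tube F) ∣ x ↔ constantCoeff (tubeEquiv F x) = 0
    rw [← X_dvd_iff, ← tubeEquiv_par k F]
    exact (map_dvd_iff (tubeEquiv F)).symm)).trans
    (Ideal.quotientKerAlgEquivOfSurjective (f := f) (constantCoeff_surj (R := F)))

/-- The isomorphism on Kähler differentials induced by an isomorphism of algebras. -/
def kaehlerEquiv {A B : Type u} [CommRing A] [CommRing B] [Algebra k A] [Algebra k B]
    (e : A ≃ₐ[k] B) : KaehlerDifferential k A ≃+ KaehlerDifferential k B :=
  have h : ∀ {A B : Type u} [CommRing A] [CommRing B] [Algebra k A] [Algebra k B]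
      (e : A ≃ₐ[k] B) w, kaehlerMap k e.symm.toAlgHom (kaehlerMap k e.toAlgHom w) = w := by
    intro A B _ _ _ _ e w
    have hv : w ∈ Submodule.span A (Set.range (KaehlerDifferential.D k A)) := by
      rw [KaehlerDifferential.span_range_derivation]; trivial
    induction hv using Submodule.span_induction with
    | mem x hx =>
      obtain ⟨b, rfl⟩ := hx
      have h1 := kaehlerMap_smul_D k e.toAlgHom 1 b
      have h2 := kaehlerMap_smul_D k e.symm.toAlgHom 1 (e b)
      rw [one_smul, map_one, one_smul] at h1 h2
      refine (congrArg _ h1).trans (h2.trans ?_)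
      congr 1
      exact e.symm_apply_apply b
    | zero => rw [map_zero, map_zero]
    | add x y _ _ hx hy => rw [map_add, map_add, hx, hy]
    | smul a x _ hx =>
      rw [kaehlerMap_smul, kaehlerMap_smul, hx]
      congr 1
      exact e.symm_apply_apply a
  { kaehlerMap k e.toAlgHom with
    invFun := kaehlerMap k e.symm.toAlgHom
    left_inv := h e
    right_inv := fun w => h e.symm w }

lemma kaehlerEquiv_smul {A B : Type u} [CommRing A] [CommRing B] [Algebra k A] [Algebra k B]
    (e : A ≃ₐ[k] B) (a : A) (w : KaehlerDifferential k A) :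
    kaehlerEquiv e (a • w) = e a • kaehlerEquiv e w :=
  kaehlerMap_smul k e.toAlgHom a w

/-- The conditions on the closed fibre of a curve only depend on the fibre. -/
lemma curve_conditions_of_algEquiv {A B : Type u} [CommRing A] [CommRing B] [Algebra k A]
    [Algebra k B] (e : A ≃ₐ[k] B)
    (h : Algebra.FormallySmooth k A ∧ Module.Finite A (KaehlerDifferential k A) ∧
      Module.finrank A (KaehlerDifferential k A) = 1 ∧
      ∀ m : Ideal A, m.IsMaximal → Module.Finite k (A ⧸ m)) :
    Algebra.FormallySmooth k B ∧ Module.Finite B (KaehlerDifferential k B) ∧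
      Module.finrank B (KaehlerDifferential k B) = 1 ∧
      ∀ m : Ideal B, m.IsMaximal → Module.Finite k (B ⧸ m) := by
  obtain ⟨h1, h2, h3, h4⟩ := h
  refine ⟨Algebra.FormallySmooth.of_equiv e, ?_, ?_, fun m hm => ?_⟩
  · let f : KaehlerDifferential k A →ₛₗ[e.toRingEquiv.toRingHom] KaehlerDifferential k B :=
      { kaehlerEquiv e with map_smul' := kaehlerEquiv_smul e }
    have : RingHomSurjective e.toRingEquiv.toRingHom := ⟨e.surjective⟩
    exact Module.Finite.of_surjective f (kaehlerEquiv e).surjective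
  · rw [← h3, Module.finrank, Module.finrank,
      rank_eq_of_equiv_equiv e (kaehlerEquiv e) e.bijective (kaehlerEquiv_smul e)]
  · have : (m.comap (e : A →+* B)).IsMaximal := Ideal.comap_isMaximal_of_surjective _ e.surjective
    have := h4 _ this
    exact Module.Finite.equiv (Ideal.quotientEquivAlg (R₁ := k) (m.comap (e : A →+* B)) m e
      (Ideal.map_comap_of_surjective _ e.surjective _).symm).toLinearEquiv

lemma isAdic_bot_fibre (Y : Obj k) (h : IsAdic (Ideal.span {par k Y})) :
    IsAdic (⊥ : Ideal (Fibre k Y)) := by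
  have := isAdic_map_quotient h (Ideal.span {par k Y})
  rwa [Ideal.map_quotient_self] at this

variable (F : Type u) [CommRing F] [Algebra k F] [TopologicalSpace F] [IsTopologicalRing F]

lemma isAdic_tube {I : Ideal F} (hI : IsAdic I) :
    IsAdic (I.comap ((constantCoeff (R := F)).comp (tubeEquiv F).toRingHom)) :=
  isAdic_powerSeries hI

/-- If `F` is discrete, the topology of `F⟦t⟧` is `t`-adic. -/
lemma isAdic_tube_par (h : IsAdic (⊥ : Ideal F)) : IsAdic (Ideal.span {par k (Tube F)}) := by
  have h1 := isAdic_tube F h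
  convert h1 using 1
  ext x
  rw [Ideal.mem_span_singleton, Ideal.mem_comap, Ideal.mem_bot]
  change par k (Tube F) ∣ x ↔ constantCoeff (tubeEquiv F x) = 0
  rw [← X_dvd_iff, ← tubeEquiv_par k F]
  exact (map_dvd_iff (tubeEquiv F)).symm

/-- `(Y/(t))⟦t⟧` is of the same kind as `Y`. -/
lemma tube_kind (Y : Obj k) : IsCurveKind k (Tube (Fibre k Y)) ∨
    IsFunctionFieldKind k (Tube (Fibre k Y)) ∨ IsDiscKind k (Tube (Fibre k Y)) ∨
    IsPuncturedDiscKind k (Tube (Fibre k Y)) := by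
  rcases Y.kind with h | h | h | h
  · exact Or.inl ⟨isAdic_tube_par _ (isAdic_bot_fibre Y h.1),
      curve_conditions_of_algEquiv (tubeFibre k (Fibre k Y)).symm h.2⟩
  · obtain ⟨h1, h2, h3, h4⟩ := h
    have e := tubeFibre k (Fibre k Y)
    exact Or.inr (Or.inl ⟨isAdic_tube_par _ (isAdic_bot_fibre Y h1), e.toMulEquiv.isField h2,
      (Algebra.EssFiniteType.iff_of_algEquiv e).2 h3, e.trdeg_eq.trans h4⟩)
  · obtain ⟨k', _, _, hk', ⟨e⟩, J, hJ, hpar, hadic⟩ := h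
    refine Or.inr (Or.inr (Or.inl ⟨k', inferInstance, inferInstance, hk',
      ⟨(tubeFibre k _).trans e⟩, _, ?_, ?_, isAdic_tube _ (isAdic_map_quotient hadic _)⟩))
    · have h1 : (J.map Y.red).IsMaximal := by
        refine Ideal.IsMaximal.map_of_surjective_of_ker_le Ideal.Quotient.mk_surjective ?_
        rw [Ideal.mk_ker, Ideal.span_le, Set.singleton_subset_iff]
        exact hpar
      exact Ideal.comap_isMaximal_of_surjective _ (constantCoeff_surj (R := Fibre k Y))
    · rw [Ideal.mem_comap]
      change constantCoeff (tubeEquiv _ (par k (Tube (Fibre k Y)))) ∈ _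
      rw [tubeEquiv_par, constantCoeff_X]
      exact Ideal.zero_mem _
  · obtain ⟨k', _, _, hk', e, -⟩ := h.exists_equiv
    let e' : Fibre k Y →+* LaurentSeries k' := e.toAlgEquiv.toRingEquiv.toRingHom
    have he' : ∀ a, e' a = e a := fun a => rfl
    have hsurj : ∀ f, ∃ g : Tube (Fibre k Y), PowerSeries.map e' g = f := fun f =>
      ⟨PowerSeries.map e.symm.toAlgEquiv.toRingEquiv.toRingHom f, by
        ext n : 1
        exact e.apply_symm_apply _⟩
    have hinj : Function.Injective (PowerSeries.map e') := PowerSeries.map_injective _ e.injective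
    have hpar : PowerSeries.map e' (par k (Tube (Fibre k Y))) = X := by
      have := tubeEquiv_par k (Fibre k Y)
      exact (congrArg (PowerSeries.map e') this).trans (map_X _)
    refine Or.inr (Or.inr (Or.inr ⟨k', inferInstance, inferInstance, hk', PowerSeries.map e',
      fun a => ?_, ?_, fun n => ⟨fun x hx => ?_, fun y => ?_⟩⟩))
    · change PowerSeries.map e' (PowerSeries.map (algebraMap k (Fibre k Y)) a) = _
      ext n : 1
      rw [coeff_map, coeff_map, coeff_map, he']
      exact e.toAlgEquiv.commutes _
    · refine Topology.IsInducing.of_comp (continuous_powerSeries_map e.continuous)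
        (g := PowerSeries.map (e.symm.toAlgEquiv.toRingEquiv.toRingHom))
        (continuous_powerSeries_map e.symm.continuous) ?_
      have hid : ⇑(PowerSeries.map e.symm.toAlgEquiv.toRingEquiv.toRingHom) ∘
          ⇑(PowerSeries.map e') = id := by
        ext f n
        exact e.symm_apply_apply _
      have hind := Topology.IsInducing.id (X := PowerSeries (Fibre k Y))
      rw [← hid] at hind
      exact hind
    · obtain ⟨z, hz⟩ := hx
      obtain ⟨z, rfl⟩ := hsurj z
      refine ⟨z, hinj ?_⟩
      exact hz.trans ((map_mul (PowerSeries.map e') _ _).trans (congrArg (· * _)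
        (map_pow (PowerSeries.map e') _ _))).symm
    · obtain ⟨z, rfl⟩ := hsurj y
      exact ⟨z, Dvd.intro_left 0 (by rw [zero_mul]; exact (sub_self _).symm)⟩

/-- The object `(Y/(t))⟦t⟧`, which is the completion of `Y` along its closed fibre. -/
def Obj.completion (Y : Obj k) : Obj k :=
  haveI := Y.noetherian
  haveI := Y.fibreDomain
  tube k (Fibre k Y) (tube_kind Y)

/-- The elements of the completion are power series over the closed fibre. -/
def completionEquiv (Y : Obj k) : Y.completion ≃+* PowerSeries (Fibre k Y) := tubeEquiv (Fibre k Y)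

end TubeKinds

/-! ### Charts and completions -/

section ChartProperties

open PowerSeries

variable {k : Type u} [Field k] {Y : Obj k} {κ : Y →+* PowerSeries (Fibre k Y)}

lemma IsChart.map_par (hκ : IsChart Y κ) : κ (par k Y) = X := by
  rw [hκ.algebraMap, map_X]

lemma IsChart.pow_dvd_iff (hκ : IsChart Y κ) (n : ℕ) (y : Y) : X ^ n ∣ κ y ↔ par k Y ^ n ∣ y := by
  constructor
  · induction n generalizing y with
    | zero => intro _; rw [pow_zero]; exact one_dvd _
    | succ n ih =>
      intro h
      have h0 : Y.red y = 0 := by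
        rw [← hκ.coeff_zero]
        exact X_pow_dvd_iff.1 h 0 n.succ_pos
      obtain ⟨z, rfl⟩ := red_eq_zero_iff.1 h0
      obtain ⟨g, hg⟩ := h
      have hz : κ z = X ^ n * g := by
        have := Y.fibreDomain
        refine mul_left_cancel₀ (X_ne_zero (R := Fibre k Y)) ?_
        rw [map_mul κ, hκ.map_par] at hg
        rw [hg, pow_succ']; ring
      rw [pow_succ']
      exact mul_dvd_mul_left _ (ih z ⟨g, hz⟩)
  · rintro ⟨z, rfl⟩
    rw [map_mul κ, map_pow, hκ.map_par]
    exact Dvd.intro _ rfl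

lemma IsChart.exists_approx (hκ : IsChart Y κ) (n : ℕ) (g : PowerSeries (Fibre k Y)) :
    ∃ y, X ^ n ∣ g - κ y :=
  exists_approx_of_surjective hκ.map_par (fun b => by
    obtain ⟨y, rfl⟩ := Ideal.Quotient.mk_surjective b
    exact ⟨y, hκ.coeff_zero y⟩) n g

lemma IsChart.isAdicIso (hκ : IsChart Y κ) : IsAdicIso κ (par k Y) := fun n =>
  ⟨fun y h => by rw [hκ.map_par] at h; exact (hκ.pow_dvd_iff n y).1 h, fun g => by
    rw [hκ.map_par]; exact hκ.exists_approx n g⟩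

/-- A chart of a complete object is bijective. -/
lemma IsChart.bijective (hκ : IsChart Y κ) (hY : Y.IsComplete) : Function.Bijective κ := by
  have : IsAdicComplete (Ideal.span {par k Y}) Y := hY
  constructor
  · rw [injective_iff_map_eq_zero]
    intro y hy
    refine eq_zero_of_forall_pow_dvd (S := par k Y) fun n => ?_
    rw [← hκ.pow_dvd_iff, hy]
    exact dvd_zero _
  · intro g
    choose y hy using fun n => hκ.exists_approx n g
    obtain ⟨L, hL⟩ := exists_limit_of_pow_dvd (S := par k Y) y fun n => by
      rw [← hκ.pow_dvd_iff, map_sub]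
      have h1 := (pow_dvd_pow X n.le_succ).trans (hy (n + 1))
      have := dvd_sub (hy n) h1
      rwa [sub_sub_sub_cancel_left] at this
    refine ⟨L, sub_eq_zero.1 (eq_zero_of_forall_pow_dvd (S := (X : PowerSeries (Fibre k Y)))
      fun n => ?_)⟩
    have h1 : X ^ n ∣ κ (L - y n) := (hκ.pow_dvd_iff n _).2 (hL n)
    have := dvd_sub h1 (hy n)
    rwa [map_sub, sub_sub_sub_cancel_right] at this

/-- A chart, viewed as a morphism to the completion. -/
def IsChart.hom (hκ : IsChart Y κ) : Y.Hom Y.completion where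
  toFun := fun y => (completionEquiv Y).symm (κ y)
  map_one' := by rw [map_one, map_one]
  map_mul' x y := by rw [map_mul κ, map_mul]
  map_zero' := by rw [map_zero, map_zero]
  map_add' x y := by rw [map_add, map_add]
  commutes' a := hκ.algebraMap a
  cont := hκ.inducing.continuous

lemma completionEquiv_hom (hκ : IsChart Y κ) (y : Y) : completionEquiv Y (hκ.hom y) = κ y := rfl

lemma completion_isComplete (Y : Obj k) : Y.completion.IsComplete := by
  have h : par k Y.completion = (X : PowerSeries (Fibre k Y)) :=
    tubeEquiv_par k (Fibre k Y)
  change IsAdicComplete (Ideal.span {par k Y.completion}) (Y.completion)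
  rw [h]
  exact inferInstanceAs (IsAdicComplete (Ideal.span {(X : PowerSeries (Fibre k Y))})
    (PowerSeries (Fibre k Y)))

lemma IsChart.isCompletion (hκ : IsChart Y κ) : IsCompletion hκ.hom :=
  ⟨completion_isComplete Y, hκ.isAdicIso⟩

end ChartProperties

/-! ### Lifting isomorphisms of truncations -/

section Lifting

open PowerSeries

variable {k : Type u} [Field k]

lemma par_dvd_of_iso₂' {X Y : Obj k} (χ : X.Iso₂ Y) {x : X} {y : Y} (h : χ (X.red₂ x) = Y.red₂ y)
    (hx : par k X ∣ x) : par k Y ∣ y :=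
  par_dvd_of_iso₂ χ.symm (by rw [← h]; exact χ.symm_apply_apply _) hx

/-- An isomorphism of truncations induces an isomorphism of closed fibres. -/
lemma exists_fibre_iso {X Y : Obj k} (χ : X.Iso₂ Y) : ∃ v : Fibre k X ≃A[k] Fibre k Y,
    ∀ x y, χ (X.red₂ x) = Y.red₂ y → v (X.red x) = Y.red y := by
  have aux : ∀ {X Y : Obj k} (χ : X.Iso₂ Y), ∃ v : Fibre k X →+* Fibre k Y, Continuous v ∧
      ∀ x y, χ (X.red₂ x) = Y.red₂ y → v (X.red x) = Y.red y := by
    intro X Y χ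
    let π : Trunc k Y 2 →+* Fibre k Y := Ideal.Quotient.lift _ Y.red fun a ha => by
      rw [red_eq_zero_iff]
      exact (dvd_pow_self _ two_ne_zero).trans (Ideal.mem_span_singleton.1 ha)
    have hπ : ∀ y, π (Y.red₂ y) = Y.red y := fun y => rfl
    let w : X →+* Fibre k Y := π.comp (χ.toAlgEquiv.toRingEquiv.toRingHom.comp X.red₂)
    have hw : ∀ x y, χ (X.red₂ x) = Y.red₂ y → w x = Y.red y := fun x y h => by
      rw [← hπ, ← h]; rfl
    have hwc : Continuous w := by
      have h1 : Continuous π := (isQuotientMap_quot_mk (X := Y)).continuous_iff.2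
        (continuous_quot_mk (X := Y))
      exact h1.comp (χ.continuous.comp continuous_quot_mk)
    refine ⟨Ideal.Quotient.lift _ w fun a ha => ?_, (isQuotientMap_red X).continuous_iff.2 hwc, hw⟩
    obtain ⟨y, hy⟩ := exists_iso₂_lift χ a
    rw [hw a y hy, red_eq_zero_iff]
    exact par_dvd_of_iso₂' χ hy (Ideal.mem_span_singleton.1 ha)
  obtain ⟨v, hvc, hv⟩ := aux χ
  obtain ⟨v', hvc', hv'⟩ := aux χ.symm
  have h1 : ∀ a, v' (v a) = a := fun a => by
    obtain ⟨x, rfl⟩ := Ideal.Quotient.mk_surjective a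
    obtain ⟨y, hy⟩ := exists_iso₂_lift χ x
    rw [hv x y hy, hv' y x (by rw [← hy]; exact χ.symm_apply_apply _)]
  have h2 : ∀ b, v (v' b) = b := fun b => by
    obtain ⟨y, rfl⟩ := Ideal.Quotient.mk_surjective b
    obtain ⟨x, hx⟩ := exists_iso₂_lift' χ y
    rw [hv' y x (by rw [← hx]; exact χ.symm_apply_apply _), hv x y hx]
  exact ⟨{ toFun := v
           invFun := v'
           left_inv := h1
           right_inv := h2
           map_mul' := map_mul v
           map_add' := map_add v
           commutes' := fun c => by
            refine hv (algebraMap k X c) (algebraMap k Y c) ?_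
            rw [algebraMap_eq_algebraMap_C, algebraMap_eq_algebraMap_C]
            exact χ.toAlgEquiv.commutes (C c : PowerSeries k)
           continuous_toFun := hvc
           continuous_invFun := hvc' }, hv⟩

/-- The isomorphism `χ` lifts to an isomorphism of power series rings: in charts, `χ` is given in
degree one by a continuous derivation `δ`, and `exp(t δ)` provides a lift. -/
theorem exists_powerSeries_lift [CharZero k] {X Y : Obj k} (χ : X.Iso₂ Y)
    {κ : X →+* PowerSeries (Fibre k X)} {κ' : Y →+* PowerSeries (Fibre k Y)}
    (hκ : IsChart X κ) (hκ' : IsChart Y κ') :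
    ∃ F : PowerSeries (Fibre k X) ≃+* PowerSeries (Fibre k Y), Continuous F ∧ Continuous F.symm ∧
      (∀ a, F (PowerSeries.map (algebraMap k (Fibre k X)) a) =
        PowerSeries.map (algebraMap k (Fibre k Y)) a) ∧
      ∀ x y, χ (X.red₂ x) = Y.red₂ y → PowerSeries.X ^ 2 ∣ F (κ x) - κ' y := by
  obtain ⟨v, hv⟩ := exists_fibre_iso χ
  -- The coefficient in degree one as a function on the truncation.
  obtain ⟨c, hc⟩ : ∃ c : Trunc k Y 2 → Fibre k Y, ∀ y, c (Y.red₂ y) = coeff 1 (κ' y) := by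
    refine ⟨fun z => coeff 1 (κ' (Function.surjInv Ideal.Quotient.mk_surjective z)), fun y => ?_⟩
    have h1 := red₂_eq_iff.1 (Function.surjInv_eq Ideal.Quotient.mk_surjective (Y.red₂ y))
    rw [← hκ'.pow_dvd_iff, map_sub, X_pow_dvd_iff] at h1
    have := h1 1 (by norm_num)
    rwa [map_sub, sub_eq_zero] at this
  have hcc : Continuous c := by
    refine (isQuotientMap_quot_mk (X := Y)).continuous_iff.2 ?_
    refine Continuous.congr (f := fun y => coeff 1 (κ' y)) ?_ fun y => (hc y).symm
    exact (PowerSeries.WithPiTopology.continuous_coeff _ 1).comp hκ'.inducing.continuous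
  let E : X → Fibre k Y := fun x => c (χ (X.red₂ x)) - v (coeff 1 (κ x))
  have hE : ∀ x y, χ (X.red₂ x) = Y.red₂ y → E x = coeff 1 (κ' y) - v (coeff 1 (κ x)) :=
    fun x y h => by simp only [E]; rw [h, hc]
  have hEc : Continuous E := by
    refine (hcc.comp (χ.continuous.comp continuous_quot_mk)).sub ?_
    exact v.continuous.comp ((PowerSeries.WithPiTopology.continuous_coeff _ 1).comp
      hκ.inducing.continuous)
  have hEadd : ∀ x x', E (x + x') = E x + E x' := fun x x' => by
    obtain ⟨y, hy⟩ := exists_iso₂_lift χ x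
    obtain ⟨y', hy'⟩ := exists_iso₂_lift χ x'
    rw [hE _ _ hy, hE _ _ hy', hE (x + x') (y + y') (by rw [map_add, map_add, hy, hy', map_add])]
    simp only [map_add]; ring
  have hEmul : ∀ x x', E (x * x') = v (X.red x) * E x' + v (X.red x') * E x := fun x x' => by
    obtain ⟨y, hy⟩ := exists_iso₂_lift χ x
    obtain ⟨y', hy'⟩ := exists_iso₂_lift χ x'
    rw [hE _ _ hy, hE _ _ hy', hE (x * x') (y * y') (by rw [map_mul, map_mul, hy, hy', map_mul]),
      map_mul κ', map_mul κ, coeff_one_mul_eq, coeff_one_mul_eq, hκ'.coeff_zero, hκ'.coeff_zero,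
      hκ.coeff_zero, hκ.coeff_zero, hv _ _ hy, hv _ _ hy', map_add, map_mul, map_mul, hv _ _ hy,
      hv _ _ hy']
    ring
  have hEpar : ∀ x, E (par k X * x) = 0 := fun x => by
    obtain ⟨y, hy⟩ := exists_iso₂_lift χ x
    rw [hE _ (par k Y * y) (by rw [map_mul, map_mul, hy, iso₂_par, map_mul]), map_mul κ',
      map_mul κ, hκ.map_par, hκ'.map_par, ← zero_add 1, coeff_succ_X_mul, coeff_succ_X_mul, hκ.coeff_zero,
      hκ'.coeff_zero, hv _ _ hy, sub_self]
  have hEred : ∀ x x', X.red x = X.red x' → E x = E x' := fun x x' h => by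
    rw [← sub_eq_zero, ← map_sub, red_eq_zero_iff] at h
    obtain ⟨z, hz⟩ := h
    rw [sub_eq_iff_eq_add.1 hz, hEadd, hEpar, zero_add]
  obtain ⟨e, he⟩ : ∃ e : Fibre k X → Fibre k Y, ∀ x, e (X.red x) = E x :=
    ⟨fun a => E (Function.surjInv Ideal.Quotient.mk_surjective a), fun x =>
      hEred _ _ (Function.surjInv_eq Ideal.Quotient.mk_surjective _)⟩
  have hec : Continuous e := (isQuotientMap_red X).continuous_iff.2
    (hEc.congr fun x => (he x).symm)
  have headd : ∀ a b, e (a + b) = e a + e b := fun a b => by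
    obtain ⟨x, rfl⟩ := Ideal.Quotient.mk_surjective a
    obtain ⟨x', rfl⟩ := Ideal.Quotient.mk_surjective b
    rw [← map_add, he, he, he, hEadd]
  have hemul : ∀ a b, e (a * b) = v a * e b + v b * e a := fun a b => by
    obtain ⟨x, rfl⟩ := Ideal.Quotient.mk_surjective a
    obtain ⟨x', rfl⟩ := Ideal.Quotient.mk_surjective b
    rw [← map_mul, he, he, he, hEmul]
  have hek : ∀ r : k, e (algebraMap k _ r) = 0 := fun r => by
    have h1 : E (algebraMap k X r) = 0 := by
      rw [hE _ (algebraMap k Y r), algebraMap_eq_algebraMap_C, algebraMap_eq_algebraMap_C,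
        hκ.algebraMap, hκ'.algebraMap, map_C, map_C, coeff_C, coeff_C, if_neg one_ne_zero,
        if_neg one_ne_zero, map_zero, sub_zero]
      rw [algebraMap_eq_algebraMap_C, algebraMap_eq_algebraMap_C]
      exact χ.toAlgEquiv.commutes (C r : PowerSeries k)
    rw [← h1, ← he]; rfl
  let δ : Derivation k (Fibre k Y) (Fibre k Y) :=
    { toFun := fun b => e (v.symm b)
      map_add' := fun a b => by rw [map_add, headd]
      map_smul' := fun r b => by
        rw [map_smul, Algebra.smul_def, hemul, hek, mul_zero, add_zero, RingHom.id_apply,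
          Algebra.smul_def]
        congr 1
        exact v.toAlgEquiv.commutes r
      map_one_eq_zero' := by
        change e (v.symm 1) = 0
        rw [map_one, ← map_one (algebraMap k (Fibre k X)), hek]
      leibniz' := fun a b => by
        change e (v.symm (a * b)) = a * e (v.symm b) + b * e (v.symm a)
        rw [map_mul, hemul, v.apply_symm_apply, v.apply_symm_apply] }
  have hδ : ∀ a, δ (v a) = e a := fun a => congrArg e (v.symm_apply_apply a)
  obtain ⟨φ, hφc, hφ0, hφ1, hφk⟩ := exists_exp_derivation k δ (hec.comp v.symm.continuous)
  let v' : Fibre k X →+* Fibre k Y := v.toAlgEquiv.toRingEquiv.toRingHom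
  have hv' : ∀ a, v' a = v a := fun a => rfl
  obtain ⟨F, hFC, hFX, hFc, hFc'⟩ := exists_powerSeries_homeomorph (φ.comp v')
    (hφc.comp v.continuous) v.toEquiv v.symm.continuous (fun a => hφ0 _)
  refine ⟨F, hFc, hFc', fun a => ?_, fun x y hxy => ?_⟩
  · refine DFunLike.congr_fun (f := (F : PowerSeries (Fibre k X) →+* PowerSeries (Fibre k Y)).comp
      (PowerSeries.map (algebraMap k (Fibre k X))))
      (?_ : _ = PowerSeries.map (algebraMap k (Fibre k Y))) a
    have hX : ((F : PowerSeries (Fibre k X) →+* PowerSeries (Fibre k Y)).comp (PowerSeries.map (algebraMap k (Fibre k X))))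
        PowerSeries.X = PowerSeries.X := by
      rw [RingHom.comp_apply, map_X]; exact hFX
    have hh : IsHausdorff (Ideal.span {((F : PowerSeries (Fibre k X) →+* PowerSeries (Fibre k Y)).comp
        (PowerSeries.map (algebraMap k (Fibre k X)))) PowerSeries.X})
        (PowerSeries (Fibre k Y)) := by
      rw [hX]; infer_instance
    refine powerSeries_hom_ext (fun r => ?_) ?_
    · rw [RingHom.comp_apply, map_C, map_C]
      refine (hFC _).trans ?_
      rw [RingHom.comp_apply, hv', ← hφk]
      congr 1
      exact v.toAlgEquiv.commutes r
    · rw [hX, map_X]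
  · have hFX' : (F : PowerSeries (Fibre k X) →+* PowerSeries (Fibre k Y)) PowerSeries.X =
        PowerSeries.X := hFX
    have h0 := coeff_eval_eq_sum (E := (F : PowerSeries (Fibre k X) →+* PowerSeries (Fibre k Y))) hFX' (κ x) 0
    have h1 := coeff_eval_eq_sum (E := (F : PowerSeries (Fibre k X) →+* PowerSeries (Fibre k Y))) hFX' (κ x) 1
    rw [Finset.sum_range_one] at h0
    rw [Finset.sum_range_succ, Finset.sum_range_one] at h1
    simp only [RingHom.coe_coe, hFC, Nat.sub_zero, Nat.sub_self, RingHom.comp_apply, hφ0, hφ1,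
      hv', hδ, hκ.coeff_zero, he, hE x y hxy] at h0 h1
    rw [X_pow_dvd_iff]
    intro m hm
    rw [map_sub, sub_eq_zero]
    interval_cases m
    · rw [h0, hv x y hxy, hκ'.coeff_zero]
    · rw [h1]; ring

/-- An isomorphism induces an isomorphism of truncations. -/
lemma exists_lifts {X Y : Obj k} (f : X.Iso Y) : ∃ ψ : X.Iso₂ Y, Lifts f ψ := by
  have aux : ∀ {X Y : Obj k} (f : X.Iso Y), ∃ ψ : Trunc k X 2 →ₐ[PowerSeries k] Trunc k Y 2,
      Continuous ψ ∧ ∀ x, ψ (X.red₂ x) = Y.red₂ (f x) := by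
    intro X Y f
    refine ⟨Ideal.quotientMapₐ _ f.toAlgEquiv.toAlgHom ?_, ?_, fun x => rfl⟩
    · rw [Ideal.span_le, Set.singleton_subset_iff]
      change f (par k X ^ 2) ∈ Ideal.span {par k Y ^ 2}
      rw [map_pow, show f (par k X) = par k Y from f.toAlgEquiv.commutes _]
      exact Ideal.mem_span_singleton_self _
    · refine (isQuotientMap_quot_mk (X := X)).continuous_iff.2 ?_
      exact (continuous_quot_mk (X := Y)).comp f.continuous
  obtain ⟨ψ, hψc, hψ⟩ := aux f
  obtain ⟨ψ', hψc', hψ'⟩ := aux f.symm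
  exact ⟨{ toFun := ψ
           invFun := ψ'
           left_inv := fun a => by
             obtain ⟨x, rfl⟩ := Ideal.Quotient.mk_surjective a
             rw [hψ, hψ']
             exact congrArg _ (f.symm_apply_apply x)
           right_inv := fun a => by
             obtain ⟨x, rfl⟩ := Ideal.Quotient.mk_surjective a
             rw [hψ', hψ]
             exact congrArg _ (f.apply_symm_apply x)
           map_mul' := map_mul ψ
           map_add' := map_add ψ
           commutes' := ψ.commutes
           continuous_toFun := hψc
           continuous_invFun := hψc' }, hψ⟩

end Lifting

/-! ### The field of Laurent series -/

section LaurentField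

variable {K : Type u} [Field K]

open scoped Topology

open WithZero in
lemma laurent_mem_nhds_zero {U : Set (LaurentSeries K)} :
    U ∈ 𝓝 (0 : LaurentSeries K) ↔
      ∃ n : ℤ, ∀ f : LaurentSeries K, (∀ i < n, f.coeff i = 0) → f ∈ U := by
  constructor
  · intro hU
    obtain ⟨γ, hγ⟩ := Valued.mem_nhds_zero.1 hU
    have hne : MonoidWithZeroHom.ValueGroup₀.embedding γ.1 ≠ 0 := by
      rw [Ne, map_eq_zero]
      exact γ.ne_zero
    obtain ⟨m, hm⟩ : ∃ m : ℤ, MonoidWithZeroHom.ValueGroup₀.embedding γ.1 = exp m :=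
      ⟨log _, (exp_log hne).symm⟩
    refine ⟨1 - m, fun f hf => hγ ?_⟩
    have h1 := (LaurentSeries.valuation_le_iff_coeff_lt_eq_zero K).2 hf
    rw [Set.mem_ofPred_eq, Valuation.restrict_lt_iff_lt_embedding, hm]
    refine lt_of_le_of_lt h1 ?_
    rw [exp_lt_exp]
    omega
  · rintro ⟨n, hn⟩
    have hX : Valued.v (HahnSeries.single (n - 1) 1 : LaurentSeries K) = exp (-(n - 1)) :=
      LaurentSeries.valuation_single_zpow K (n - 1)
    have hne : Valued.v.restrict (HahnSeries.single (n - 1) 1 : LaurentSeries K) ≠ 0 := by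
      rw [Ne, map_eq_zero]
      exact HahnSeries.single_ne_zero one_ne_zero
    refine Valued.mem_nhds_zero.2 ⟨Units.mk0 _ hne, fun f hf => hn f ?_⟩
    rw [Set.mem_ofPred_eq, Units.val_mk0, Valuation.restrict_lt_iff, hX] at hf
    refine (LaurentSeries.valuation_le_iff_coeff_lt_eq_zero K).1 ?_
    refine le_of_not_gt fun hlt => ?_
    have h0 : Valued.v f ≠ 0 := (lt_of_le_of_lt zero_le hlt).ne'
    rw [← exp_log h0, exp_lt_exp] at hf hlt
    omega

lemma laurent_algebraMap {k : Type u} [Field k] [Algebra k K] (c : k) :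
    algebraMap k (LaurentSeries K) c = HahnSeries.C (algebraMap k K c) := by
  rw [HahnSeries.algebraMap_apply', PowerSeries.algebraMap_apply, HahnSeries.ofPowerSeries_C]

instance {k : Type u} [Field k] [Algebra k K] :
    @IsScalarTower k K (LaurentSeries K) _ Algebra.toSMul Algebra.toSMul :=
  IsScalarTower.of_algebraMap_eq (R := k) (S := K) (A := LaurentSeries K) fun c => by
    rw [laurent_algebraMap, laurent_algebraMap]
    rfl

/-- The Euler operator `s d/ds` on Laurent series. -/
def laurentEuler (f : LaurentSeries K) : LaurentSeries K :=
  ⟨fun n => n * f.coeff n, f.isPWO_support.mono fun _ hn => right_ne_zero_of_mul hn⟩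

lemma laurentEuler_coeff (f : LaurentSeries K) (n : ℤ) :
    (laurentEuler f).coeff n = n * f.coeff n := rfl

lemma laurentEuler_add (f g : LaurentSeries K) :
    laurentEuler (f + g) = laurentEuler f + laurentEuler g := by
  ext n
  rw [laurentEuler_coeff, HahnSeries.coeff_add, HahnSeries.coeff_add, laurentEuler_coeff,
    laurentEuler_coeff, mul_add]

lemma laurentEuler_C (c : K) : laurentEuler (HahnSeries.C c : LaurentSeries K) = 0 := by
  ext n
  rw [laurentEuler_coeff, HahnSeries.C_apply, HahnSeries.coeff_single, HahnSeries.coeff_zero]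
  split_ifs with h
  · rw [h, Int.cast_zero, zero_mul]
  · rw [mul_zero]

lemma laurentEuler_mul (f g : LaurentSeries K) :
    laurentEuler (f * g) = f * laurentEuler g + g * laurentEuler f := by
  have hsupp : ∀ h : LaurentSeries K, (laurentEuler h).support ⊆ h.support :=
    fun h n hn => right_ne_zero_of_mul (a := (n : K)) hn
  ext n
  rw [HahnSeries.coeff_add, mul_comm g,
    HahnSeries.coeff_mul_right' g.isPWO_support (hsupp g),
    HahnSeries.coeff_mul_left' f.isPWO_support (hsupp f), laurentEuler_coeff,
    HahnSeries.coeff_mul, Finset.mul_sum, ← Finset.sum_add_distrib]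
  refine Finset.sum_congr rfl fun p hp => ?_
  have hn : p.1 + p.2 = n := (Finset.mem_antidiagonal.1 hp).2.2
  rw [laurentEuler_coeff, laurentEuler_coeff, ← hn]
  push_cast
  ring

lemma continuous_laurentEuler : Continuous (laurentEuler (K := K)) := by
  refine continuous_of_continuousAt_zero (AddMonoidHom.mk' laurentEuler laurentEuler_add) ?_
  rw [ContinuousAt, map_zero]
  intro U hU
  obtain ⟨n, hn⟩ := laurent_mem_nhds_zero.1 hU
  refine laurent_mem_nhds_zero.2 ⟨n, fun f hf => hn _ fun i hi => ?_⟩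
  change (laurentEuler f).coeff i = 0
  rw [laurentEuler_coeff, hf i hi, mul_zero]

/-- The parameter `s` of `K((s))`. -/
abbrev laurentX (K : Type u) [Field K] : LaurentSeries K := HahnSeries.single 1 1

lemma laurentX_ne_zero : laurentX K ≠ 0 := HahnSeries.single_ne_zero one_ne_zero

/-- A derivation of a `k`-algebra from its Leibniz rule and its values on constants. -/
def derivationMk {k F : Type u} [Field k] [CommRing F] [Algebra k F] (f : F → F)
    (hadd : ∀ a b, f (a + b) = f a + f b) (hmul : ∀ a b, f (a * b) = a * f b + b * f a)
    (hk : ∀ c : k, f (algebraMap k F c) = 0) : Derivation k F F where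
  toFun := f
  map_add' := hadd
  map_smul' c a := by
    rw [RingHom.id_apply, Algebra.smul_def, Algebra.smul_def, hmul, hk, mul_zero, add_zero]
  map_one_eq_zero' := by
    change f 1 = 0
    rw [← map_one (algebraMap k F), hk]
  leibniz' := hmul

/-- The derivation `d/ds` on Laurent series. -/
abbrev laurentDeriv (k : Type u) [Field k] (K : Type u) [Field K] [Algebra k K] :=
  derivationMk (k := k) (fun f : LaurentSeries K => (laurentX K)⁻¹ * laurentEuler f)
    (fun f g => by rw [laurentEuler_add, mul_add])
    (fun f g => by rw [laurentEuler_mul]; ring)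
    (fun c => by rw [laurent_algebraMap, laurentEuler_C, mul_zero])

lemma laurentDeriv_apply {k : Type u} [Field k] [Algebra k K] (f : LaurentSeries K) :
    laurentDeriv k K f = (laurentX K)⁻¹ * laurentEuler f := rfl

lemma laurentDeriv_X {k : Type u} [Field k] [Algebra k K] : laurentDeriv k K (laurentX K) = 1 := by
  have : laurentEuler (laurentX K) = laurentX K := by
    ext n
    rw [laurentEuler_coeff, HahnSeries.coeff_single]
    split_ifs with h
    · rw [h, Int.cast_one, one_mul]
    · rw [mul_zero]
  rw [laurentDeriv_apply, this, inv_mul_cancel₀ laurentX_ne_zero]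

lemma continuous_laurentDeriv {k : Type u} [Field k] [Algebra k K] :
    Continuous (laurentDeriv k K) :=
  (continuous_laurentEuler.const_mul (laurentX K)⁻¹)

end LaurentField

/-! ### Differentials of the closed fibres -/

section RankOne

variable {k : Type u} [Field k]

/-- A derivation over `k` vanishes on a finite extension of `k`. -/
lemma derivation_algebraMap_eq_zero [CharZero k] {k' F M : Type u} [Field k'] [Algebra k k']
    [FiniteDimensional k k'] [CommRing F] [Algebra k F] [Algebra k' F] [IsScalarTower k k' F]
    [AddCommGroup M] [Module F M] [Module k M] [IsScalarTower k F M] (D : Derivation k F M)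
    (c : k') : D (algebraMap k' F c) = 0 := by
  have hp : Polynomial.aeval (algebraMap k' F c) (minpoly k c) = 0 := by
    rw [Polynomial.aeval_algebraMap_apply, minpoly.aeval, map_zero]
  have hsep : (minpoly k c).Separable :=
    (minpoly.irreducible (Algebra.IsIntegral.isIntegral c)).separable
  have hu : IsUnit (Polynomial.aeval (algebraMap k' F c) (minpoly k c).derivative) := by
    rw [Polynomial.aeval_algebraMap_apply]
    refine IsUnit.map (algebraMap k' F) (IsUnit.mk0 _ ?_)
    exact hsep.aeval_derivative_ne_zero (minpoly.aeval k c)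
  have h1 : D (Polynomial.aeval (algebraMap k' F c) (minpoly k c)) =
      Polynomial.aeval (algebraMap k' F c) (minpoly k c).derivative • D (algebraMap k' F c) := by
    generalize minpoly k c = p
    generalize algebraMap k' F c = x
    induction p using Polynomial.induction_on' with
    | add p q hp hq => rw [map_add, map_add, hp, hq, Polynomial.derivative_add, map_add, add_smul]
    | monomial n a =>
      rw [Polynomial.aeval_monomial, D.leibniz, D.map_algebraMap, smul_zero, add_zero,
        D.leibniz_pow, Polynomial.derivative_monomial, Polynomial.aeval_monomial, mul_smul,
        ← Nat.cast_smul_eq_nsmul F, map_mul, map_natCast, mul_smul, smul_smul (n : F)]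
  rw [hp, map_zero] at h1
  exact (hu.smul_eq_zero.1 h1.symm)

variable {F : Type u} [CommRing F] [Algebra k F]

/-- A continuous derivation `∂` with `∂ x = 1`, such that `D a = ∂ a • D x` for all continuous
derivations `D` and all `a` in a dense set, makes `dx` a basis of the continuous differentials. -/
lemma hasRankOneForms_of_derivation [TopologicalSpace F] [IsDomain F] [T2Space F] [IsTopologicalRing F]
    (del : Derivation k F F) (hdel : Continuous del) {x : F} {S : Set F}
    (hS : Dense S)
    (h : ∀ (M : Type u) [AddCommGroup M] [Module F M] [Module k M] [IsScalarTower k F M]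
      (D : Derivation k F M), ∀ a ∈ S, D a = del a • D x) : HasRankOneForms k F := by
  have hd : ∀ a, Form.d k a = del a • Form.d k x := by
    intro a
    rw [← sub_eq_zero, Form.d, Form.d, ← map_smul, ← map_sub, Submodule.mkQ_apply,
      Submodule.Quotient.mk_eq_zero]
    intro M _ _ _ _ _ _ _ _ D hD
    rw [map_sub, map_smul, D.liftKaehlerDifferential_comp_D, D.liftKaehlerDifferential_comp_D,
      sub_eq_zero]
    refine congrFun (Continuous.ext_on hS hD (g := fun a => del a • D x) ?_ (h M D)) a
    exact hdel.smul continuous_const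
  obtain ⟨L, hL⟩ := Form.exists_lift k del hdel
  have hw : ∀ w : Form k F, w = L w • Form.d k x := by
    intro w
    induction w using Form.induction with
    | d a => rw [hL]; exact hd a
    | zero => rw [map_zero, zero_smul]
    | add x y hx hy => rw [map_add, add_smul, ← hx, ← hy]
    | smul c x hx => rw [map_smul, smul_assoc, ← hx]
  refine ⟨inferInstance, ⟨x, fun w => ⟨1, one_ne_zero, L w, by rw [one_smul]; exact hw w⟩⟩,
    fun c w hcw => ?_⟩
  have h1 : c * L w = 0 := by rw [← smul_eq_mul, ← map_smul, hcw, map_zero]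
  rcases mul_eq_zero.1 h1 with h2 | h2
  · exact Or.inl h2
  · right; rw [hw w, h2, zero_smul]

lemma HasRankOneForms.of_equiv [TopologicalSpace F] {F' : Type u} [CommRing F'] [Algebra k F'] [TopologicalSpace F']
    (e : F ≃A[k] F') (h : HasRankOneForms k F') : HasRankOneForms k F := by
  have h1 : ∀ w, Form.map k (e.symm : F' →A[k] F) (Form.map k (e : F →A[k] F') w) = w := by
    intro w
    rw [Form.map_comp]
    induction w using Form.induction with
    | d a => rw [Form.map_d]; exact congrArg _ (e.symm_apply_apply a)
    | zero => rw [map_zero]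
    | add x y hx hy => rw [map_add, hx, hy]
    | smul c x hx => rw [Form.map_smul, hx]; exact congrArg (· • x) (e.symm_apply_apply c)
  have h2 : ∀ v w, Form.map k (e : F →A[k] F') v = Form.map k (e : F →A[k] F') w → v = w :=
    fun v w hvw => by rw [← h1 v, hvw, h1]
  have he : ∀ a, (e : F →A[k] F') a = e a := fun a => rfl
  have := h.t2
  obtain ⟨x, hx⟩ := h.exists_generator
  refine ⟨e.toHomeomorph.symm.t2Space, ⟨e.symm x, fun w => ?_⟩, fun c w hcw => ?_⟩
  · obtain ⟨c, hc, c', hcc⟩ := hx (Form.map k (e : F →A[k] F') w)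
    refine ⟨e.symm c, ?_, e.symm c', h2 _ _ ?_⟩
    · rwa [Ne, map_eq_zero_iff e.symm e.symm.injective]
    · rw [Form.map_smul, Form.map_smul, Form.map_d, he, he, he, e.apply_symm_apply,
        e.apply_symm_apply, e.apply_symm_apply, hcc]
  · have h3 := congrArg (Form.map k (e : F →A[k] F')) hcw
    rw [Form.map_smul, map_zero] at h3
    rcases h.torsionFree _ _ h3 with h4 | h4
    · left
      exact (map_eq_zero_iff e e.injective).1 h4
    · right
      refine h2 _ _ ?_
      rw [h4, map_zero]

/-- For a derivation `del` with `del x = 1`, the elements on which a derivation `D` agrees with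
`D x • del` form a subalgebra that contains `x` and a finite extension of `k`. -/
lemma derivation_eq_smul_of_polynomial [CharZero k] {k' : Type u} [Field k'] [Algebra k k']
    [FiniteDimensional k k'] [Algebra k' F] [IsScalarTower k k' F] (del : Derivation k F F) {x : F}
    (hx : del x = 1) {M : Type u} [AddCommGroup M] [Module F M] [Module k M] [IsScalarTower k F M]
    (D : Derivation k F M) (p : Polynomial k') :
    D (Polynomial.aeval x p) = del (Polynomial.aeval x p) • D x := by
  induction p using Polynomial.induction_on' with
  | add p q hp hq => rw [map_add, map_add, map_add, add_smul, hp, hq]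
  | monomial n a =>
    rw [Polynomial.aeval_monomial, D.leibniz, del.leibniz, derivation_algebraMap_eq_zero,
      derivation_algebraMap_eq_zero, D.leibniz_pow, del.leibniz_pow, hx, smul_zero, smul_zero,
      add_zero, add_zero]
    simp only [smul_eq_mul, mul_one, mul_smul, smul_assoc]

end RankOne

section RankOneFibres

variable {k : Type u} [Field k]

/-- For a discrete ring the continuous differentials are the Kähler differentials. -/
lemma nullForms_eq_bot {F : Type u} [CommRing F] [Algebra k F] [TopologicalSpace F]
    [DiscreteTopology F] : nullForms k F = ⊥ := by
  rw [eq_bot_iff]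
  intro w hw
  let : TopologicalSpace (KaehlerDifferential k F) := ⊥
  have : DiscreteTopology (KaehlerDifferential k F) := ⟨rfl⟩
  have : ContinuousSMul F (KaehlerDifferential k F) := ⟨continuous_of_discreteTopology⟩
  have h := hw (KaehlerDifferential k F) (KaehlerDifferential.D k F) continuous_of_discreteTopology
  rwa [Derivation.liftKaehlerDifferential_D] at h

/-- For a discrete ring the rank of the continuous differentials is that of the Kähler
differentials. -/
lemma hasRankOneForms_of_discrete {F : Type u} [CommRing F] [IsDomain F] [Algebra k F]
    [TopologicalSpace F] [DiscreteTopology F]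
    (htf : ∀ (c : F) (w : KaehlerDifferential k F), c • w = 0 → c = 0 ∨ w = 0)
    (hgen : ∃ x : F, ∀ w : KaehlerDifferential k F, ∃ c : F, c ≠ 0 ∧ ∃ c' : F,
      c • w = c' • KaehlerDifferential.D k F x) : HasRankOneForms k F := by
  obtain ⟨x, hx⟩ := hgen
  have hker : ∀ w, (nullForms k F).mkQ w = 0 → w = 0 := fun w hw => by
    rw [Submodule.mkQ_apply, Submodule.Quotient.mk_eq_zero, nullForms_eq_bot] at hw
    exact hw
  refine ⟨inferInstance, ⟨x, fun w => ?_⟩, fun c w hcw => ?_⟩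
  · obtain ⟨w, rfl⟩ := (nullForms k F).mkQ_surjective w
    obtain ⟨c, hc, c', h⟩ := hx w
    exact ⟨c, hc, c', by rw [← map_smul, h, map_smul]; rfl⟩
  · obtain ⟨w, rfl⟩ := (nullForms k F).mkQ_surjective w
    rw [← map_smul] at hcw
    rcases htf c w (hker _ hcw) with h | h
    · exact Or.inl h
    · right; rw [h, map_zero]

/-- The differentials of a smooth curve are projective of rank one, hence torsion-free; some `dx` is
nonzero and generates up to torsion. -/
lemma hasRankOneForms_of_formallySmooth {F : Type u} [CommRing F] [IsDomain F] [Algebra k F]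
    [TopologicalSpace F] [DiscreteTopology F] [Algebra.FormallySmooth k F]
    [Module.Finite F (KaehlerDifferential k F)]
    (h1 : Module.finrank F (KaehlerDifferential k F) = 1) : HasRankOneForms k F := by
  have htf : ∀ (c : F) (w : KaehlerDifferential k F), c • w = 0 → c = 0 ∨ w = 0 :=
    fun c w h => smul_eq_zero.1 h
  refine hasRankOneForms_of_discrete htf ?_
  obtain ⟨x, hx⟩ : ∃ x : F, KaehlerDifferential.D k F x ≠ 0 := by
    by_contra! hx
    have htop : (⊤ : Submodule F (KaehlerDifferential k F)) = ⊥ := by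
      rw [← KaehlerDifferential.span_range_derivation, Submodule.span_eq_bot]
      rintro _ ⟨x, rfl⟩
      exact hx x
    have : Subsingleton (KaehlerDifferential k F) :=
      (Submodule.subsingleton_iff F).1 (subsingleton_of_bot_eq_top htop.symm)
    rw [Module.finrank_zero_of_subsingleton] at h1
    exact zero_ne_one h1
  refine ⟨x, fun w => ?_⟩
  have hdep : ¬ LinearIndependent F ![w, KaehlerDifferential.D k F x] := fun hli => by
    have := hli.fintype_card_le_finrank
    rw [h1, Fintype.card_fin] at this
    omega
  rw [LinearIndependent.pair_iff] at hdep
  push Not at hdep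
  obtain ⟨c, c', h, hne⟩ := hdep
  refine ⟨c, fun hc => ?_, -c', by rw [neg_smul]; exact eq_neg_of_add_eq_zero_left h⟩
  rw [hc, zero_smul, zero_add] at h
  exact hne hc ((htf _ _ h).resolve_right hx)

/-- A finitely generated field of transcendence degree one has a separating element `x`: the field
is finite over `k(x)`. -/
lemma exists_separating [CharZero k] {F : Type u} [Field F] [Algebra k F]
    [Algebra.EssFiniteType k F] (h : Algebra.trdeg k F = 1) :
    ∃ x : F, Transcendental k x ∧
      Algebra.IsSeparable (IntermediateField.adjoin k ({x} : Set F)) F := by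
  obtain ⟨s, hs, hsep⟩ :=
    exists_isTranscendenceBasis_and_isSeparable_of_perfectField (k := k) (K := F)
  have hcard := hs.cardinalMk_eq_trdeg
  rw [h, Cardinal.mk_coe_finset, Nat.cast_eq_one, Finset.card_eq_one] at hcard
  obtain ⟨x, rfl⟩ := hcard
  rw [Finset.coe_singleton] at hsep
  exact ⟨x, hs.1.transcendental ⟨x, Finset.mem_singleton_self x⟩, hsep⟩

/-- The differentials of a function field of one variable are spanned by `dx` for a separating
element `x`, since the field is unramified over `k(x)`. -/
lemma hasRankOneForms_of_field [CharZero k] {F : Type u} [Field F] [Algebra k F]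
    [TopologicalSpace F] [DiscreteTopology F] [Algebra.EssFiniteType k F]
    (h : Algebra.trdeg k F = 1) : HasRankOneForms k F := by
  refine hasRankOneForms_of_discrete (fun c w hcw => smul_eq_zero.1 hcw) ?_
  obtain ⟨x, -, hsep⟩ := exists_separating h
  refine ⟨x, fun w => ⟨1, one_ne_zero, ?_⟩⟩
  set K := IntermediateField.adjoin k ({x} : Set F) with hK
  set D := KaehlerDifferential.D k F with hD
  -- On `K = k(x)` every differential is a multiple of `dx`.
  have hK' : ∀ y ∈ K, ∃ c : F, D y = c • D x := by
    intro y hy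
    induction hy using IntermediateField.adjoin_induction with
    | mem y hy => exact ⟨1, by rw [Set.mem_singleton_iff.1 hy, one_smul]⟩
    | algebraMap c => exact ⟨0, by rw [D.map_algebraMap, zero_smul]⟩
    | add y z _ _ hy hz =>
      obtain ⟨a, ha⟩ := hy
      obtain ⟨b, hb⟩ := hz
      exact ⟨a + b, by rw [map_add, ha, hb, add_smul]⟩
    | inv y _ hy =>
      obtain ⟨a, ha⟩ := hy
      exact ⟨-y⁻¹ ^ 2 * a, by rw [D.leibniz_inv, ha, mul_smul]⟩
    | mul y z _ _ hy hz =>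
      obtain ⟨a, ha⟩ := hy
      obtain ⟨b, hb⟩ := hz
      exact ⟨y * b + z * a, by rw [D.leibniz, ha, hb, add_smul, mul_smul, mul_smul]⟩
  -- As `F` is unramified over `K`, the differentials of `F` come from those of `K`.
  have hunr : Algebra.FormallyUnramified K F := Algebra.FormallyUnramified.of_isSeparable K F
  have hw := KaehlerDifferential.range_mapBaseChange k K F
  have hw' : w ∈ LinearMap.range (KaehlerDifferential.mapBaseChange k K F) := by
    rw [hw, LinearMap.mem_ker]
    exact Subsingleton.elim _ _
  obtain ⟨v, rfl⟩ := hw'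
  obtain ⟨c, hc⟩ : ∃ c : F, KaehlerDifferential.mapBaseChange k K F v = c • D x := by
    induction v using TensorProduct.induction_on with
    | zero => exact ⟨0, by rw [map_zero, zero_smul]⟩
    | add v w hv hw =>
      obtain ⟨a, ha⟩ := hv
      obtain ⟨b, hb⟩ := hw
      exact ⟨a + b, by rw [map_add, ha, hb, add_smul]⟩
    | tmul a v =>
      rw [KaehlerDifferential.mapBaseChange_tmul]
      suffices h : ∃ c : F, KaehlerDifferential.map k k K F v = c • D x by
        obtain ⟨c, hc⟩ := h
        exact ⟨a * c, by rw [hc, mul_smul]⟩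
      have hv : v ∈ Submodule.span K (Set.range (KaehlerDifferential.D k K)) := by
        rw [KaehlerDifferential.span_range_derivation]; trivial
      induction hv using Submodule.span_induction with
      | mem v hv =>
        obtain ⟨b, rfl⟩ := hv
        rw [KaehlerDifferential.map_D]
        exact hK' _ b.2
      | zero => exact ⟨0, by rw [map_zero, zero_smul]⟩
      | add v w _ _ hv hw =>
        obtain ⟨a, ha⟩ := hv
        obtain ⟨b, hb⟩ := hw
        exact ⟨a + b, by rw [map_add, ha, hb, add_smul]⟩
      | smul b v _ hv =>
        obtain ⟨a, ha⟩ := hv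
        exact ⟨algebraMap K F b * a, by rw [map_smul, ha, mul_smul, algebraMap_smul]⟩
  exact ⟨c, by rw [one_smul, hc]⟩

open PowerSeries in
/-- The continuous differentials of a power series ring `k'⟦s⟧` are free on `ds`: the polynomials are
dense, and `d/ds` is a continuous derivation. -/
lemma hasRankOneForms_of_powerSeries [CharZero k] {k' : Type u} [Field k'] [Algebra k k']
    [FiniteDimensional k k'] {F : Type u} [CommRing F] [IsDomain F] [Algebra k F]
    [TopologicalSpace F] [IsTopologicalRing F] (e : F ≃ₐ[k] PowerSeries k')
    (hF : IsAdic (Ideal.span {e.symm X})) : HasRankOneForms k F := by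
  let : Algebra k' F := (e.symm.toRingEquiv.toRingHom.comp (C (R := k'))).toAlgebra
  have halg : ∀ c, algebraMap k' F c = e.symm (C c) := fun c => rfl
  have : IsScalarTower k k' F := IsScalarTower.of_algebraMap_eq fun c => by
    rw [halg, ← e.symm.commutes, IsScalarTower.algebraMap_apply k k' (PowerSeries k'),
      algebraMap_eq]
  have hmem : ∀ n a, a ∈ Ideal.span {e.symm X} ^ n ↔ X ^ n ∣ e a := fun n a => by
    rw [mem_span_pow_iff_dvd, ← map_dvd_iff e, map_pow, e.apply_symm_apply]
  rw [isAdic_iff] at hF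
  let del : Derivation k F F := derivationMk (fun a => e.symm (d⁄dX k' (e a)))
    (fun a b => by rw [map_add, map_add, map_add])
    (fun a b => by
      rw [map_mul, Derivation.leibniz, map_add, smul_eq_mul, smul_eq_mul, map_mul, map_mul,
        e.symm_apply_apply, e.symm_apply_apply])
    (fun c => by
      rw [e.commutes, IsScalarTower.algebraMap_apply k k' (PowerSeries k'), algebraMap_eq,
        derivative_C, map_zero])
  have hdel : ∀ a, del a = e.symm (d⁄dX k' (e a)) := fun a => rfl
  have hdelX : del (e.symm X) = 1 := by
    rw [hdel, e.apply_symm_apply, derivative_X, map_one]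
  have hcont : Continuous del := by
    refine continuous_of_continuousAt_zero del ?_
    rw [ContinuousAt, map_zero]
    intro U hU
    obtain ⟨n, hn⟩ := hF.2 U hU
    refine Filter.mem_map.2 (Filter.mem_of_superset
      ((hF.1 (n + 1)).mem_nhds (Ideal.zero_mem _)) fun a ha => hn ?_)
    rw [SetLike.mem_coe, hmem] at ha ⊢
    rw [hdel, e.apply_symm_apply, X_pow_dvd_iff]
    intro m hm
    rw [coeff_derivative, X_pow_dvd_iff.1 ha (m + 1) (by omega), zero_mul]
  have hdense : Dense (Set.range fun p : Polynomial k' => Polynomial.aeval (e.symm X) p) := by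
    intro a
    rw [mem_closure_iff_nhds]
    intro U hU
    have hU' : (fun z => a + z) ⁻¹' U ∈ nhds (0 : F) :=
      (continuous_const.add continuous_id).continuousAt.preimage_mem_nhds (by simpa using hU)
    obtain ⟨n, hn⟩ := hF.2 _ hU'
    refine ⟨Polynomial.aeval (e.symm X) (trunc n (e a)), ?_, ⟨_, rfl⟩⟩
    have h1 : e (Polynomial.aeval (e.symm X) (trunc n (e a))) = (trunc n (e a) : PowerSeries k') := by
      have h2 : ∀ p : Polynomial k', e (Polynomial.aeval (e.symm X) p) = (p : PowerSeries k') := by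
        intro p
        induction p using Polynomial.induction_on' with
        | add p q hp hq => rw [map_add, map_add, hp, hq, Polynomial.coe_add]
        | monomial m c =>
          rw [Polynomial.aeval_monomial, map_mul, map_pow, e.apply_symm_apply, halg,
            e.apply_symm_apply, Polynomial.coe_monomial, monomial_eq_C_mul_X_pow]
      exact h2 _
    have h3 : Polynomial.aeval (e.symm X) (trunc n (e a)) - a ∈ Ideal.span {e.symm X} ^ n := by
      rw [hmem, map_sub, h1]
      obtain ⟨g, hg⟩ := exists_eq_trunc_add (e a) n
      refine ⟨-g, ?_⟩
      conv_lhs => rw [hg]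
      rw [← hg]
      linear_combination (-1 : PowerSeries k') * hg
    have h4 := hn h3
    rwa [Set.mem_preimage, add_sub_cancel] at h4
  have : T2Space F := by
    refine IsTopologicalAddGroup.t2Space_of_zero_sep fun x hx => ?_
    by_contra! h
    refine hx (e.injective ?_)
    rw [map_zero]
    refine eq_zero_of_forall_pow_dvd (S := (X : PowerSeries k')) fun n => ?_
    rw [← hmem]
    exact h _ ((hF.1 n).mem_nhds (Ideal.zero_mem _))
  refine hasRankOneForms_of_derivation del hcont hdense ?_ (x := e.symm X)
  rintro M _ _ _ _ D _ ⟨p, rfl⟩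
  exact derivation_eq_smul_of_polynomial del hdelX D p

lemma derivation_eq_smul_of_quotient [CharZero k] {k' : Type u} [Field k'] [Algebra k k']
    [FiniteDimensional k k'] {F : Type u} [Field F] [Algebra k F] [Algebra k' F]
    [IsScalarTower k k' F] (del : Derivation k F F) {x : F} (hx : del x = 1) {M : Type u}
    [AddCommGroup M] [Module F M] [Module k M] [IsScalarTower k F M] (D : Derivation k F M)
    (p q : Polynomial k') : D (Polynomial.aeval x p / Polynomial.aeval x q) =
      del (Polynomial.aeval x p / Polynomial.aeval x q) • D x := by
  rw [D.leibniz_div, del.leibniz_div, derivation_eq_smul_of_polynomial del hx D,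
    derivation_eq_smul_of_polynomial del hx D]
  simp only [smul_eq_mul, sub_smul, smul_sub, mul_smul]

lemma laurent_aeval {K : Type u} [Field K] (p : Polynomial K) :
    Polynomial.aeval (laurentX K) p = HahnSeries.ofPowerSeries ℤ K p := by
  refine DFunLike.congr_fun (f := (Polynomial.aeval (laurentX K)).toRingHom)
    (g := (HahnSeries.ofPowerSeries ℤ K).comp Polynomial.coeToPowerSeries.ringHom)
    (Polynomial.ringHom_ext (fun c => ?_) ?_) p
  · change Polynomial.aeval (laurentX K) (Polynomial.C c) = HahnSeries.ofPowerSeries ℤ K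
      (Polynomial.C c : Polynomial K)
    rw [Polynomial.aeval_C, Polynomial.coe_C, HahnSeries.ofPowerSeries_C, laurent_algebraMap]
    rfl
  · change Polynomial.aeval (laurentX K) Polynomial.X = HahnSeries.ofPowerSeries ℤ K
      (Polynomial.X : Polynomial K)
    rw [Polynomial.aeval_X, Polynomial.coe_X, HahnSeries.ofPowerSeries_X]

/-- Quotients of polynomials are dense in the field of Laurent series. -/
lemma dense_laurent_quotients (K : Type u) [Field K] :
    Dense {z : LaurentSeries K | ∃ p q : Polynomial K,
      z = Polynomial.aeval (laurentX K) p / Polynomial.aeval (laurentX K) q} := by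
  refine (LaurentSeries.coe_range_dense (K := K)).mono ?_
  rintro _ ⟨r, rfl⟩
  have hp : ∀ p : Polynomial K, ((algebraMap (Polynomial K) (RatFunc K) p : RatFunc K) :
      LaurentSeries K) = Polynomial.aeval (laurentX K) p := fun p => by
    rw [laurent_aeval]
    exact (RatFunc.coe_coe p).symm
  induction r using RatFunc.induction_on with
  | f p q hq => exact ⟨p, q, by rw [← hp, ← hp]; exact map_div₀ _ _ _⟩

lemma hasRankOneForms_laurent [CharZero k] (k' : Type u) [Field k'] [Algebra k k']
    [FiniteDimensional k k'] : HasRankOneForms k (LaurentSeries k') := by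
  refine hasRankOneForms_of_derivation (laurentDeriv k k') continuous_laurentDeriv
    (dense_laurent_quotients k') (x := laurentX k') ?_
  rintro M _ _ _ _ D _ ⟨p, q, rfl⟩
  exact derivation_eq_smul_of_quotient _ laurentDeriv_X D p q

/-- For a disc, the topology of the closed fibre is the `s`-adic one. -/
lemma isAdic_disc_fibre {Y : Obj k} {k' : Type u} [Field k'] [Algebra k k']
    (e : Fibre k Y ≃ₐ[k] PowerSeries k') {J : Ideal Y} (hmax : J.IsMaximal) (hpar : par k Y ∈ J)
    (hJ : IsAdic J) : IsAdic (Ideal.span {e.symm PowerSeries.X}) := by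
  have h1 := isAdic_map_quotient hJ (Ideal.span {par k Y})
  have h2 : (J.map Y.red).IsMaximal := by
    refine Ideal.IsMaximal.map_of_surjective_of_ker_le Ideal.Quotient.mk_surjective ?_
    rw [Ideal.mk_ker, Ideal.span_le, Set.singleton_subset_iff]
    exact hpar
  have h3 : J.map Y.red = Ideal.span {e.symm PowerSeries.X} := by
    have h4 : (Ideal.map e (J.map Y.red)).IsMaximal :=
      Ideal.map_isMaximal_of_equiv e
    have h5 := IsLocalRing.eq_maximalIdeal h4
    rw [PowerSeries.maximalIdeal_eq_span_X] at h5
    have h6 := congrArg (Ideal.map e.symm) h5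
    rw [Ideal.map_span, Set.image_singleton] at h6
    rw [← h6]
    exact (Ideal.map_of_equiv (I := J.map Y.red) e.toRingEquiv).symm
  rwa [← h3]

/-- The continuous differentials of a closed fibre have rank one. -/
theorem hasRankOneForms_fibre [CharZero k] (Y : Obj k) : HasRankOneForms k (Fibre k Y) := by
  have := Y.fibreDomain
  rcases Y.kind with h | h | h | h
  · have := is_bot_adic_iff.1 (isAdic_bot_fibre Y h.1)
    obtain ⟨-, h1, h2, h3, -⟩ := h
    exact hasRankOneForms_of_formallySmooth h3
  · have := is_bot_adic_iff.1 (isAdic_bot_fibre Y h.1)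
    obtain ⟨-, h1, h2, h3⟩ := h
    let : Field (Fibre k Y) := h1.toField
    exact hasRankOneForms_of_field h3
  · obtain ⟨k', _, _, hk', ⟨e⟩, J, hmax, hpar, hJ⟩ := h
    exact hasRankOneForms_of_powerSeries e (isAdic_disc_fibre e hmax hpar hJ)
  · obtain ⟨k', _, _, hk', e, -⟩ := h.exists_equiv
    exact (hasRankOneForms_laurent k').of_equiv e

end RankOneFibres

/-! ### Local expansions of smooth curves -/

section LocalExpansion

open IsLocalRing

open scoped TensorProduct

variable {k : Type u} [Field k]

lemma finite_residue_of_localization {D : Type u} [CommRing D] [Algebra k D] (m : Ideal D)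
    [m.IsMaximal] [Module.Finite k (D ⧸ m)] (O : Type u) [CommRing O] [IsLocalRing O] [Algebra D O]
    [Algebra k O] [IsScalarTower k D O] [IsLocalization.AtPrime O m] :
    Module.Finite k (O ⧸ maximalIdeal O) := by
  let e : (D ⧸ m) ≃ₐ[k] (O ⧸ maximalIdeal O) :=
    AlgEquiv.ofRingEquiv (f := IsLocalization.AtPrime.equivQuotMaximalIdeal m O) fun c => by
      change IsLocalization.AtPrime.equivQuotMaximalIdeal m O
        (Ideal.Quotient.mk m (algebraMap k D c)) = Ideal.Quotient.mk _ (algebraMap k O c)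
      rw [IsLocalization.AtPrime.equivQuotMaximalIdeal_apply_mk,
        ← IsScalarTower.algebraMap_apply k D O]
  exact Module.Finite.equiv e.toLinearEquiv

/-- The local rings of a smooth curve at closed points are discrete valuation rings: the cotangent
space is the fibre of the module of differentials. -/
lemma isDiscreteValuationRing_of_formallySmooth [CharZero k] {D : Type u} [CommRing D] [IsDomain D]
    [IsNoetherianRing D] [Algebra k D] [Algebra.FormallySmooth k D]
    [Module.Finite D (KaehlerDifferential k D)]
    (h1 : Module.finrank D (KaehlerDifferential k D) = 1) (m : Ideal D) [m.IsMaximal]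
    [Module.Finite k (D ⧸ m)] (O : Type u) [CommRing O] [IsDomain O] [IsLocalRing O] [Algebra D O]
    [Algebra k O] [IsScalarTower k D O] [IsLocalization.AtPrime O m] :
    IsDiscreteValuationRing O := by
  have hnoeth : IsNoetherianRing O := IsLocalization.isNoetherianRing m.primeCompl O inferInstance
  have hsm : Algebra.FormallySmooth k O :=
    have := Algebra.FormallySmooth.of_isLocalization (Rₘ := O) m.primeCompl
    Algebra.FormallySmooth.comp k D O
  have hfin : Module.Finite O (KaehlerDifferential k O) :=
    Module.Finite.of_isLocalizedModule m.primeCompl (KaehlerDifferential.map k k D O)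
  have hfree : Module.Free O (KaehlerDifferential k O) := Module.free_of_flat_of_isLocalRing
  have hrank : Module.finrank O (KaehlerDifferential k O) = 1 := by
    rw [IsLocalization.finrank_eq O m.primeCompl m.primeCompl_le_nonZeroDivisors,
      IsLocalizedModule.finrank_eq m.primeCompl (KaehlerDifferential.map k k D O)
        m.primeCompl_le_nonZeroDivisors, h1]
  have hfk : Module.Finite k (ResidueField O) := finite_residue_of_localization m O
  have : Algebra.FormallyEtale k (ResidueField O) :=
    Algebra.FormallyEtale.of_isSeparable k (ResidueField O)
  -- The conormal sequence of the residue field is short exact, and the residue field is étale over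
  -- `k`; hence `𝔪/𝔪²` is the fibre of the differentials.
  have hsurj : Function.Surjective (algebraMap O (ResidueField O)) := residue_surjective
  have hinj : Function.Injective (KaehlerDifferential.kerCotangentToTensor k O (ResidueField O)) := by
    obtain ⟨l, hl⟩ := (Algebra.FormallySmooth.iff_split_injection (R := k) hsurj).1 inferInstance
    exact Function.LeftInverse.injective (DFunLike.congr_fun hl)
  have hsurj' : Function.Surjective
      (KaehlerDifferential.kerCotangentToTensor k O (ResidueField O)) := fun w =>
    (KaehlerDifferential.exact_kerCotangentToTensor_mapBaseChange k O (ResidueField O) hsurj w).1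
      (Subsingleton.elim _ _)
  have key : ∀ I : Ideal O, I = maximalIdeal O →
      (I.Cotangent ≃ₗ[O] ResidueField O ⊗[O] KaehlerDifferential k O) →
      Module.finrank (ResidueField O) (CotangentSpace O) = 1 := by
    rintro I rfl e
    rw [(e.extendScalarsOfSurjective hsurj).finrank_eq, Module.finrank_baseChange, hrank]
  rw [← finrank_CotangentSpace_eq_one_iff]
  exact key _ ker_residue (LinearEquiv.ofBijective _ ⟨hinj, hsurj'⟩)

open PowerSeries in
/-- A discrete valuation ring with residue field finite over `k` embeds into the power series over
its residue field. -/
lemma exists_expansion_of_dvr [CharZero k] (O : Type u) [CommRing O] [IsDomain O]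
    [IsDiscreteValuationRing O] [Algebra k O] [Module.Finite k (O ⧸ maximalIdeal O)] :
    ∃ (k' : Type u) (_ : Field k') (_ : Algebra k k') (_ : FiniteDimensional k k')
      (Θ : O →+* PowerSeries k'), Function.Injective Θ ∧
      (∀ c, Θ (algebraMap k O c) = C (algebraMap k k' c)) ∧
      (∃ t, Θ t = X) ∧ ∀ b, ∃ r, coeff 0 (Θ r) = b := by
  obtain ⟨t, ht⟩ := IsDiscreteValuationRing.exists_irreducible O
  have hm : maximalIdeal O = Ideal.span {t} := ht.maximalIdeal_eq
  have hmax : (Ideal.span {t}).IsMaximal := hm ▸ inferInstance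
  let : Field (O ⧸ Ideal.span {t}) := Ideal.Quotient.field _
  have hfin : Module.Finite k (O ⧸ Ideal.span {t}) := hm ▸ inferInstance
  have : Algebra.FormallyEtale k (O ⧸ Ideal.span {t}) := Algebra.FormallyEtale.of_isSeparable k _
  obtain ⟨g, hg⟩ := Algebra.FormallySmooth.exists_adicCompletionEvalOneₐ_comp_eq (R := k)
    (I := Ideal.span {t}) (AlgHom.id k (O ⧸ Ideal.span {t}))
  obtain ⟨Θ, hΘt, hΘ0, hΘc⟩ := exists_chart_of_section (t := t)
    (fun x hx => (mul_eq_zero.1 hx).resolve_left ht.ne_zero) (g : _ →+* _)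
    fun b => DFunLike.congr_fun hg b
  refine ⟨O ⧸ Ideal.span {t}, inferInstance, inferInstance, hfin, Θ, ?_, fun c => ?_, ⟨t, hΘt⟩,
    fun b => ?_⟩
  · -- An element of the kernel is infinitely divisible by `t`.
    rw [injective_iff_map_eq_zero]
    intro x hx
    have h1 : ∀ n : ℕ, ∃ y, x = t ^ n * y ∧ Θ y = 0 := by
      intro n
      induction n with
      | zero => exact ⟨x, by rw [pow_zero, one_mul], hx⟩
      | succ n ih =>
        obtain ⟨y, hy, hy0⟩ := ih
        have h2 := hΘ0 y
        rw [hy0, map_zero, eq_comm, Ideal.Quotient.eq_zero_iff_mem, Ideal.mem_span_singleton] at h2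
        obtain ⟨z, rfl⟩ := h2
        refine ⟨z, by rw [hy]; ring, ?_⟩
        rw [map_mul Θ, hΘt] at hy0
        exact (mul_eq_zero.1 hy0).resolve_left X_ne_zero
    have h3 : x ∈ (⨅ n : ℕ, maximalIdeal O ^ n : Ideal O) := by
      rw [Ideal.mem_iInf]
      intro n
      obtain ⟨y, hy, -⟩ := h1 n
      rw [hm, mem_span_pow_iff_dvd, hy]
      exact Dvd.intro _ rfl
    rwa [Ideal.iInf_pow_eq_bot_of_isLocalRing _ (maximalIdeal.isMaximal O).ne_top] at h3
  · refine hΘc _ _ ?_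
    have h1 := g.commutes c
    change _ = g (algebraMap k _ c)
    rw [h1, IsScalarTower.algebraMap_apply k O (AdicCompletion _ _)]
  · obtain ⟨r, rfl⟩ := Ideal.Quotient.mk_surjective b
    exact ⟨r, hΘ0 r⟩

open PowerSeries in
/-- The quotients of the images of elements of a ring with dense image in `K⟦s⟧` are dense in
`K((s))`. -/
lemma dense_quotients {O K : Type u} [CommRing O] [Field K] (Θ : O →+* PowerSeries K) {t : O}
    (ht : Θ t = X) (hΘ : ∀ b, ∃ r, coeff 0 (Θ r) = b) :
    Dense {z : LaurentSeries K | ∃ x y : O,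
      z = HahnSeries.ofPowerSeries ℤ K (Θ x) / HahnSeries.ofPowerSeries ℤ K (Θ y)} := by
  intro f
  rw [mem_closure_iff_nhds]
  intro U hU
  have hU' : (fun z => f + z) ⁻¹' U ∈ nhds (0 : LaurentSeries K) :=
    (continuous_const.add continuous_id).continuousAt.preimage_mem_nhds (by simpa using hU)
  obtain ⟨n, hn⟩ := laurent_mem_nhds_zero.1 hU'
  -- Write `f = g / sᴺ` and approximate the numerator.
  obtain ⟨⟨g, ⟨_, N, rfl⟩⟩, hg⟩ :=
    IsLocalization.surj (Submonoid.powers (X : PowerSeries K)) f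
  obtain ⟨r, hr⟩ := exists_approx_of_surjective ht hΘ (n.toNat + N) g
  have hX : HahnSeries.ofPowerSeries ℤ K (X ^ N) = HahnSeries.single (N : ℤ) 1 :=
    HahnSeries.ofPowerSeries_X_pow N
  have hX0 : (HahnSeries.single (N : ℤ) (1 : K) : LaurentSeries K) ≠ 0 :=
    HahnSeries.single_ne_zero one_ne_zero
  have hgf : f = HahnSeries.ofPowerSeries ℤ K g / HahnSeries.single (N : ℤ) 1 := by
    rw [eq_div_iff hX0, ← hX]
    exact hg
  refine ⟨_, ?_, r, t ^ N, rfl⟩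
  obtain ⟨w, hw⟩ := hr
  have h1 : HahnSeries.ofPowerSeries ℤ K (Θ r) / HahnSeries.ofPowerSeries ℤ K (Θ (t ^ N)) =
      f + -(HahnSeries.single (n.toNat : ℤ) 1 * HahnSeries.ofPowerSeries ℤ K w) := by
    rw [map_pow Θ, ht, hX, hgf, div_eq_iff hX0, add_mul, div_mul_cancel₀ _ hX0, ← hX, neg_mul,
      mul_right_comm, ← HahnSeries.ofPowerSeries_X_pow, ← map_mul, ← map_mul, ← pow_add, ← hw,
      map_sub]
    ring
  rw [h1]
  refine hn _ fun i hi => ?_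
  rw [HahnSeries.coeff_neg, neg_eq_zero]
  have h2 : (HahnSeries.single (n.toNat : ℤ) 1 * HahnSeries.ofPowerSeries ℤ K w).coeff
      ((i - n.toNat) + n.toNat) = 1 * (HahnSeries.ofPowerSeries ℤ K w).coeff (i - n.toNat) :=
    HahnSeries.coeff_single_mul_add
  rw [sub_add_cancel] at h2
  rw [h2, one_mul]
  have h3 : i - n.toNat < 0 := by have := Int.self_le_toNat n; omega
  have h4 := PowerSeries.coeff_coe w (i - n.toNat)
  rwa [if_pos h3] at h4

/-- If a discrete valuation ring of the fraction field of `F` has residue field finite over `k`,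
there is an embedding of `F` in a field of Laurent series for which the quotients are dense. -/
lemma exists_germ_of_dvr [CharZero k] (F E O : Type u) [CommRing F] [IsDomain F] [Algebra k F]
    [Field E] [Algebra F E] [IsFractionRing F E] [Algebra k E] [IsScalarTower k F E] [CommRing O]
    [IsDomain O] [IsDiscreteValuationRing O] [Algebra k O] [Algebra O E] [IsFractionRing O E]
    [IsScalarTower k O E] [Module.Finite k (O ⧸ maximalIdeal O)] :
    ∃ (k' : Type u) (_ : Field k') (_ : Algebra k k') (_ : FiniteDimensional k k')
      (θ : F →ₐ[k] LaurentSeries k'), Function.Injective θ ∧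
      Dense {z : LaurentSeries k' | ∃ x y : F, z = θ x / θ y} := by
  obtain ⟨k', _, _, hk', Θ, hinj, hc, ⟨t, ht⟩, hΘ⟩ := exists_expansion_of_dvr (k := k) O
  have hinj' : Function.Injective ((HahnSeries.ofPowerSeries ℤ k').comp Θ) :=
    HahnSeries.ofPowerSeries_injective.comp hinj
  let ΘE : E →+* LaurentSeries k' := IsFractionRing.lift hinj'
  have hΘE : ∀ o, ΘE (algebraMap O E o) = HahnSeries.ofPowerSeries ℤ k' (Θ o) := fun o =>
    IsFractionRing.lift_algebraMap hinj' o
  let θ : F →ₐ[k] LaurentSeries k' :=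
    { ΘE.comp (algebraMap F E) with
      commutes' := fun c => by
        change ΘE (algebraMap F E (algebraMap k F c)) = _
        rw [← IsScalarTower.algebraMap_apply k F E, IsScalarTower.algebraMap_apply k O E, hΘE, hc,
          HahnSeries.ofPowerSeries_C, laurent_algebraMap] }
  have hθ : ∀ a, θ a = ΘE (algebraMap F E a) := fun a => rfl
  refine ⟨k', inferInstance, inferInstance, hk', θ, ?_, ?_⟩
  · exact ΘE.injective.comp (IsFractionRing.injective F E)
  · refine (dense_quotients Θ ht hΘ).mono ?_
    rintro _ ⟨x, y, rfl⟩
    obtain ⟨a, b, -, hab⟩ := IsFractionRing.div_surjective F (algebraMap O E x / algebraMap O E y)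
    refine ⟨a, b, ?_⟩
    rw [hθ, hθ, ← map_div₀ ΘE, hab, map_div₀, hΘE, hΘE]

/-- A smooth curve has a germ, at any of its closed points. -/
lemma exists_germ_of_curve [CharZero k] (F : Type u) [CommRing F] [IsDomain F] [IsNoetherianRing F]
    [Algebra k F] [Algebra.FormallySmooth k F] [Module.Finite F (KaehlerDifferential k F)]
    (h1 : Module.finrank F (KaehlerDifferential k F) = 1)
    (hres : ∀ m : Ideal F, m.IsMaximal → Module.Finite k (F ⧸ m)) :
    ∃ (k' : Type u) (_ : Field k') (_ : Algebra k k') (_ : FiniteDimensional k k')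
      (θ : F →ₐ[k] LaurentSeries k'), Function.Injective θ ∧
      Dense {z : LaurentSeries k' | ∃ x y : F, z = θ x / θ y} := by
  obtain ⟨m, hm⟩ := Ideal.exists_maximal F
  have := hres m hm
  let O := Localization.subalgebra.ofField (FractionRing F) m.primeCompl
    m.primeCompl_le_nonZeroDivisors
  have hloc : IsLocalization.AtPrime O m := Localization.subalgebra.isLocalization_ofField ..
  have hlr : IsLocalRing O := IsLocalization.AtPrime.isLocalRing O m
  have := isDiscreteValuationRing_of_formallySmooth h1 m O
  have := finite_residue_of_localization (k := k) m O
  exact exists_germ_of_dvr F (FractionRing F) O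

/-- A finite separable extension of the fraction field of an affine principal ideal domain `A` has a
germ: the maximal ideals of the integral closure of `A` provide discrete valuation rings. -/
lemma exists_germ_of_integralClosure [CharZero k] (A K F : Type u) [CommRing A] [IsDomain A]
    [IsPrincipalIdealRing A] [Algebra k A] [Algebra.FiniteType k A] (hA : ¬ IsField A) [Field K]
    [Algebra A K] [IsFractionRing A K] [Field F] [Algebra k F] [Algebra A F] [Algebra K F]
    [IsScalarTower A K F] [IsScalarTower k A F] [FiniteDimensional K F] [Algebra.IsSeparable K F] :
    ∃ (k' : Type u) (_ : Field k') (_ : Algebra k k') (_ : FiniteDimensional k k')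
      (θ : F →ₐ[k] LaurentSeries k'), Function.Injective θ ∧
      Dense {z : LaurentSeries k' | ∃ x y : F, z = θ x / θ y} := by
  have hAF : Function.Injective (algebraMap A F) := by
    rw [IsScalarTower.algebraMap_eq A K F]
    exact (algebraMap K F).injective.comp (IsFractionRing.injective A K)
  have hBd : IsDedekindDomain (integralClosure A F) := integralClosure.isDedekindDomain A K F
  have hBfr : IsFractionRing (integralClosure A F) F :=
    IsIntegralClosure.isFractionRing_of_finite_extension A K F (integralClosure A F)
  have hBfin : Module.Finite A (integralClosure A F) :=
    IsIntegralClosure.finite A K F (integralClosure A F)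
  have hBf : ¬ IsField (integralClosure A F) := fun hf => hA (isField_of_isIntegral_of_isField
    (fun a b hab => hAF (congrArg Subtype.val hab)) hf)
  have hBft : Algebra.FiniteType k (integralClosure A F) :=
    Algebra.FiniteType.trans (S := A) inferInstance inferInstance
  obtain ⟨P, hP, hPp⟩ := Ring.not_isField_iff_exists_prime.1 hBf
  have hPm : P.IsMaximal := hPp.isMaximal hP
  let : Field (integralClosure A F ⧸ P) := Ideal.Quotient.field P
  have : Module.Finite k (integralClosure A F ⧸ P) :=
    finite_of_finite_type_of_isJacobsonRing k (integralClosure A F ⧸ P)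
  let O := Localization.subalgebra.ofField F P.primeCompl P.primeCompl_le_nonZeroDivisors
  have hloc : IsLocalization.AtPrime O P := Localization.subalgebra.isLocalization_ofField ..
  have := IsLocalization.AtPrime.isDiscreteValuationRing_of_dedekind_domain _ hP O
  have := finite_residue_of_localization (k := k) P O
  exact exists_germ_of_dvr F F O

open IntermediateField.algebraAdjoinAdjoin in
/-- A function field of one variable has a germ, at a closed point of an affine model finite over the
line. -/
lemma exists_germ_of_functionField [CharZero k] (F : Type u) [Field F] [Algebra k F]
    [Algebra.EssFiniteType k F] (h : Algebra.trdeg k F = 1) :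
    ∃ (k' : Type u) (_ : Field k') (_ : Algebra k k') (_ : FiniteDimensional k k')
      (θ : F →ₐ[k] LaurentSeries k'), Function.Injective θ ∧
      Dense {z : LaurentSeries k' | ∃ x y : F, z = θ x / θ y} := by
  obtain ⟨x, hx, hsep⟩ := exists_separating h
  let e : Polynomial k ≃ₐ[k] Algebra.adjoin k ({x} : Set F) :=
    (AlgEquiv.ofInjective (Polynomial.aeval x) (transcendental_iff_injective.1 hx)).trans
      (Subalgebra.equivOfEq _ _ (Algebra.adjoin_singleton_eq_range_aeval k x).symm)
  have hA : IsPrincipalIdealRing (Algebra.adjoin k ({x} : Set F)) :=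
    IsPrincipalIdealRing.of_surjective e e.surjective
  have hAf : ¬ IsField (Algebra.adjoin k ({x} : Set F)) := fun hf =>
    Polynomial.not_isField k (e.toMulEquiv.isField hf)
  have : Algebra.EssFiniteType (IntermediateField.adjoin k ({x} : Set F)) F :=
    Algebra.EssFiniteType.of_comp k _ F
  have : FiniteDimensional (IntermediateField.adjoin k ({x} : Set F)) F :=
    Algebra.finite_of_essFiniteType_of_isAlgebraic
  have hAft : Algebra.FiniteType k (Algebra.adjoin k ({x} : Set F)) :=
    Algebra.FiniteType.equiv inferInstance e
  exact exists_germ_of_integralClosure (Algebra.adjoin k ({x} : Set F))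
    (IntermediateField.adjoin k ({x} : Set F)) F hAf

end LocalExpansion

/-! ### Formal germs -/

section Germs

variable {k : Type u} [Field k]

/-- A homomorphism from a ring with an `I`-adic topology, `I = (s)`, to the Laurent series is
continuous if it maps the ring to `K⟦s⟧` and `s` to `s`. -/
lemma continuous_ofPowerSeries {F K : Type u} [CommRing F] [TopologicalSpace F]
    [IsTopologicalRing F] [Field K] (e : F →+* PowerSeries K) {s : F} (hs : e s = PowerSeries.X)
    (hF : IsAdic (Ideal.span {s})) :
    Continuous ((HahnSeries.ofPowerSeries ℤ K).comp e) := by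
  refine continuous_of_continuousAt_zero _ ?_
  rw [ContinuousAt, map_zero]
  intro U hU
  obtain ⟨n, hn⟩ := laurent_mem_nhds_zero.1 hU
  have h0 := ((isAdic_iff.1 hF).1 n.toNat).mem_nhds (Ideal.zero_mem _)
  refine Filter.mem_map.2 (Filter.mem_of_superset h0 ?_)
  intro x hx
  refine hn _ fun i hi => ?_
  obtain ⟨y, rfl⟩ := mem_span_pow_iff_dvd.1 hx
  rw [RingHom.comp_apply, map_mul, map_pow, hs, PowerSeries.coeff_coe]
  split_ifs with h0
  · rfl
  · rw [PowerSeries.coeff_X_pow_mul', if_neg (by omega)]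

/-- The closed fibre of every object has a place with finite residue field. -/
theorem exists_fibre_germ [CharZero k] (Y : Obj k) :
    ∃ (k' : Type u) (_ : Field k') (_ : Algebra k k') (_ : FiniteDimensional k k')
      (θ : Fibre k Y →A[k] LaurentSeries k'), Function.Injective θ ∧
      Dense {z : LaurentSeries k' | ∃ x y : Fibre k Y, z = θ x / θ y} := by
  have hdom := Y.fibreDomain
  have hnoeth := Y.noetherian
  rcases Y.kind with h | h | h | h
  · have := is_bot_adic_iff.1 (isAdic_bot_fibre Y h.1)
    obtain ⟨-, h1, h2, h3, h4⟩ := h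
    obtain ⟨k', _, _, hk', θ, hinj, hd⟩ := exists_germ_of_curve (k := k) (Fibre k Y) h3 h4
    exact ⟨k', _, _, hk', ⟨θ, continuous_of_discreteTopology⟩, hinj, hd⟩
  · have := is_bot_adic_iff.1 (isAdic_bot_fibre Y h.1)
    obtain ⟨-, h1, h2, h3⟩ := h
    let : Field (Fibre k Y) := h1.toField
    obtain ⟨k', _, _, hk', θ, hinj, hd⟩ := exists_germ_of_functionField (k := k) (Fibre k Y) h3
    exact ⟨k', _, _, hk', ⟨θ, continuous_of_discreteTopology⟩, hinj, hd⟩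
  · obtain ⟨k', _, _, hk', ⟨e⟩, J, hmax, hpar, hJ⟩ := h
    have heX : e (e.symm PowerSeries.X) = PowerSeries.X := e.apply_symm_apply _
    let θ : Fibre k Y →ₐ[k] LaurentSeries k' :=
      { (HahnSeries.ofPowerSeries ℤ k').comp e.toRingEquiv.toRingHom with
        commutes' := fun c => by
          change HahnSeries.ofPowerSeries ℤ k' (e (algebraMap k _ c)) = _
          rw [e.commutes, laurent_algebraMap, PowerSeries.algebraMap_apply,
            HahnSeries.ofPowerSeries_C] }
    refine ⟨k', _, _, hk', ⟨θ, continuous_ofPowerSeries e.toRingEquiv.toRingHom heX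
      (isAdic_disc_fibre e hmax hpar hJ)⟩, ?_, ?_⟩
    · exact HahnSeries.ofPowerSeries_injective.comp e.injective
    · exact dense_quotients e.toRingEquiv.toRingHom heX fun b =>
        ⟨e.symm (PowerSeries.C b), by
          change PowerSeries.coeff 0 (e (e.symm _)) = _
          rw [e.apply_symm_apply, PowerSeries.coeff_zero_C]⟩
  · obtain ⟨k', _, _, hk', e, -⟩ := h.exists_equiv
    refine ⟨k', _, _, hk', ⟨e.toAlgEquiv.toAlgHom, e.continuous⟩, e.injective, ?_⟩
    convert dense_univ
    refine Set.eq_univ_of_forall fun z => ⟨e.symm z, 1, ?_⟩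
    change z = e (e.symm z) / e 1
    rw [e.apply_symm_apply, map_one, div_one]

/-- Continuous derivations factor through the continuous differentials. -/
lemma derivation_eq_zero_of_form_d_eq_zero {B : Type u} [CommRing B] [Algebra k B]
    [TopologicalSpace B] [T2Space B] [IsTopologicalRing B] (D : Derivation k B B)
    (hD : Continuous D) {a : B} (ha : Form.d k a = 0) : D a = 0 := by
  obtain ⟨L, hL⟩ := Form.exists_lift k D hD
  rw [← hL, ha, map_zero]

lemma derivation_div_eq_zero {K : Type u} [Field K] [Algebra k K] (D : Derivation k K K) {a b : K}
    (ha : D a = 0) (hb : D b = 0) : D (a / b) = 0 := by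
  rw [Derivation.leibniz_div, ha, hb, smul_zero, smul_zero, sub_zero, smul_zero]

/-- A form vanishes if its expansion at a place does: otherwise the derivation `d/ds` of the Laurent
series would vanish on the dense subfield of quotients. -/
lemma Form.map_injective_of_dense [CharZero k] {F : Type u} [CommRing F] [IsDomain F] [Algebra k F]
    [TopologicalSpace F] (hF : HasRankOneForms k F) {k' : Type u} [Field k'] [Algebra k k']
    [FiniteDimensional k k'] (θ : F →A[k] LaurentSeries k') (hinj : Function.Injective θ)
    (hd : Dense {z : LaurentSeries k' | ∃ x y : F, z = θ x / θ y}) :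
    Function.Injective (Form.map k θ) := by
  have hL : HasRankOneForms k (LaurentSeries k') := hasRankOneForms_laurent k'
  have hT := hL.t2
  obtain ⟨x, hx⟩ := hF.exists_generator
  have h0 : ∀ a, a ≠ 0 → θ a ≠ 0 := fun a ha hha => ha (hinj (hha.trans (map_zero θ).symm))
  -- If `d(θ x) = 0`, then `d/ds` vanishes on the image of `F`, hence everywhere.
  have hx0 : Form.d k (θ x) ≠ 0 := by
    intro hx0
    have h1 : ∀ a, laurentDeriv k k' (θ a) = 0 := fun a => by
      obtain ⟨c, hc, c', h⟩ := hx (Form.d k a)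
      have h2 := congrArg (Form.map k θ) h
      rw [Form.map_smul, Form.map_smul, Form.map_d, Form.map_d, hx0, smul_zero] at h2
      exact derivation_eq_zero_of_form_d_eq_zero _ continuous_laurentDeriv
        ((hL.torsionFree _ _ h2).resolve_left (h0 c hc))
    have h2 : Set.EqOn (laurentDeriv k k') (fun _ => 0)
        {z : LaurentSeries k' | ∃ x y : F, z = θ x / θ y} := by
      rintro _ ⟨a, b, rfl⟩
      exact derivation_div_eq_zero _ (h1 a) (h1 b)
    have h3 := Continuous.ext_on hd continuous_laurentDeriv continuous_const h2
    have h4 := congrFun h3 (laurentX k')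
    rw [laurentDeriv_X] at h4
    exact one_ne_zero h4
  rw [injective_iff_map_eq_zero]
  intro w hw
  obtain ⟨c, hc, c', h⟩ := hx w
  have h1 := congrArg (Form.map k θ) h
  rw [Form.map_smul, Form.map_smul, Form.map_d, hw, smul_zero] at h1
  have h2 : θ c' = 0 := (hL.torsionFree _ _ h1.symm).resolve_right hx0
  have h3 : c' = 0 := by_contra fun h' => h0 c' h' h2
  rw [h3, zero_smul] at h
  exact (hF.torsionFree _ _ h).resolve_left hc

variable {k' : Type u} [Field k'] [Algebra k k'] [FiniteDimensional k k']

variable (k k') in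
/-- The closed fibre of `k'((s))⟦t⟧` is `k'((s))`. -/
def laurentFibre : Fibre k (laurent k k') →A[k] LaurentSeries k' where
  toAlgHom := Ideal.Quotient.liftₐ _
    ({ (PowerSeries.constantCoeff (R := LaurentSeries k')).comp
        (laurentSeriesEquiv k k').toRingHom with
      commutes' := fun c => by
        change PowerSeries.constantCoeff (PowerSeries.map (algebraMap k (LaurentSeries k'))
          (PowerSeries.C c)) = _
        rw [PowerSeries.map_C, PowerSeries.constantCoeff_C] } : laurent k k' →ₐ[k] LaurentSeries k')
    (by
      intro a ha
      obtain ⟨b, rfl⟩ := Ideal.mem_span_singleton.1 ha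
      rw [map_mul]
      change PowerSeries.constantCoeff (PowerSeries.map (algebraMap k (LaurentSeries k'))
          PowerSeries.X) * _ = 0
      rw [PowerSeries.map_X, PowerSeries.constantCoeff_X, zero_mul])
  cont := (isQuotientMap_red (laurent k k')).continuous_iff.2
    (PowerSeries.WithPiTopology.continuous_constantCoeff (LaurentSeries k'))

/-- The morphism `(Y/(t))⟦t⟧ → k'((s))⟦t⟧` given by a homomorphism of closed fibres. -/
def germHom {Y : Obj k} (θ : Fibre k Y →A[k] LaurentSeries k') :
    Y.completion.Hom (laurent k k') where
  toFun := fun y => (laurentSeriesEquiv k k').symm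
    (PowerSeries.map (θ : Fibre k Y →ₐ[k] LaurentSeries k').toRingHom (completionEquiv Y y))
  map_one' := by rw [map_one, map_one, map_one]
  map_mul' x y := by rw [map_mul, map_mul, map_mul]
  map_zero' := by rw [map_zero, map_zero, map_zero]
  map_add' x y := by rw [map_add, map_add, map_add]
  commutes' a := by
    change PowerSeries.map (θ : Fibre k Y →ₐ[k] LaurentSeries k').toRingHom
      (PowerSeries.map (algebraMap k (Fibre k Y)) a) =
        PowerSeries.map (algebraMap k (LaurentSeries k')) a
    ext n : 1
    rw [PowerSeries.coeff_map, PowerSeries.coeff_map, PowerSeries.coeff_map]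
    exact (θ : Fibre k Y →ₐ[k] LaurentSeries k').commutes _
  cont := continuous_powerSeries_map θ.continuous

lemma residueMap_germHom {Y : Obj k} (θ : Fibre k Y →A[k] LaurentSeries k') (y : Y.completion) :
    residueMap (germHom θ) y = θ (PowerSeries.constantCoeff (completionEquiv Y y)) := by
  change PowerSeries.constantCoeff (PowerSeries.map
    (θ : Fibre k Y →ₐ[k] LaurentSeries k').toRingHom (completionEquiv Y y)) = _
  rw [← PowerSeries.coeff_zero_eq_constantCoeff_apply, PowerSeries.coeff_map,
    PowerSeries.coeff_zero_eq_constantCoeff_apply]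
  rfl

lemma isGerm_germHom {Y : Obj k} {θ : Fibre k Y →A[k] LaurentSeries k'}
    (hinj : Function.Injective θ)
    (hd : Dense {z : LaurentSeries k' | ∃ x y : Fibre k Y, z = θ x / θ y}) :
    IsGerm (germHom θ) := by
  constructor
  · intro y hy
    rw [residueMap_germHom] at hy
    have h0 := hinj (hy.trans (map_zero θ).symm)
    rw [← PowerSeries.X_dvd_iff] at h0
    have h1 : completionEquiv Y (par k Y.completion) = PowerSeries.X := tubeEquiv_par k _
    rw [← h1] at h0
    exact (map_dvd_iff (completionEquiv Y)).1 h0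
  · refine hd.mono ?_
    rintro _ ⟨a, b, rfl⟩
    refine ⟨(completionEquiv Y).symm (PowerSeries.C a), (completionEquiv Y).symm (PowerSeries.C b), ?_⟩
    rw [residueMap_germHom, residueMap_germHom, RingEquiv.apply_symm_apply,
      RingEquiv.apply_symm_apply, PowerSeries.constantCoeff_C, PowerSeries.constantCoeff_C]

lemma laurentSeriesEquiv_par : laurentSeriesEquiv k k' (par k (laurent k k')) = PowerSeries.X :=
  PowerSeries.map_X (algebraMap k (LaurentSeries k'))

lemma isGerm_id : IsGerm (ContinuousAlgHom.id (PowerSeries k) (laurent k k')) := by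
  have hres : ∀ x, residueMap (ContinuousAlgHom.id (PowerSeries k) (laurent k k')) x =
      PowerSeries.constantCoeff (laurentSeriesEquiv k k' x) := fun x => rfl
  constructor
  · intro x hx
    rw [hres, ← PowerSeries.X_dvd_iff] at hx
    rw [← laurentSeriesEquiv_par (k := k)] at hx
    exact (map_dvd_iff (laurentSeriesEquiv k k')).1 hx
  · convert dense_univ
    refine Set.eq_univ_of_forall fun z => ⟨(laurentSeriesEquiv k k').symm (PowerSeries.C z), 1, ?_⟩
    rw [hres, hres, RingEquiv.apply_symm_apply, map_one, map_one, div_one,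
      PowerSeries.constantCoeff_C]

/-- The morphism `germHom θ` induces an isomorphism of germs, with the identity as the germ of its
target. -/
lemma isGermIso_germHom {Y : Obj k} {θ : Fibre k Y →A[k] LaurentSeries k'}
    (hinj : Function.Injective θ)
    (hd : Dense {z : LaurentSeries k' | ∃ x y : Fibre k Y, z = θ x / θ y}) :
    IsGermIso (germHom θ) :=
  ⟨k', _, _, inferInstance, ContinuousAlgHom.id _ _, isGerm_id, isGerm_germHom hinj hd⟩

/-- A form on the closed fibre of `Y` is determined by its expansion at a place. -/
lemma push_germHom_injective [CharZero k] {Y : Obj k} {κ : Y →+* PowerSeries (Fibre k Y)}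
    (hκ : IsChart Y κ) {θ : Fibre k Y →A[k] LaurentSeries k'} (hinj : Function.Injective θ)
    (hd : Dense {z : LaurentSeries k' | ∃ x y : Fibre k Y, z = θ x / θ y}) :
    Function.Injective fun w : Y.Ω => (germHom θ).push (hκ.hom.push w) := by
  have := Y.fibreDomain
  refine Function.Injective.of_comp (f := Form.map k (laurentFibre k k')) ?_
  convert Form.map_injective_of_dense (hasRankOneForms_fibre Y) θ hinj hd using 1
  ext w
  change Form.map k _ (Form.map k _ (Form.map k _ w)) = _
  rw [Form.map_comp, Form.map_comp]
  congr 1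
  congr 1
  refine DFunLike.ext _ _ fun a => ?_
  obtain ⟨y, rfl⟩ := Ideal.Quotient.mk_surjective a
  change residueMap (germHom θ) (hκ.hom y) = θ (Y.red y)
  rw [residueMap_germHom, completionEquiv_hom, ← PowerSeries.coeff_zero_eq_constantCoeff_apply,
    hκ.coeff_zero]

end Germs

/-! ### Operations on presentations -/

section Presentations

open PowerSeries

variable {k : Type u} [Field k]

/-- A presentation of `χ` can be pushed forward along a homomorphism of the coefficients. -/
lemma IsPresentation.map {X Y : Obj k} {χ : X.Iso₂ Y} {B C : Type u} [CommRing B] [Algebra k B]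
    [TopologicalSpace B] [CommRing C] [Algebra k C] [TopologicalSpace C] {h : Fibre k Y →A[k] B}
    {l : X →+* PowerSeries B} {κ : Y →+* PowerSeries B} (hp : IsPresentation χ h l κ)
    (g : B →A[k] C) : IsPresentation χ (g.comp h)
      ((PowerSeries.map (g : B →ₐ[k] C).toRingHom).comp l)
      ((PowerSeries.map (g : B →ₐ[k] C).toRingHom).comp κ) where
  cont_left := (continuous_powerSeries_map g.continuous).comp hp.cont_left
  cont_right := (continuous_powerSeries_map g.continuous).comp hp.cont_right
  algebraMap_left a := by
    rw [RingHom.comp_apply, hp.algebraMap_left]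
    ext n
    rw [coeff_map, coeff_map, coeff_map]
    exact (g : B →ₐ[k] C).commutes _
  algebraMap_right a := by
    rw [RingHom.comp_apply, hp.algebraMap_right]
    ext n
    rw [coeff_map, coeff_map, coeff_map]
    exact (g : B →ₐ[k] C).commutes _
  constantCoeff y := by
    rw [RingHom.comp_apply, ← coeff_zero_eq_constantCoeff_apply, coeff_map,
      coeff_zero_eq_constantCoeff_apply, hp.constantCoeff]
    rfl
  compat x y hxy := by
    rw [RingHom.comp_apply, RingHom.comp_apply, ← map_sub]
    have := map_dvd (PowerSeries.map (g : B →ₐ[k] C).toRingHom) (hp.compat x y hxy)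
    rwa [map_pow, map_X] at this

/-- A presentation of `ψ` can be pulled back along morphisms compatible with `χ` and `ψ`. -/
lemma IsPresentation.comp {X Y X' Y' : Obj k} {χ : X.Iso₂ Y} {ψ : X'.Iso₂ Y'} {B : Type u}
    [CommRing B] [Algebra k B] [TopologicalSpace B] {h : Fibre k Y' →A[k] B}
    {l : X' →+* PowerSeries B} {κ : Y' →+* PowerSeries B} (hp : IsPresentation ψ h l κ)
    (f : X.Hom X') (g : Y.Hom Y')
    (hfg : ∀ x y, χ (X.red₂ x) = Y.red₂ y → ψ (X'.red₂ (f x)) = Y'.red₂ (g y)) :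
    IsPresentation χ (h.comp g.fibre) (l.comp (f : X →ₐ[PowerSeries k] X').toRingHom)
      (κ.comp (g : Y →ₐ[PowerSeries k] Y').toRingHom) where
  cont_left := hp.cont_left.comp f.continuous
  cont_right := hp.cont_right.comp g.continuous
  algebraMap_left a := by
    rw [← hp.algebraMap_left]
    exact congrArg l ((f : X →ₐ[PowerSeries k] X').commutes a)
  algebraMap_right a := by
    rw [← hp.algebraMap_right]
    exact congrArg κ ((g : Y →ₐ[PowerSeries k] Y').commutes a)
  constantCoeff y := hp.constantCoeff (g y)
  compat x y hxy := hp.compat _ _ (hfg x y hxy)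

lemma Form.map_id {B : Type u} [CommRing B] [Algebra k B] [TopologicalSpace B] (w : Form k B) :
    Form.map k (ContinuousAlgHom.id k B) w = w := by
  induction w using Form.induction with
  | d a => rw [Form.map_d]; rfl
  | zero => rw [map_zero]
  | add x y hx hy => rw [map_add, hx, hy]
  | smul c x hx => rw [Form.map_smul, hx]; rfl

lemma map_par {X Y : Obj k} (g : X.Hom Y) : g (par k X) = par k Y := g.toAlgHom.commutes _

/-- Isomorphisms over morphisms induce compatible isomorphisms of truncations. -/
lemma lifts_compat {X₁ Y₁ X₂ Y₂ : Obj k} {χ₁ : X₁.Iso Y₁} {χ₂ : X₂.Iso Y₂} {f : X₁.Hom X₂}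
    {g : Y₁.Hom Y₂} (hfg : ∀ x, g (χ₁ x) = χ₂ (f x)) {ψ₁ : X₁.Iso₂ Y₁} {ψ₂ : X₂.Iso₂ Y₂}
    (h₁ : Lifts χ₁ ψ₁) (h₂ : Lifts χ₂ ψ₂) (x : X₁) (y : Y₁) (hxy : ψ₁ (X₁.red₂ x) = Y₁.red₂ y) :
    ψ₂ (X₂.red₂ (f x)) = Y₂.red₂ (g y) := by
  rw [h₁, red₂_eq_iff] at hxy
  rw [h₂, ← hfg, red₂_eq_iff, ← map_sub, ← map_par g, ← map_pow]
  exact map_dvd g hxy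

section Normalisation

variable (k) (k' : Type u) [Field k'] [Algebra k k'] [FiniteDimensional k k']

lemma laurentSeriesEquiv_algebraMap (a : PowerSeries k) :
    laurentSeriesEquiv k k' (algebraMap (PowerSeries k) (laurent k k') a) =
      PowerSeries.map (algebraMap k (LaurentSeries k')) a := rfl

/-- The inclusion of the constants `k'((s))`, followed by the reduction modulo `t`. -/
abbrev laurentConst : LaurentSeries k' →+* Fibre k (laurent k k') :=
  (laurent k k').red.comp ((laurentSeriesEquiv k k').symm.toRingHom.comp PowerSeries.C)

lemma continuous_laurentConst : Continuous (laurentConst k k') :=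
  (continuous_quot_mk (X := laurent k k')).comp
    (PowerSeries.WithPiTopology.continuous_C (R := LaurentSeries k'))

lemma laurentConst_algebraMap (c : k) :
    laurentConst k k' (algebraMap k _ c) = algebraMap k (Fibre k (laurent k k')) c := by
  change (laurent k k').red _ = (laurent k k').red (algebraMap k _ c)
  congr 1
  rw [algebraMap_eq_algebraMap_C, ← (laurentSeriesEquiv k k').symm_apply_apply
    (algebraMap (PowerSeries k) _ _), laurentSeriesEquiv_algebraMap, PowerSeries.map_C]
  rfl

lemma laurentConst_constantCoeff (y : laurent k k') :
    laurentConst k k' (constantCoeff (laurentSeriesEquiv k k' y)) = (laurent k k').red y := by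
  rw [← sub_eq_zero]
  change (laurent k k').red _ - _ = 0
  rw [← map_sub, red_eq_zero_iff, ← map_dvd_iff (laurentSeriesEquiv k k'), map_sub,
    laurentSeriesEquiv_par, X_dvd_iff, map_sub]
  change constantCoeff (laurentSeriesEquiv k k' ((laurentSeriesEquiv k k').symm (C _))) - _ = 0
  rw [RingEquiv.apply_symm_apply, constantCoeff_C, sub_self]

/-- The tautological presentation of the identity of `k'((s))⟦t⟧`. -/
lemma isPresentation_laurent :
    IsPresentation (ContinuousAlgEquiv.refl (PowerSeries k) (Trunc k (laurent k k') 2))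
      (ContinuousAlgHom.id k _)
      ((PowerSeries.map (laurentConst k k')).comp (laurentSeriesEquiv k k').toRingHom)
      ((PowerSeries.map (laurentConst k k')).comp (laurentSeriesEquiv k k').toRingHom) := by
  have hc : Continuous ((PowerSeries.map (laurentConst k k')).comp
      (laurentSeriesEquiv k k').toRingHom) :=
    continuous_powerSeries_map (continuous_laurentConst k k')
  have ha : ∀ a, (PowerSeries.map (laurentConst k k')) (laurentSeriesEquiv k k'
      (algebraMap (PowerSeries k) (laurent k k') a)) =
        PowerSeries.map (algebraMap k (Fibre k (laurent k k'))) a := fun a => by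
    rw [laurentSeriesEquiv_algebraMap]
    ext n : 1
    rw [coeff_map, coeff_map, coeff_map, laurentConst_algebraMap]
  refine ⟨hc, hc, ha, ha, fun y => ?_, fun x y hxy => ?_⟩
  · change constantCoeff (PowerSeries.map (laurentConst k k') (laurentSeriesEquiv k k' y)) = _
    rw [← coeff_zero_eq_constantCoeff_apply, coeff_map, coeff_zero_eq_constantCoeff_apply,
      laurentConst_constantCoeff]
    rfl
  · rw [← map_sub]
    have h1 := map_dvd ((PowerSeries.map (laurentConst k k')).comp
      (laurentSeriesEquiv k k').toRingHom) (red₂_eq_iff.1 hxy)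
    rw [map_pow] at h1
    rwa [show ((PowerSeries.map (laurentConst k k')).comp (laurentSeriesEquiv k k').toRingHom)
      (par k (laurent k k')) = PowerSeries.X from (ha X).trans (map_X _)] at h1

variable {k k'} in
lemma coeff_eq_of_red₂_eq {x y : laurent k k'}
    (h : (laurent k k').red₂ x = (laurent k k').red₂ y) {n : ℕ} (hn : n < 2) :
    coeff n (laurentSeriesEquiv k k' x) = coeff n (laurentSeriesEquiv k k' y) := by
  have h1 := map_dvd (laurentSeriesEquiv k k') (red₂_eq_iff.1 h)
  rw [map_pow, laurentSeriesEquiv_par, X_pow_dvd_iff] at h1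
  have := h1 n hn
  rwa [map_sub, map_sub, sub_eq_zero] at this

end Normalisation

end Presentations

/-! ### The canonical form -/

section CanonicalForm

open PowerSeries

variable {k : Type u} [Field k] [CharZero k]

/-- A chosen chart of `Y`. -/
def Obj.chart (Y : Obj k) : Y →+* PowerSeries (Fibre k Y) := (exists_isChart Y).choose

lemma isChart_chart (Y : Obj k) : IsChart Y Y.chart := (exists_isChart Y).choose_spec

/-- A chosen lifting, in the chosen charts, of an isomorphism of truncations. -/
def liftIso₂ {X Y : Obj k} (χ : X.Iso₂ Y) : PowerSeries (Fibre k X) ≃+* PowerSeries (Fibre k Y) :=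
  (exists_powerSeries_lift χ (isChart_chart X) (isChart_chart Y)).choose

lemma liftIso₂_spec {X Y : Obj k} (χ : X.Iso₂ Y) :
    Continuous (liftIso₂ χ) ∧ Continuous (liftIso₂ χ).symm ∧
      (∀ a, liftIso₂ χ (PowerSeries.map (algebraMap k (Fibre k X)) a) =
        PowerSeries.map (algebraMap k (Fibre k Y)) a) ∧
      ∀ x y, χ (X.red₂ x) = Y.red₂ y → PowerSeries.X ^ 2 ∣ liftIso₂ χ (X.chart x) - Y.chart y :=
  (exists_powerSeries_lift χ (isChart_chart X) (isChart_chart Y)).choose_spec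

lemma isPresentation_liftIso₂ {X Y : Obj k} (χ : X.Iso₂ Y) :
    IsPresentation χ (ContinuousAlgHom.id k (Fibre k Y))
      ((liftIso₂ χ : PowerSeries (Fibre k X) →+* PowerSeries (Fibre k Y)).comp X.chart) Y.chart where
  cont_left := (liftIso₂_spec χ).1.comp (isChart_chart X).inducing.continuous
  cont_right := (isChart_chart Y).inducing.continuous
  algebraMap_left a := by
    rw [RingHom.comp_apply, (isChart_chart X).algebraMap]
    exact (liftIso₂_spec χ).2.2.1 a
  algebraMap_right := (isChart_chart Y).algebraMap
  constantCoeff y := by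
    rw [← coeff_zero_eq_constantCoeff_apply, (isChart_chart Y).coeff_zero]
    rfl
  compat := (liftIso₂_spec χ).2.2.2

variable (k) in
/-- The canonical form `ω(p̃, p̂, χ)`: the explicit formula in the chosen presentation. -/
def canonicalForm : Assignment k := fun X Y χ p =>
  formValue k (fun i => liftIso₂ χ (X.chart (p.fst i))) (fun i => Y.chart (p.snd i))

/-- The canonical form can be computed in any presentation. -/
theorem map_canonicalForm {X Y : Obj k} {χ : X.Iso₂ Y} {B : Type u} [CommRing B] [Algebra k B]
    [TopologicalSpace B] [IsDomain B] [IsTopologicalRing B] {h : Fibre k Y →A[k] B}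
    {l : X →+* PowerSeries B} {κ : Y →+* PowerSeries B} (hB : HasRankOneForms k B)
    (hinj : Function.Injective h) (hp : IsPresentation χ h l κ) (p : Beta3 χ) :
    Form.map k h (canonicalForm k X Y χ p) =
      formValue k (fun i => l (p.fst i)) (fun i => κ (p.snd i)) := by
  rw [canonicalForm, Form.map_formValue _ _ fun i =>
    (((p.fst i).isUnit.map X.chart).map (liftIso₂ χ))]
  exact formValue_eq_of_isPresentation (hasRankOneForms_fibre Y) hB hinj
    ((isPresentation_liftIso₂ χ).map h) hp p

/-- For presentations over the closed fibre itself no push-forward is needed. -/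
lemma canonicalForm_eq {X Y : Obj k} {χ : X.Iso₂ Y} {l : X →+* PowerSeries (Fibre k Y)}
    {κ : Y →+* PowerSeries (Fibre k Y)}
    (hp : IsPresentation χ (ContinuousAlgHom.id k (Fibre k Y)) l κ) (p : Beta3 χ) :
    canonicalForm k X Y χ p = formValue k (fun i => l (p.fst i)) (fun i => κ (p.snd i)) := by
  have := Y.fibreDomain
  rw [← map_canonicalForm (hasRankOneForms_fibre Y) Function.injective_id hp, Form.map_id]

/-- The canonical form is compatible with all morphisms that are injective on the closed fibre. -/
lemma push_canonicalForm {X Y X' Y' : Obj k} {χ : X.Iso₂ Y} {ψ : X'.Iso₂ Y'} (f : X.Hom X')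
    (g : Y.Hom Y')
    (hfg : ∀ x y, χ (X.red₂ x) = Y.red₂ y → ψ (X'.red₂ (f x)) = Y'.red₂ (g y))
    (hg : ∀ y, par k Y' ∣ g y → par k Y ∣ y) {p : Beta3 χ} {q : Beta3 ψ} (hpq : p.IsImage f g q) :
    g.push (canonicalForm k X Y χ p) = canonicalForm k X' Y' ψ q := by
  have := Y'.fibreDomain
  have hinj : Function.Injective ((ContinuousAlgHom.id k (Fibre k Y')).comp g.fibre) := by
    rw [injective_iff_map_eq_zero]
    intro a ha
    obtain ⟨y, rfl⟩ := Ideal.Quotient.mk_surjective a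
    exact red_eq_zero_iff.2 (hg y (red_eq_zero_iff.1 ha))
  refine (map_canonicalForm (hasRankOneForms_fibre Y') hinj
    ((isPresentation_liftIso₂ ψ).comp f g hfg) p).trans ?_
  rw [canonicalForm]
  congr 1
  · funext i; rw [(hpq i).1]; rfl
  · funext i; rw [(hpq i).2]; rfl

theorem completionCompatible_canonicalForm : CompletionCompatible (canonicalForm k) := by
  intro X Y X' Y' c d _ hd χ ψ hψ p q hpq
  refine push_canonicalForm c d hψ (fun y hy => ?_) hpq
  have h1 := (hd.2 1).1 y
  rw [pow_one, pow_one] at h1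
  exact h1 (by rw [show (d : Y →ₐ[PowerSeries k] Y').toRingHom (par k Y) = par k Y' from map_par d]
               exact hy)

theorem functorial_canonicalForm : Functorial (canonicalForm k) := by
  intro X₁ Y₁ X₂ Y₂ χ₁ χ₂ f g hfg hg ψ₁ ψ₂ h₁ h₂ p q hpq
  refine push_canonicalForm f g (lifts_compat hfg h₁ h₂) (fun y hy => ?_) hpq
  obtain ⟨k', _, _, _, ι, -, hι⟩ := hg
  refine hι.1 y ?_
  obtain ⟨z, hz⟩ := hy
  change residueMap ι (g y) = 0
  have h0 : residueMap ι (par k Y₂) = 0 := by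
    change constantCoeff (laurentSeriesEquiv k k' (ι (par k Y₂))) = 0
    rw [map_par, laurentSeriesEquiv_par, constantCoeff_X]
  rw [hz, map_mul, h0, zero_mul]

theorem normalised_canonicalForm : Normalised (canonicalForm k) := by
  intro k' _ _ _ p
  rw [canonicalForm_eq (isPresentation_laurent k k')]
  have hc : ∀ i, (laurent k k').red₂ (p.fst i) = (laurent k k').red₂ (p.snd i) := p.compat
  exact isFormulaValue_formValue k (fun i => (p.fst i).isUnit.map (laurentSeriesEquiv k k'))
    (fun i => (p.snd i).isUnit.map (laurentSeriesEquiv k k'))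
    (fun i => coeff_eq_of_red₂_eq (hc i) two_pos)
    (fun i => coeff_eq_of_red₂_eq (hc i) one_lt_two)

end CanonicalForm

/-! ### Complete objects -/

section Complete

open PowerSeries

variable {k : Type u} [Field k]

/-- An isomorphism of power series rings over `k⟦t⟧` as an isomorphism of completions. -/
def completionIso {X Y : Obj k} (F : PowerSeries (Fibre k X) ≃+* PowerSeries (Fibre k Y))
    (hF : Continuous F) (hF' : Continuous F.symm)
    (hFa : ∀ a, F (PowerSeries.map (algebraMap k (Fibre k X)) a) =
      PowerSeries.map (algebraMap k (Fibre k Y)) a) : X.completion.Iso Y.completion where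
  toFun x := (completionEquiv Y).symm (F (completionEquiv X x))
  invFun y := (completionEquiv X).symm (F.symm (completionEquiv Y y))
  left_inv x := by
    beta_reduce
    rw [RingEquiv.apply_symm_apply, RingEquiv.symm_apply_apply, RingEquiv.symm_apply_apply]
  right_inv y := by
    beta_reduce
    rw [RingEquiv.apply_symm_apply, RingEquiv.apply_symm_apply, RingEquiv.symm_apply_apply]
  map_mul' x y := by rw [map_mul, map_mul, map_mul]
  map_add' x y := by rw [map_add, map_add, map_add]
  commutes' a := hFa a
  continuous_toFun := hF
  continuous_invFun := hF'

/-- A chart of a complete object is an isomorphism with the completion. -/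
def IsChart.iso {Y : Obj k} {κ : Y →+* PowerSeries (Fibre k Y)} (hκ : IsChart Y κ)
    (hY : Y.IsComplete) : Y.Iso Y.completion :=
  let e : Y ≃ Y.completion := Equiv.ofBijective hκ.hom (hκ.bijective hY)
  { e with
    map_mul' := map_mul hκ.hom
    map_add' := map_add hκ.hom
    commutes' := hκ.hom.toAlgHom.commutes
    continuous_toFun := hκ.hom.continuous
    continuous_invFun := by
      have h : Topology.IsInducing e := hκ.inducing
      exact h.continuous_iff.2 (continuous_id.congr fun x => (e.apply_symm_apply x).symm) }

lemma IsChart.completionEquiv_iso {Y : Obj k} {κ : Y →+* PowerSeries (Fibre k Y)}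
    (hκ : IsChart Y κ) (hY : Y.IsComplete) (y : Y) : completionEquiv Y (hκ.iso hY y) = κ y := rfl

lemma IsChart.apply_iso_symm {Y : Obj k} {κ : Y →+* PowerSeries (Fibre k Y)} (hκ : IsChart Y κ)
    (hY : Y.IsComplete) (z : Y.completion) : κ ((hκ.iso hY).symm z) = completionEquiv Y z := by
  rw [← hκ.completionEquiv_iso hY, ContinuousAlgEquiv.apply_symm_apply]

/-- In a chart that is an isomorphism, the constants define a splitting. -/
lemma IsChart.exists_isSplitting {Y : Obj k} {κ : Y →+* PowerSeries (Fibre k Y)}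
    (hκ : IsChart Y κ) (hY : Y.IsComplete) : ∃ φ : Fibre k Y →A[k] Y, IsSplitting φ := by
  let φ : Fibre k Y →+* Y := (hκ.iso hY).symm.toAlgEquiv.toRingEquiv.toRingHom.comp
    ((completionEquiv Y).symm.toRingHom.comp C)
  have hφ : ∀ a, κ (φ a) = C a := fun a => hκ.apply_iso_symm hY _
  refine ⟨⟨{ φ with commutes' := fun c => ?_ }, ?_⟩, fun a => ?_⟩
  · refine (hκ.bijective hY).1 ((hφ _).trans ?_)
    rw [algebraMap_eq_algebraMap_C, hκ.algebraMap, map_C]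
  · exact (hκ.iso hY).symm.continuous.comp
      (PowerSeries.WithPiTopology.continuous_C (R := Fibre k Y))
  · change Y.red (φ a) = a
    rw [← hκ.coeff_zero, hφ, coeff_zero_C]

/-- A splitting of a complete object extends uniquely to an isomorphism with a ring of power
series. -/
lemma existsUnique_extendsSplitting {Y : Obj k} (hY : Y.IsComplete) {φ : Fibre k Y →A[k] Y}
    (hφ : IsSplitting φ) : ∃! e : PowerSeries (Fibre k Y) ≃+* Y, ExtendsSplitting φ e := by
  have hcomp : IsAdicComplete (Ideal.span {par k Y}) Y := hY
  let φ' : Fibre k Y →+* Y := (φ : Fibre k Y →ₐ[k] Y).toRingHom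
  have hφ' : ∀ a, Y.red (φ' a) = a := hφ
  obtain ⟨E, hC, hX⟩ := exists_powerSeries_eval (par k Y) φ'
  have hb : Function.Bijective E := powerSeries_eval_bijective (S := par k Y) (φ := φ')
    (fun x => par_mul_cancel Y)
    (fun a ha => by rwa [← red_eq_zero_iff, hφ'] at ha)
    (fun c => ⟨Y.red c, by rw [← red_eq_zero_iff, map_sub, hφ', sub_self]⟩) hC hX
  refine ⟨RingEquiv.ofBijective E hb, ⟨hC, hX⟩, fun e he => ?_⟩
  have hh : IsHausdorff (Ideal.span {(e : PowerSeries (Fibre k Y) →+* Y) X}) Y := by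
    rw [show (e : PowerSeries (Fibre k Y) →+* Y) X = par k Y from he.2]
    infer_instance
  have h1 : (e : PowerSeries (Fibre k Y) →+* Y) = E :=
    powerSeries_hom_ext (fun a => (he.1 a).trans (hC a).symm) (he.2.trans hX.symm)
  exact RingEquiv.ext fun f => DFunLike.congr_fun h1 f

lemma ExtendsSplitting.map_algebraMap {Y : Obj k} (hY : Y.IsComplete) {φ : Fibre k Y →A[k] Y}
    {e : PowerSeries (Fibre k Y) ≃+* Y} (he : ExtendsSplitting φ e) (a : PowerSeries k) :
    e (PowerSeries.map (algebraMap k (Fibre k Y)) a) = algebraMap (PowerSeries k) Y a := by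
  have hcomp : IsAdicComplete (Ideal.span {par k Y}) Y := hY
  let e' : PowerSeries k →+* Y := (e : PowerSeries (Fibre k Y) →+* Y).comp
    (PowerSeries.map (algebraMap k (Fibre k Y)))
  have hX : e' X = par k Y := (congrArg e (map_X _)).trans he.2
  have hh : IsHausdorff (Ideal.span {e' X}) Y := by
    rw [hX]
    infer_instance
  have hC : ∀ c, e' (C c) = algebraMap (PowerSeries k) Y (C c) := fun c => by
    rw [← algebraMap_eq_algebraMap_C]
    refine (congrArg e (map_C _ c)).trans ((he.1 _).trans ?_)
    exact (φ : Fibre k Y →ₐ[k] Y).commutes c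
  exact DFunLike.congr_fun (powerSeries_hom_ext hC hX) a

lemma ExtendsSplitting.constantCoeff_symm {Y : Obj k} {φ : Fibre k Y →A[k] Y} (hφ : IsSplitting φ)
    {e : PowerSeries (Fibre k Y) ≃+* Y} (he : ExtendsSplitting φ e) (y : Y) :
    PowerSeries.constantCoeff (e.symm y) = Y.red y := by
  obtain ⟨f, rfl⟩ := e.surjective y
  have h1 : X ∣ f - C (PowerSeries.constantCoeff f) := by
    rw [X_dvd_iff, map_sub, constantCoeff_C, sub_self]
  have h2 := map_dvd e h1
  rw [he.2, map_sub, he.1, ← red_eq_zero_iff, map_sub, hφ, sub_eq_zero] at h2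
  rw [h2, RingEquiv.symm_apply_apply]

/-- The isomorphism that extends a splitting has a continuous inverse. -/
lemma ExtendsSplitting.continuous_symm {Y : Obj k} {φ : Fibre k Y →A[k] Y} (hφ : IsSplitting φ)
    {e : PowerSeries (Fibre k Y) ≃+* Y} (he : ExtendsSplitting φ e)
    {κ : Y →+* PowerSeries (Fibre k Y)} (hκ : IsChart Y κ) : Continuous e.symm := by
  obtain ⟨F, hFC, hFX, -, hF'⟩ := exists_powerSeries_homeomorph
    (κ.comp (φ : Fibre k Y →ₐ[k] Y).toRingHom) (hκ.inducing.continuous.comp φ.continuous)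
    (Equiv.refl _) continuous_id fun a => (hκ.coeff_zero _).trans (hφ a)
  -- In the chart, `e` is a homeomorphism of power series rings.
  let G : PowerSeries (Fibre k Y) →+* PowerSeries (Fibre k Y) :=
    κ.comp (e : PowerSeries (Fibre k Y) →+* Y)
  have hGX : G X = X := (congrArg κ he.2).trans hκ.map_par
  have hh : IsHausdorff (Ideal.span {G X}) (PowerSeries (Fibre k Y)) := by
    rw [hGX]
    infer_instance
  have hG : G = (F : PowerSeries (Fibre k Y) →+* PowerSeries (Fibre k Y)) :=
    powerSeries_hom_ext (fun a => (congrArg κ (he.1 a)).trans (hFC a).symm) (hGX.trans hFX.symm)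
  refine (hF'.comp hκ.inducing.continuous).congr fun y => ?_
  obtain ⟨f, rfl⟩ := e.surjective y
  rw [e.symm_apply_apply]
  exact (congrArg F.symm (DFunLike.congr_fun hG f)).trans (F.symm_apply_apply f)

/-- A lifting of `χ` and a splitting define a presentation of `χ`. -/
lemma ExtendsSplitting.isPresentation {X Y : Obj k} (hY : Y.IsComplete) {χ : X.Iso₂ Y}
    {f : X.Iso Y} (hf : Lifts f χ) {φ : Fibre k Y →A[k] Y} (hφ : IsSplitting φ)
    {e : PowerSeries (Fibre k Y) ≃+* Y} (he : ExtendsSplitting φ e)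
    {κ : Y →+* PowerSeries (Fibre k Y)} (hκ : IsChart Y κ) :
    IsPresentation χ (ContinuousAlgHom.id k (Fibre k Y))
      (e.symm.toRingHom.comp f.toAlgEquiv.toRingEquiv.toRingHom) e.symm.toRingHom where
  cont_left := (he.continuous_symm hφ hκ).comp f.continuous
  cont_right := he.continuous_symm hφ hκ
  algebraMap_left a := by
    change e.symm (f (algebraMap (PowerSeries k) X a)) = _
    rw [show f (algebraMap (PowerSeries k) X a) = _ from f.toAlgEquiv.commutes a,
      ← he.map_algebraMap hY, e.symm_apply_apply]
  algebraMap_right a := by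
    change e.symm (algebraMap (PowerSeries k) Y a) = _
    rw [← he.map_algebraMap hY, e.symm_apply_apply]
  constantCoeff := he.constantCoeff_symm hφ
  compat x y hxy := by
    rw [hf, red₂_eq_iff] at hxy
    have h1 := map_dvd e.symm hxy
    rw [map_pow, e.symm_apply_eq.2 he.2.symm, map_sub] at h1
    exact h1

variable [CharZero k]

/-- For complete objects `χ` lifts, since charts are isomorphisms. -/
lemma exists_iso_lifts {X Y : Obj k} (hX : X.IsComplete) (hY : Y.IsComplete) (χ : X.Iso₂ Y) :
    ∃ f : X.Iso Y, Lifts f χ := by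
  obtain ⟨h1, h2, h3, h4⟩ := liftIso₂_spec χ
  refine ⟨(((isChart_chart X).iso hX).trans (completionIso _ h1 h2 h3)).trans
    ((isChart_chart Y).iso hY).symm, fun x => ?_⟩
  obtain ⟨y, hy⟩ := exists_iso₂_lift χ x
  rw [hy, eq_comm, red₂_eq_iff, ← (isChart_chart Y).pow_dvd_iff, map_sub]
  refine (h4 x y hy).trans (dvd_of_eq ?_)
  congr 1
  exact ((isChart_chart Y).apply_iso_symm hY _).symm

theorem definedByFormula_canonicalForm : DefinedByFormula (canonicalForm k) := by
  intro X Y hX hY χ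
  have hκ := isChart_chart Y
  refine ⟨exists_iso_lifts hX hY χ, hκ.exists_isSplitting hY, fun f hf φ hφ =>
    ⟨existsUnique_extendsSplitting hY hφ, fun e he p => ?_⟩⟩
  have hp := he.isPresentation hY hf hφ hκ
  rw [canonicalForm_eq hp]
  have h := isFormulaValue_formValue k (ρ := RingHom.id (Fibre k Y))
    (fun i => ((p.fst i).isUnit.map f).map e.symm) (fun i => (p.snd i).isUnit.map e.symm)
    (fun i => (hp.coeff_eq (p.compat i)).1) (fun i => (hp.coeff_eq (p.compat i)).2)
  simp only [PowerSeries.map_id] at h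
  exact h

end Complete

/-! ### Uniqueness -/

section Uniqueness

open PowerSeries

variable {k : Type u} [Field k]

/-- The image of a pair of triples under compatible morphisms. -/
lemma Beta3.exists_isImage {X Y X' Y' : Obj k} {χ : X.Iso₂ Y} {ψ : X'.Iso₂ Y'} (f : X.Hom X')
    (g : Y.Hom Y')
    (hfg : ∀ x y, χ (X.red₂ x) = Y.red₂ y → ψ (X'.red₂ (f x)) = Y'.red₂ (g y)) (p : Beta3 χ) :
    ∃ q : Beta3 ψ, p.IsImage f g q :=
  ⟨⟨fun i => Units.map (f : X →* X') (p.fst i), fun i => Units.map (g : Y →* Y') (p.snd i), fun i =>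
    hfg _ _ (p.compat i)⟩, fun _ => ⟨rfl, rfl⟩⟩

variable [CharZero k]

/-- The normalisation determines the form of triples over `k'((s))⟦t⟧`. -/
lemma Normalised.eq {ω ω' : Assignment k} (h : Normalised ω) (h' : Normalised ω') (k' : Type u)
    [Field k'] [Algebra k k'] [FiniteDimensional k k']
    (p : Beta3 (ContinuousAlgEquiv.refl (PowerSeries k) (Trunc k (laurent k k') 2))) :
    ω _ _ _ p = ω' _ _ _ p := by
  have hu : ∀ i, IsUnit (laurentSeriesEquiv k k' (p.fst i)) := fun i =>
    (p.fst i).isUnit.map (laurentSeriesEquiv k k')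
  rw [(h k' p).eq_formValue k hu, (h' k' p).eq_formValue k hu]

/-- Expansion at a place of the closed fibre of the completion reduces the determination of `ω` to
the normalisation. -/
theorem Assignment.ext_of_normalised {ω ω' : Assignment k} (h₁ : Normalised ω)
    (h₂ : CompletionCompatible ω) (h₃ : Functorial ω) (h₁' : Normalised ω')
    (h₂' : CompletionCompatible ω') (h₃' : Functorial ω') : ω = ω' := by
  funext X Y χ p
  obtain ⟨hF, hF', hFa, hFχ⟩ := liftIso₂_spec χ
  let f := completionIso _ hF hF' hFa
  obtain ⟨ψ, hψ⟩ := exists_lifts f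
  have hκX := isChart_chart X
  have hκY := isChart_chart Y
  have hχψ : ∀ x y, χ (X.red₂ x) = Y.red₂ y →
      ψ (X.completion.red₂ (hκX.hom x)) = Y.completion.red₂ (hκY.hom y) := fun x y hxy => by
    rw [hψ, red₂_eq_iff, ← map_dvd_iff (completionEquiv Y), map_pow, map_sub]
    rw [show completionEquiv Y (par k Y.completion) = PowerSeries.X from tubeEquiv_par k _]
    exact hFχ x y hxy
  obtain ⟨q, hq⟩ := p.exists_isImage hκX.hom hκY.hom hχψ
  obtain ⟨k', _, _, _, θ, hinj, hd⟩ := exists_fibre_germ Y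
  let γ : X.completion.Hom (laurent k k') := (germHom θ).comp (f : X.completion.Hom Y.completion)
  have hγ : ∀ x, germHom θ (f x) =
      ContinuousAlgEquiv.refl (PowerSeries k) (laurent k k') (γ x) := fun x => rfl
  have hrefl : Lifts (ContinuousAlgEquiv.refl (PowerSeries k) (laurent k k') :
      (laurent k k').Iso (laurent k k'))
      (ContinuousAlgEquiv.refl (PowerSeries k) (Trunc k (laurent k k') 2)) := fun x => rfl
  obtain ⟨r, hr⟩ := q.exists_isImage γ (germHom θ) (lifts_compat hγ hψ hrefl)
  have hgerm := isGermIso_germHom hinj hd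
  refine push_germHom_injective hκY hinj hd ?_
  change (germHom θ).push (hκY.hom.push (ω X Y χ p)) =
    (germHom θ).push (hκY.hom.push (ω' X Y χ p))
  rw [h₂ _ _ _ _ _ _ hκX.isCompletion hκY.isCompletion χ ψ hχψ p q hq,
    h₂' _ _ _ _ _ _ hκX.isCompletion hκY.isCompletion χ ψ hχψ p q hq,
    h₃ _ _ _ _ _ _ γ (germHom θ) hγ hgerm ψ _ hψ hrefl q r hr,
    h₃' _ _ _ _ _ _ γ (germHom θ) hγ hgerm ψ _ hψ hrefl q r hr]
  exact h₁.eq h₁' k' r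

end Uniqueness

end CanonicalForm

theorem mainTheorem12 (k : Type*) [Field k] [CharZero k] :
    ∃ ω : CanonicalForm.Assignment k,
      (CanonicalForm.Normalised ω ∧ CanonicalForm.CompletionCompatible ω ∧
        CanonicalForm.Functorial ω) ∧
      (∀ ω' : CanonicalForm.Assignment k, CanonicalForm.Normalised ω' →
        CanonicalForm.CompletionCompatible ω' → CanonicalForm.Functorial ω' → ω' = ω) ∧
      CanonicalForm.DefinedByFormula ω := by
  open CanonicalForm in
  exact ⟨canonicalForm k, ⟨normalised_canonicalForm, completionCompatible_canonicalForm,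
    functorial_canonicalForm⟩, fun ω' h₁ h₂ h₃ => Assignment.ext_of_normalised h₁ h₂ h₃
      normalised_canonicalForm completionCompatible_canonicalForm functorial_canonicalForm,
    definedByFormula_canonicalForm⟩
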